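/- Let $k$ be an algebraically closed field and let $C$ be a basic, connected, finite dimensional $k$-algebra with a fixed complete set $\{e_x\}_{x\in C_0}$ of primitive orthogonal idempotents (its points). Modules are finitely generated right modules, $I_x=\operatorname{Hom}_k(Ce_x,k)$ is the indecomposable injective $C$-module at the point $x$, and $\tau=D\,\mathrm{Tr}$ is the Auslander–Reiten translation. For indecomposable modules write $M\leadsto N$ if there is a path of nonzero morphisms between indecomposable modules from $M$ to $N$. Assume that $C$ is a tilted algebra of tree type, that is, $C\cong\operatorname{End}_A(T)$ where $A$ is a finite dimensional basic hereditary $k$-algebra whose ordinary quiver is a tree and $T$ is a tilting $A$-module. Assume further that $\operatorname{mod} C$ has a rightmost slice $\Sigma^+$, that is, a complete slice all of whose sources are injective $C$-modules. Here a complete slice is a full subquiver $\Sigma$ of the Auslander–Reiten quiver of $\operatorname{mod} C$ that is sincere and convex (if $M\leadsto X\leadsto N$ with $M,N\in\Sigma$, then $X\in\Sigma$), that contains at most one of $M,\tau M$ for each indecomposable non-projective $M$, and such that, whenever $M\to N$ is an arrow of the Auslander–Reiten quiver with $N\in\Sigma$, either $M\in\Sigma$, or $M$ is not injective and $\tau^{-1}M\in\Sigma$.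 Then there exists a point $x$ of $C$ that is a strong sink (no indecomposable injective module $J\not\cong I_x$ satisfies $J\leadsto I_x$) and for which a completion $G_x$ exists, that is, a non-empty full connected subquiver $G_x$ of $\Sigma^+$ such that (a) $I_x\in G_x$; (b) $G_x$ is closed under predecessors in $\Sigma^+$; (c) if $I\to M$ is an arrow in $\Sigma^+$ with $I\in G_x$ injective, then $M\in G_x$; (d) if $N\to I$ is an arrow in $\Sigma^+$ with $I\in G_x$ injective, then $N$ is injective and $N\in G_x$. -/

import Mathlib

open CategoryTheory MulOpposite

universe u

namespace TiltedTree

section Algebras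

/-! ### Algebras, their points, and their ordinary quivers

Right `C`-modules are modules over `Cᵐᵒᵖ`. -/

variable (k : Type u) [Field k] {C : Type u} [Ring C] [Algebra k C]

/-- `e` is a primitive idempotent: a nonzero idempotent that is not the sum of two nonzero
orthogonal idempotents. -/
def IsPrimitiveIdem (e : C) : Prop :=
  IsIdempotentElem e ∧ e ≠ 0 ∧
    ∀ f g : C, IsIdempotentElem f → IsIdempotentElem g → f * g = 0 → g * f = 0 →
      e = f + g → f = 0 ∨ g = 0

/-- The right module `e C`. -/
abbrev projRight (e : C) : Submodule Cᵐᵒᵖ C := Submodule.span Cᵐᵒᵖ {e}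

/-- The left module `C e`. -/
abbrev projLeft (e : C) : Submodule C C := Submodule.span C {e}

/-- `C` is basic and `(e x)` is its set of points: a complete set of primitive orthogonal
idempotents such that the right modules `e x C` are pairwise non-isomorphic. -/
structure IsPointSystem {ι : Type*} [Fintype ι] (e : ι → C) : Prop where
  complete : CompleteOrthogonalIdempotents e
  primitive : ∀ x, IsPrimitiveIdem (e x)
  basic : ∀ x y, Nonempty (projRight (e x) ≃ₗ[Cᵐᵒᵖ] projRight (e y)) → x = y

/-- `C` is connected: it is nonzero and not a product of two nonzero algebras. -/
def IsConnectedAlg (C : Type u) [Ring C] : Prop :=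
  Nontrivial C ∧ ∀ z : C, IsIdempotentElem z → (∀ c, z * c = c * z) → z = 0 ∨ z = 1

/-- `C` is (right) hereditary: right ideals are projective. -/
def IsHereditary (C : Type u) [Ring C] : Prop :=
  ∀ I : Submodule Cᵐᵒᵖ C, Module.Projective Cᵐᵒᵖ I

/-- The Jacobson radical of `C` as a subspace. -/
def rad (C : Type u) [Ring C] [Algebra k C] : Submodule k C :=
  (Ring.jacobson C).restrictScalars k

/-- The linear map `c ↦ e c f`. -/
def corner (e f : C) : C →ₗ[k] C := LinearMap.mulLeftRight k (e, f)

/-- The number of arrows between the points `e` and `f` (in one fixed direction) of the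
ordinary quiver of `C`: the dimension of
`e (rad C / rad² C) f = (e (rad C) f) / (e (rad² C) f)`. -/
noncomputable def numArrows (e f : C) : ℕ :=
  Module.finrank k
    (((rad k C).map (corner k e f)) ⧸
      ((rad k C * rad k C).map (corner k e f)).submoduleOf ((rad k C).map (corner k e f)))

/-- The ordinary quiver of `C`, with set of points `(e x)`, is a tree: there are no loops and no
multiple edges, and the underlying simple graph is a tree. -/
def QuiverIsTree {ι : Type*} (e : ι → C) : Prop :=
  (∀ x y, numArrows k (e x) (e y) + numArrows k (e y) (e x) ≤ 1) ∧
    (SimpleGraph.fromRel fun x y => numArrows k (e x) (e y) ≠ 0).IsTree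

end Algebras

section Tilting

/-! ### Tilting modules and tilted algebras -/

/-- `N` lies in `add T`: it is a direct summand of a finite direct sum of copies of `T`. -/
def InAdd {R : Type u} [Ring R] (T N : ModuleCat.{u} R) : Prop :=
  ∃ (n : ℕ) (i : N →ₗ[R] (Fin n → T)) (r : (Fin n → T) →ₗ[R] N), r ∘ₗ i = LinearMap.id

/-- `T` is a (classical) tilting right `A`-module: it is finitely generated of projective
dimension at most one, `Ext¹(T, T) = 0`, and there is an exact sequence
`0 → A → T₀ → T₁ → 0` with `T₀, T₁` in `add T`. -/
structure IsTilting (A : Type u) [Ring A] (T : ModuleCat.{u} Aᵐᵒᵖ) : Prop where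
  finite : Module.Finite Aᵐᵒᵖ T
  projDim : HasProjectiveDimensionLE T 1
  rigid : Subsingleton (Abelian.Ext T T 1)
  coresolution : ∃ (T₀ T₁ : ModuleCat.{u} Aᵐᵒᵖ) (f : A →ₗ[Aᵐᵒᵖ] T₀) (g : T₀ →ₗ[Aᵐᵒᵖ] T₁),
    InAdd T T₀ ∧ InAdd T T₁ ∧
      Function.Injective f ∧ Function.Exact f g ∧ Function.Surjective g

open scoped ModuleCat.Algebra in
/-- `C` is a tilted algebra of tree type: it is the endomorphism algebra of a tilting module over
a finite dimensional (basic) hereditary algebra `A` whose ordinary quiver is a tree. -/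
def IsTiltedOfTreeType (k : Type u) [Field k] (C : Type u) [Ring C] [Algebra k C] : Prop :=
  ∃ (A : Type u) (_ : Ring A) (_ : Algebra k A) (n : ℕ) (f : Fin n → A)
    (T : ModuleCat.{u} Aᵐᵒᵖ),
    FiniteDimensional k A ∧ IsHereditary A ∧ IsPointSystem f ∧ QuiverIsTree k f ∧
      IsTilting A T ∧ Nonempty (C ≃ₐ[k] Module.End Aᵐᵒᵖ T)

end Tilting

section Duality

/-! ### The duality `D` and the Auslander–Reiten translation `τ = D Tr` -/

variable (k : Type u) [Field k] {C : Type u} [Ring C] [Algebra k C]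

/-- The `k`-dual `D X` of a left `C`-module `X`. -/
def KDual (k X : Type u) [Field k] [AddCommGroup X] [Module k X] : Type u := X →ₗ[k] k

section

variable (X : Type u) [AddCommGroup X] [Module k X]

noncomputable instance : AddCommGroup (KDual k X) := inferInstanceAs (AddCommGroup (X →ₗ[k] k))

variable [Module C X] [IsScalarTower k C X]

/-- `D X` is a right `C`-module through `(φ c)(x) = φ (c x)`. -/
noncomputable instance : Module Cᵐᵒᵖ (KDual k X) where
  smul c φ := (LinearMap.comp φ (Algebra.lsmul k k X c.unop) : X →ₗ[k] k)
  one_smul φ := LinearMap.ext fun x => congrArg φ.toFun (one_smul C x)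
  mul_smul c d φ := LinearMap.ext fun x => congrArg φ.toFun (mul_smul d.unop c.unop x)
  smul_zero _ := LinearMap.ext fun _ => rfl
  smul_add _ _ _ := LinearMap.ext fun _ => rfl
  add_smul c d φ := LinearMap.ext fun x =>
    (congrArg φ.toFun (add_smul c.unop d.unop x)).trans (LinearMap.map_add φ _ _)
  zero_smul φ := LinearMap.ext fun x =>
    (congrArg φ.toFun (zero_smul C x)).trans (LinearMap.map_zero φ)

end

/-- The indecomposable injective right module `I_x = D (C e_x)` at the point `e = e_x`. -/
noncomputable def injAt (e : C) : ModuleCat.{u} Cᵐᵒᵖ := ModuleCat.of Cᵐᵒᵖ (KDual k (projLeft e))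

/-- The map of left `C`-modules `Hom_C(P₀, C) → Hom_C(P₁, C)` induced by `p : P₁ → P₀`. -/
def transposeMap {P₁ P₀ : ModuleCat.{u} Cᵐᵒᵖ} (p : P₁ →ₗ[Cᵐᵒᵖ] P₀) :
    (P₀ →ₗ[Cᵐᵒᵖ] C) →ₗ[C] (P₁ →ₗ[Cᵐᵒᵖ] C) where
  toFun f := f ∘ₗ p
  map_add' _ _ := rfl
  map_smul' _ _ := rfl

/-- The transpose: the cokernel of `Hom_C(P₀, C) → Hom_C(P₁, C)`, a left `C`-module. -/
abbrev Transpose {P₁ P₀ : ModuleCat.{u} Cᵐᵒᵖ} (p : P₁ →ₗ[Cᵐᵒᵖ] P₀) : Type u :=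
  (P₁ →ₗ[Cᵐᵒᵖ] C) ⧸ LinearMap.range (transposeMap p)

/-- A submodule is superfluous (small) if it has no proper supplement. -/
def IsSuperfluous {R M : Type u} [Ring R] [AddCommGroup M] [Module R M]
    (K : Submodule R M) : Prop :=
  ∀ L : Submodule R M, K ⊔ L = ⊤ → L = ⊤

/-- `P₁ → P₀ → M → 0` is a minimal projective presentation of `M` by finitely generated
modules. -/
structure IsMinPresentation {R : Type u} [Ring R] {P₁ P₀ M : ModuleCat.{u} R}
    (p₁ : P₁ →ₗ[R] P₀) (p₀ : P₀ →ₗ[R] M) : Prop where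
  finite₁ : Module.Finite R P₁
  finite₀ : Module.Finite R P₀
  projective₁ : Module.Projective R P₁
  projective₀ : Module.Projective R P₀
  exact : Function.Exact p₁ p₀
  surjective : Function.Surjective p₀
  minimal₁ : IsSuperfluous (LinearMap.ker p₁)
  minimal₀ : IsSuperfluous (LinearMap.ker p₀)

/-- `N ≅ τ M`, where `τ = D Tr` is computed from a minimal projective presentation of `M`. -/
def IsTau (N M : ModuleCat.{u} Cᵐᵒᵖ) : Prop :=
  ∃ (P₁ P₀ : ModuleCat.{u} Cᵐᵒᵖ) (p₁ : P₁ →ₗ[Cᵐᵒᵖ] P₀) (p₀ : P₀ →ₗ[Cᵐᵒᵖ] M),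
    IsMinPresentation p₁ p₀ ∧ Nonempty (N ≃ₗ[Cᵐᵒᵖ] KDual k (Transpose p₁))

end Duality

section ARQuiver

/-! ### The Auslander–Reiten quiver

Its points are the isomorphism classes of indecomposable finitely generated modules. A set of
points is given by an isomorphism-closed set of such modules, and a full subquiver by its set of
points. -/

variable {R : Type u} [Ring R]

/-- `M` is an indecomposable finitely generated module. -/
def IsInd (M : ModuleCat.{u} R) : Prop := Module.Finite R M ∧ Indecomposable M

/-- `f` is an irreducible morphism of the category of finitely generated modules. -/
def IsIrreducible {M N : ModuleCat.{u} R} (f : M ⟶ N) : Prop :=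
  ¬ IsSplitMono f ∧ ¬ IsSplitEpi f ∧
    ∀ (X : ModuleCat.{u} R) (g : M ⟶ X) (h : X ⟶ N), Module.Finite R X → g ≫ h = f →
      IsSplitMono g ∨ IsSplitEpi h

/-- There is an arrow `M → N` in the Auslander–Reiten quiver. -/
def Arrow (M N : ModuleCat.{u} R) : Prop :=
  IsInd M ∧ IsInd N ∧ ∃ f : M ⟶ N, IsIrreducible f

/-- `M ⇝ N`: there is a path of nonzero morphisms between indecomposable modules. -/
def Leads : ModuleCat.{u} R → ModuleCat.{u} R → Prop :=
  Relation.ReflTransGen fun M N => IsInd M ∧ IsInd N ∧ ∃ f : M ⟶ N, f ≠ 0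

/-- `S` is a set of points of the Auslander–Reiten quiver. -/
structure IsPointSet (S : Set (ModuleCat.{u} R)) : Prop where
  ind : ∀ M ∈ S, IsInd M
  iso : ∀ M ∈ S, ∀ N, Nonempty (M ≅ N) → N ∈ S

/-- There is a path `M → ⋯ → N` in the full subquiver with set of points `S`. -/
def PathIn (S : Set (ModuleCat.{u} R)) : ModuleCat.{u} R → ModuleCat.{u} R → Prop :=
  Relation.ReflTransGen fun M N => M ∈ S ∧ N ∈ S ∧ Arrow M N

/-- The full subquiver with set of points `S` is connected (and nonempty): any two points are
joined by a walk in it. -/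
def IsConnectedSubquiver (S : Set (ModuleCat.{u} R)) : Prop :=
  S.Nonempty ∧ ∀ M ∈ S, ∀ N ∈ S,
    Relation.ReflTransGen
      (fun X Y => X ∈ S ∧ Y ∈ S ∧ (Nonempty (X ≅ Y) ∨ Arrow X Y ∨ Arrow Y X)) M N

end ARQuiver

section Slices

/-! ### Complete slices, strong sinks, completions -/

variable (k : Type u) [Field k] {C : Type u} [Ring C] [Algebra k C]

/-- `S` is a complete slice of `mod C`. -/
structure IsCompleteSlice (S : Set (ModuleCat.{u} Cᵐᵒᵖ)) : Prop where
  points : IsPointSet S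
  /-- `S` is sincere. -/
  sincere : ∀ e : C, IsIdempotentElem e → e ≠ 0 → ∃ M ∈ S, ∃ m : M, op e • m ≠ 0
  /-- `S` is convex in `mod C`. -/
  convex : ∀ M ∈ S, ∀ N ∈ S, ∀ X, Leads M X → Leads X N → X ∈ S
  /-- For `M` indecomposable not projective, at most one of `M`, `τ M` belongs to `S`. -/
  tau : ∀ M N : ModuleCat.{u} Cᵐᵒᵖ, IsInd M → ¬ Projective M → IsTau k N M → ¬ (M ∈ S ∧ N ∈ S)
  /-- If `M → N` is an arrow with `N ∈ S`, then `M ∈ S`, or `M` is not injective and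
  `τ⁻¹ M ∈ S` (`τ⁻¹ M` is the indecomposable non-projective `L` with `τ L ≅ M`). -/
  arrow : ∀ M N : ModuleCat.{u} Cᵐᵒᵖ, N ∈ S → Arrow M N →
    M ∈ S ∨ (¬ Injective M ∧ ∃ L ∈ S, ¬ Projective L ∧ IsTau k M L)

/-- `S` is a rightmost slice: a complete slice all of whose sources are injective modules. -/
def IsRightmostSlice (S : Set (ModuleCat.{u} Cᵐᵒᵖ)) : Prop :=
  IsCompleteSlice k S ∧ ∀ M ∈ S, (∀ N ∈ S, ¬ Arrow N M) → Injective M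

/-- The point `e = e_x` is a strong sink: no indecomposable injective module other than `I_x`
is a predecessor of `I_x` in `mod C`. -/
def IsStrongSink (e : C) : Prop :=
  ∀ M : ModuleCat.{u} Cᵐᵒᵖ, IsInd M → Injective M → Leads M (injAt k e) →
    Nonempty (M ≅ injAt k e)

/-- `G` is a completion in the slice `S` of the point `e = e_x`. -/
structure IsCompletion (S : Set (ModuleCat.{u} Cᵐᵒᵖ)) (e : C)
    (G : Set (ModuleCat.{u} Cᵐᵒᵖ)) : Prop where
  points : IsPointSet G
  subset : G ⊆ S
  connected : IsConnectedSubquiver G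
  mem : injAt k e ∈ G
  pred : ∀ M ∈ G, ∀ N ∈ S, PathIn S N M → N ∈ G
  succ_inj : ∀ I ∈ G, Injective I → ∀ M ∈ S, Arrow I M → M ∈ G
  pred_inj : ∀ I ∈ G, Injective I → ∀ N ∈ S, Arrow N I → Injective N ∧ N ∈ G

end Slices

end TiltedTree

/-! The key fact is that the slice, as a directed graph, has fewer arrows than vertices
(`IsIrredundant.card_arrow_lt`). Call an arrow of the slice bad if it goes from a non-injective
module to an injective one, and delete the bad arrows. If every connected component of the rest were
entered by a bad arrow, then sending one root per component to such an arrow, and every other vertex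
to the first edge of a shortest path to its root, would inject the vertices into the arrows
(`exists_connectedComponent_of_card_lt`). So some component `G` is entered by no bad arrow, and it
is a completion: an arrow into `G` is good, hence starts in `G`, and starts at an injective if it
ends at one; an arrow leaving an injective is never bad. A vertex of `G` minimal for nonzero maps is
a source of the whole slice, hence injective, hence some `I_x`; and an injective source of a slice
belongs to a strong sink, because sincerity and convexity pull all its injective predecessors into
the slice (`IsCompleteSlice.isStrongSink`).

The inequality comes from the trace of the Coxeter transformation. Consider the matrices of
dimensions of Hom between slice modules, between indecomposable projective `C`-modules, and between
indecomposable projective `A`-modules. Slice modules, and the summands of the tilting module, have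
projective dimension at most one and no extensions among each other, so their classes in the
Grothendieck group of projectives (`IsGVector`) give congruences between these matrices. All three
have the same size: slice classes span by Bongartz's universal extension (`IsIrredundant.spanning`),
tilting summands span because `A` is coresolved by them (`IsTilting.sum_hdim_eq_zero`), and the
slice matrix is invertible. Sink maps give `c * (1 - a) = 1`, with `a` the matrix of multiplicities,
so the trace of `(1 - a)ᵀ * c` is a congruence invariant; since `c` has unit diagonal, it is the
size minus `∑ a i j * c i j`. For `A` this sum is at most the number of edges of the tree, since
each edge is a bridge and `c` is 1 along it (`sum_le_of_tree`). For the slice every arrow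
contributes at least 1.

The homological properties of the slice rest on one form of the Auslander–Reiten formula: for a
presentation `P₁ → P₀ → M → 0`, maps `N → D Tr M` are the linear forms on `Hom(P₁, N)` that vanish
on maps factoring through `P₀`. With `D Tr M ⇝ M` and convexity, it gives `Hom(N, D Tr M) = 0` for
slice modules. Projective dimension at most one, vanishing of `Ext¹`, nonvanishing of compositions
and sink maps all follow. -/

namespace TiltedTree

set_option linter.unusedSectionVars false

/-! ### Fitting's lemma and Krull–Schmidt decompositions. -/

section Indecomposables

variable {R : Type u} [Ring R]

theorem isInd_iff (M : ModuleCat.{u} R) :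
    IsInd M ↔ Module.Finite R M ∧ Nontrivial M ∧
      ∀ e : M →ₗ[R] M, e ∘ₗ e = e → e = 0 ∨ e = LinearMap.id := by
  unfold IsInd Indecomposable
  refine and_congr_right fun _ => ?_
  rw [ModuleCat.isZero_iff_subsingleton, not_subsingleton_iff_nontrivial]
  refine and_congr_right fun _ => ⟨fun h e he => ?_, fun h Y Z a => ?_⟩
  · have hc := LinearMap.IsIdempotentElem.isCompl (f := e) he
    let i : M ≅ ModuleCat.of R (LinearMap.range e) ⊞ ModuleCat.of R (LinearMap.ker e) :=
      (Submodule.prodEquivOfIsCompl _ _ hc).symm.toModuleIso ≪≫ 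
        (ModuleCat.biprodIsoProd (ModuleCat.of R (LinearMap.range e))
          (ModuleCat.of R (LinearMap.ker e))).symm
    rcases h _ _ i with h | h
    · left
      rw [ModuleCat.isZero_iff_subsingleton] at h
      ext x
      have := h.elim ⟨e x, x, rfl⟩ 0
      exact congrArg Subtype.val this
    · right
      rw [ModuleCat.isZero_iff_subsingleton] at h
      ext x
      have hx : x - e x ∈ LinearMap.ker e := by
        have : e (e x) = e x := LinearMap.congr_fun he x
        simp [this]
      have := congrArg Subtype.val (h.elim ⟨_, hx⟩ 0)
      exact (sub_eq_zero.mp this).symm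
  · let i := (a ≪≫ ModuleCat.biprodIsoProd Y Z).toLinearEquiv
    rw [ModuleCat.isZero_iff_subsingleton, ModuleCat.isZero_iff_subsingleton]
    let p : (Y × Z) →ₗ[R] (Y × Z) := LinearMap.inl R Y Z ∘ₗ LinearMap.fst R Y Z
    have key := h (i.symm.toLinearMap ∘ₗ p ∘ₗ i.toLinearMap) (by ext x; simp [p])
    rcases key with key | key
    · left
      refine ⟨fun y y' => ?_⟩
      have h1 : ∀ y : Y, y = 0 := fun y => by
        have h2 := LinearMap.congr_fun key (i.symm (y, 0))
        have h3 : i.symm (p (i (i.symm (y, 0)))) = 0 := h2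
        rw [LinearEquiv.apply_symm_apply, LinearEquiv.map_eq_zero_iff] at h3
        exact congrArg Prod.fst h3
      rw [h1 y, h1 y']
    · right
      refine ⟨fun z z' => ?_⟩
      have h1 : ∀ z : Z, z = 0 := fun z => by
        have h2 := LinearMap.congr_fun key (i.symm (0, z))
        have h3 : i.symm (p (i (i.symm (0, z)))) = i.symm (0, z) := h2
        rw [LinearEquiv.apply_symm_apply] at h3
        exact (congrArg Prod.snd (i.symm.injective h3)).symm
      rw [h1 z, h1 z']

theorem IsInd.finite {M : ModuleCat.{u} R} (h : IsInd M) : Module.Finite R M := h.1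

theorem IsInd.nontrivial {M : ModuleCat.{u} R} (h : IsInd M) : Nontrivial M :=
  ((isInd_iff M).1 h).2.1

theorem IsInd.of_linearEquiv {M N : ModuleCat.{u} R} (h : IsInd M) (e : M ≃ₗ[R] N) : IsInd N := by
  rw [isInd_iff] at h ⊢
  obtain ⟨h1, h2, h3⟩ := h
  refine ⟨Module.Finite.equiv e, e.symm.toEquiv.nontrivial, fun f hf => ?_⟩
  have hf' : ∀ x, f (f x) = f x := LinearMap.congr_fun hf
  rcases h3 (e.symm.toLinearMap ∘ₗ f ∘ₗ e.toLinearMap) (by ext x; simp [hf']) with h | h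
  · left
    ext x
    simpa using LinearMap.congr_fun h (e.symm x)
  · right
    ext x
    simpa [LinearEquiv.symm_apply_eq] using LinearMap.congr_fun h (e.symm x)

theorem not_bijective_of_isNilpotent {M : ModuleCat.{u} R} [Nontrivial M] {f : Module.End R M}
    (h : IsNilpotent f) : ¬ Function.Bijective f := by
  intro hb
  obtain ⟨n, hn⟩ := h
  have : Function.Bijective (f ^ n) := by
    rw [Module.End.coe_pow]
    exact hb.iterate n
  rw [hn] at this
  obtain ⟨x, hx⟩ := exists_ne (0 : M)
  exact hx (this.1 (by simp))

/-- A map with a one-sided inverse up to an automorphism is an isomorphism between indecomposable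
modules. -/
theorem IsInd.bijective_of_comp {M N : ModuleCat.{u} R} (hM : IsInd M) (hN : IsInd N)
    {f : M →ₗ[R] N} {g : N →ₗ[R] M} (h : Function.Bijective (g ∘ₗ f)) :
    Function.Bijective f ∧ Function.Bijective g := by
  let e := LinearEquiv.ofBijective _ h
  obtain ⟨-, -, h3⟩ := (isInd_iff N).1 hN
  have he : ∀ x, e.symm (g (f x)) = x := fun x => e.symm_apply_apply x
  have hb : Function.Bijective f := by
    rcases h3 (f ∘ₗ e.symm.toLinearMap ∘ₗ g) (by ext x; simp [he]) with h0 | h1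
    · exfalso
      have := hM.nontrivial
      obtain ⟨x, hx⟩ := exists_ne (0 : M)
      have h2 : f (e.symm (g (f x))) = 0 := LinearMap.congr_fun h0 (f x)
      rw [he] at h2
      exact hx (h.1 (by simp [h2]))
    · refine ⟨fun x y hxy => h.1 (congrArg g hxy), fun y => ⟨_, LinearMap.congr_fun h1 y⟩⟩
  refine ⟨hb, ?_⟩
  have : (g : N → M) = (g ∘ₗ f) ∘ (LinearEquiv.ofBijective f hb).symm := by
    funext y
    simp only [Function.comp_apply, LinearMap.comp_apply]
    congr 1
    exact ((LinearEquiv.ofBijective f hb).apply_symm_apply y).symm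
  rw [this]
  exact h.comp (LinearEquiv.bijective _)

variable [IsArtinianRing R]

/-- Fitting's lemma: kernel and range of a high power are complementary, and indecomposability makes
the corresponding projection 0 or the identity. -/
theorem IsInd.bijective_or_isNilpotent {M : ModuleCat.{u} R} (h : IsInd M) (f : Module.End R M) :
    Function.Bijective f ∨ IsNilpotent f := by
  obtain ⟨h1, h2, h3⟩ := (isInd_iff M).1 h
  have : IsArtinian R M := inferInstance
  have : IsNoetherian R M := inferInstance
  obtain ⟨n, hn, hpos⟩ := ((f.eventually_isCompl_ker_pow_range_pow).and
    (Filter.eventually_ge_atTop 1)).exists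
  have hI := Submodule.isIdempotentElem_projection hn.symm
  rcases h3 _ hI with h | h
  · right
    refine ⟨n, ?_⟩
    have := Submodule.range_projection hn.symm
    rw [h, LinearMap.range_zero] at this
    exact LinearMap.range_eq_bot.1 this.symm
  · left
    have hk := Submodule.ker_projection hn.symm
    rw [h, LinearMap.ker_id] at hk
    obtain ⟨m, rfl⟩ : ∃ m, n = m + 1 := ⟨n - 1, by omega⟩
    have hinj : Function.Injective f := by
      rw [← LinearMap.ker_eq_bot, eq_bot_iff, hk]
      intro x hx
      rw [LinearMap.mem_ker, pow_succ]
      simp [LinearMap.mem_ker.1 hx]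
    exact IsArtinian.bijective_of_injective_endomorphism f hinj

theorem IsInd.bijective_of_add {M : ModuleCat.{u} R} (h : IsInd M) {f g : M →ₗ[R] M}
    (hfg : f + g = LinearMap.id) : Function.Bijective f ∨ Function.Bijective g := by
  rcases h.bijective_or_isNilpotent f with hf | hf
  · exact Or.inl hf
  · right
    have hu : IsUnit (1 - f : Module.End R M) := IsNilpotent.isUnit_one_sub hf
    have : g = (1 - f : Module.End R M) := by
      rw [eq_sub_iff_add_eq, add_comm]; exact hfg
    rw [this]
    exact (Module.End.isUnit_iff _).1 hu

/-- The endomorphism ring is local: dividing by the sum reduces to two endomorphisms adding up to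
the identity. -/
theorem IsInd.not_bijective_add {M : ModuleCat.{u} R} (h : IsInd M) {f g : M →ₗ[R] M}
    (hf : ¬ Function.Bijective f) (hg : ¬ Function.Bijective g) :
    ¬ Function.Bijective (f + g) := by
  intro hb
  let e := LinearEquiv.ofBijective _ hb
  have h1 : (e.symm.toLinearMap ∘ₗ f) + (e.symm.toLinearMap ∘ₗ g) = LinearMap.id := by
    rw [← LinearMap.comp_add]
    ext x
    exact e.symm_apply_apply x
  rcases h.bijective_of_add h1 with h2 | h2
  · exact hf (by simpa using h2)
  · exact hg (by simpa using h2)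

theorem IsInd.exists_bijective_of_sum {M : ModuleCat.{u} R} (h : IsInd M) {ι : Type*}
    (s : Finset ι) (f : ι → M →ₗ[R] M) (hf : Function.Bijective (∑ i ∈ s, f i : M →ₗ[R] M)) :
    ∃ i ∈ s, Function.Bijective (f i) := by
  classical
  by_contra! hne
  suffices H : ¬ Function.Bijective (∑ i ∈ s, f i : M →ₗ[R] M) from H hf
  clear hf
  induction s using Finset.induction_on with
  | empty =>
    have := h.nontrivial
    exact not_bijective_of_isNilpotent IsNilpotent.zero
  | insert a s ha ih =>
    rw [Finset.sum_insert ha]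
    exact h.not_bijective_add (hne a (Finset.mem_insert_self _ _))
      (ih fun i hi => hne i (Finset.mem_insert_of_mem hi))

/-- Induction on length: a nontrivial idempotent splits the module into its range and its kernel,
both shorter. -/
theorem exists_linearEquiv_pi (M : ModuleCat.{u} R) [Module.Finite R M] :
    ∃ (ι : Type) (_ : Fintype ι) (X : ι → ModuleCat.{u} R), (∀ i, IsInd (X i)) ∧
      Nonempty (M ≃ₗ[R] ∀ i, X i) := by
  obtain ⟨n, hn⟩ : ∃ n : ℕ, Module.length R M = n :=
    ⟨_, (ENat.natCast_toNat Module.length_ne_top).symm⟩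
  induction n using Nat.strong_induction_on generalizing M with
  | _ n ih =>
    rcases subsingleton_or_nontrivial M with hs | hs
    · refine ⟨Empty, inferInstance, Empty.elim, fun i => i.elim, ⟨?_⟩⟩
      exact LinearEquiv.ofSubsingleton _ _
    by_cases hI : IsInd M
    · exact ⟨Unit, inferInstance, fun _ => M, fun _ => hI,
        ⟨(LinearEquiv.funUnique Unit R M).symm⟩⟩
    rw [isInd_iff] at hI
    push Not at hI
    obtain ⟨e, he, h0, h1⟩ := hI inferInstance hs
    have hc := LinearMap.IsIdempotentElem.isCompl (f := e) he
    have lt (K : Submodule R M) (hK : K ≠ ⊤) : ∃ m : ℕ, m < n ∧ Module.length R K = m := by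
      have h2 := Submodule.length_lt hK
      rw [hn] at h2
      have h3 : Module.length R K ≠ ⊤ := (h2.trans (ENat.natCast_lt_top n)).ne
      refine ⟨_, ?_, (ENat.natCast_toNat h3).symm⟩
      rw [← ENat.natCast_toNat h3] at h2
      exact_mod_cast h2
    have hr : LinearMap.range e ≠ ⊤ := by
      intro h
      apply h1
      ext x
      obtain ⟨y, rfl⟩ := LinearMap.range_eq_top.1 h x
      exact LinearMap.congr_fun he y
    have hk : LinearMap.ker e ≠ ⊤ := fun h => h0 (LinearMap.ker_eq_top.1 h)
    obtain ⟨a, ha, ha'⟩ := lt _ hr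
    obtain ⟨b, hb, hb'⟩ := lt _ hk
    obtain ⟨ι, _, X, hX, ⟨eX⟩⟩ := ih a ha (ModuleCat.of R (LinearMap.range e)) ha'
    obtain ⟨κ, _, Y, hY, ⟨eY⟩⟩ := ih b hb (ModuleCat.of R (LinearMap.ker e)) hb'
    refine ⟨ι ⊕ κ, inferInstance, Sum.elim X Y, by rintro (i | i) <;> simp [hX, hY], ⟨?_⟩⟩
    exact (Submodule.prodEquivOfIsCompl _ _ hc).symm ≪≫ₗ (eX.prodCongr eY) ≪≫ₗ
      (LinearEquiv.sumPiEquivProdPi R ι κ (fun i => (Sum.elim X Y i : ModuleCat.{u} R))).symm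

/-- The identity of `X` is the sum of the composites through the factors `L j`. By locality one of
these composites is bijective. -/
theorem IsInd.exists_linearEquiv_of_retract {X : ModuleCat.{u} R} (hX : IsInd X) {κ : Type*}
    [Fintype κ] {L : κ → ModuleCat.{u} R} (hL : ∀ j, IsInd (L j))
    (i : X →ₗ[R] ∀ j, L j) (r : (∀ j, L j) →ₗ[R] X) (h : r ∘ₗ i = LinearMap.id) :
    ∃ j, Nonempty (X ≃ₗ[R] L j) := by
  classical
  have hsum : ∑ j, (r ∘ₗ LinearMap.single R (fun j => (L j : Type u)) j) ∘ₗ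
      (LinearMap.proj j ∘ₗ i) = LinearMap.id := by
    rw [← h]
    ext x
    simp only [LinearMap.sum_apply, LinearMap.comp_apply, LinearMap.proj_apply]
    rw [← map_sum]
    congr 1
    exact Finset.univ_sum_single (i x)
  obtain ⟨j, -, hj⟩ := hX.exists_bijective_of_sum Finset.univ _
    (by rw [hsum]; exact Function.bijective_id)
  exact ⟨j, ⟨LinearEquiv.ofBijective _ (hX.bijective_of_comp (hL j) hj).1⟩⟩

theorem exists_linearEquiv_pi_of_retract {Q : ModuleCat.{u} R} [Module.Finite R Q] {κ : Type*}
    [Fintype κ] {L : κ → ModuleCat.{u} R} (hL : ∀ j, IsInd (L j))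
    (i : Q →ₗ[R] ∀ j, L j) (r : (∀ j, L j) →ₗ[R] Q) (h : r ∘ₗ i = LinearMap.id) :
    ∃ (ι : Type) (_ : Fintype ι) (c : ι → κ), Nonempty (Q ≃ₗ[R] ∀ i, L (c i)) := by
  classical
  obtain ⟨ι, _, X, hX, ⟨e⟩⟩ := exists_linearEquiv_pi Q
  have (a : ι) : ∃ j, Nonempty (X a ≃ₗ[R] L j) := by
    refine (hX a).exists_linearEquiv_of_retract hL
      (i ∘ₗ e.symm.toLinearMap ∘ₗ LinearMap.single R (fun a => (X a : Type u)) a)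
      (LinearMap.proj a ∘ₗ e.toLinearMap ∘ₗ r) ?_
    ext x
    have h' : ∀ q, r (i q) = q := LinearMap.congr_fun h
    simp [h']
  choose c hc using this
  exact ⟨ι, inferInstance, c, ⟨e ≪≫ₗ LinearEquiv.piCongrRight fun a => (hc a).some⟩⟩

end Indecomposables

/-! ### Vanishing of `Ext¹` without resolutions, and pushouts of extensions. -/

section Extensions

variable {R : Type u} [Ring R]

/-- Every extension of `M` by a module `K` becomes split after pushing out along any map
`K → N`; that is, `Ext¹(M, N) = 0`. -/
def ExtZero (M N : ModuleCat.{u} R) : Prop :=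
  ∀ (X : ModuleCat.{u} R) (π : X →ₗ[R] M), Function.Surjective π →
    ∀ t : LinearMap.ker π →ₗ[R] N, ∃ s : X →ₗ[R] N, s ∘ₗ (LinearMap.ker π).subtype = t

theorem exists_comp_eq_of_ker_le {X Y N : Type*} [AddCommGroup X] [Module R X] [AddCommGroup Y]
    [Module R Y] [AddCommGroup N] [Module R N] {s : X →ₗ[R] Y} (hs : Function.Surjective s)
    {m : X →ₗ[R] N} (h : LinearMap.ker s ≤ LinearMap.ker m) : ∃ m' : Y →ₗ[R] N, m' ∘ₗ s = m := by
  refine ⟨(LinearMap.ker s).liftQ m h ∘ₗ (s.quotKerEquivOfSurjective hs).symm.toLinearMap, ?_⟩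
  ext x
  have : (s.quotKerEquivOfSurjective hs).symm (s x) = (LinearMap.ker s).mkQ x := by
    rw [LinearEquiv.symm_apply_eq]; rfl
  simp [this]

/-- Lifting `P₀` to `X` exhibits `X` as a quotient of `P₀ × ker π`, on which the extended map is
visible. The map `i` need not be injective, so any projective presentation can serve as a test. -/
theorem ExtZero.of_exact {P₁ P₀ M N : ModuleCat.{u} R} [Module.Projective R P₀]
    {i : P₁ →ₗ[R] P₀} {p : P₀ →ₗ[R] M} (he : Function.Exact i p) (hp : Function.Surjective p)
    (h : ∀ t : P₁ →ₗ[R] N, ∃ s : P₀ →ₗ[R] N, s ∘ₗ i = t) : ExtZero M N := by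
  intro X π hπ t
  obtain ⟨l, hl⟩ := Module.projective_lifting_property π p hπ
  have hl' : ∀ x, π (l x) = p x := LinearMap.congr_fun hl
  obtain ⟨v, hv⟩ := h (t ∘ₗ (l ∘ₗ i).codRestrict (LinearMap.ker π) fun x => by
    simp [hl', he.apply_apply_eq_zero])
  have hsurj : Function.Surjective (l.coprod (LinearMap.ker π).subtype) := by
    intro x
    obtain ⟨y, hy⟩ := hp (π x)
    exact ⟨(y, ⟨x - l y, by simp [hl', hy]⟩), by simp⟩
  obtain ⟨s, hs⟩ := exists_comp_eq_of_ker_le hsurj (m := v.coprod t) (by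
    rintro ⟨y, κ⟩ hy
    have hy' : l y + (κ : X) = 0 := by simpa using hy
    have h1 : p y = 0 := by
      rw [← hl', eq_neg_of_add_eq_zero_left hy', map_neg, LinearMap.mem_ker.1 κ.2, neg_zero]
    obtain ⟨z, rfl⟩ := (he y).1 h1
    have h2 : v (i z) = t ⟨l (i z), _⟩ := LinearMap.congr_fun hv z
    rw [LinearMap.mem_ker, LinearMap.coprod_apply, h2, ← map_add]
    convert map_zero t
    exact Subtype.ext hy')
  refine ⟨s, ?_⟩
  ext κ
  simpa using LinearMap.congr_fun hs (0, κ)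

theorem ExtZero.exists_extend {P₁ P₀ M N : ModuleCat.{u} R} (h : ExtZero M N)
    {i : P₁ →ₗ[R] P₀} {p : P₀ →ₗ[R] M} (hi : Function.Injective i) (he : Function.Exact i p)
    (hp : Function.Surjective p) (t : P₁ →ₗ[R] N) : ∃ s : P₀ →ₗ[R] N, s ∘ₗ i = t := by
  have hk : LinearMap.ker p = LinearMap.range i := LinearMap.exact_iff.1 he
  let e : P₁ ≃ₗ[R] LinearMap.ker p := (LinearEquiv.ofInjective i hi) ≪≫ₗ LinearEquiv.ofEq _ _ hk.symm
  obtain ⟨s, hs⟩ := h P₀ p hp (t ∘ₗ e.symm.toLinearMap)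
  refine ⟨s, ?_⟩
  ext x
  have h1 : s (e x).1 = t (e.symm (e x)) := LinearMap.congr_fun hs (e x)
  rwa [LinearEquiv.symm_apply_apply] at h1

theorem ExtZero.retract_right {M N N' : ModuleCat.{u} R} (h : ExtZero M N)
    (a : N' →ₗ[R] N) (b : N →ₗ[R] N') (hab : b ∘ₗ a = LinearMap.id) : ExtZero M N' := by
  intro X π hπ t
  obtain ⟨s, hs⟩ := h X π hπ (a ∘ₗ t)
  exact ⟨b ∘ₗ s, by rw [LinearMap.comp_assoc, hs, ← LinearMap.comp_assoc, hab, LinearMap.id_comp]⟩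

/-- Pull the extension of `M'` back along `b`. The result is an extension of `M` with the same
kernel, and `x ↦ (x, a (π x))` maps `X` back into it. -/
theorem ExtZero.retract_left {M M' N : ModuleCat.{u} R} (h : ExtZero M N)
    (a : M' →ₗ[R] M) (b : M →ₗ[R] M') (hab : b ∘ₗ a = LinearMap.id) : ExtZero M' N := by
  intro X π hπ t
  have hab' : ∀ x, b (a x) = x := LinearMap.congr_fun hab
  let Y : Submodule R (X × M) :=
    LinearMap.ker (π ∘ₗ LinearMap.fst R X M - b ∘ₗ LinearMap.snd R X M)
  have hY : ∀ z : X × M, z ∈ Y ↔ π z.1 = b z.2 := fun z => by simp [Y, sub_eq_zero]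
  let π' : Y →ₗ[R] M := LinearMap.snd R X M ∘ₗ Y.subtype
  have hπ' : Function.Surjective π' := fun m => by
    obtain ⟨x, hx⟩ := hπ (b m)
    exact ⟨⟨(x, m), (hY _).2 hx⟩, rfl⟩
  obtain ⟨s, hs⟩ := h (ModuleCat.of R Y) π' hπ'
    (t ∘ₗ (LinearMap.fst R X M ∘ₗ Y.subtype ∘ₗ (LinearMap.ker π').subtype).codRestrict
      (LinearMap.ker π) fun z => by
        have h1 := (hY _).1 z.1.2
        have h2 : z.1.1.2 = 0 := z.2
        simp only [LinearMap.comp_apply, Submodule.subtype_apply, LinearMap.fst_apply,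
          LinearMap.mem_ker]
        rw [h1, h2, map_zero])
  refine ⟨s ∘ₗ (LinearMap.id.prod (a ∘ₗ π)).codRestrict Y (fun x => (hY _).2 (by simp [hab'])), ?_⟩
  ext κ
  have h1 : ((κ : X), a (π κ)) = ((κ : X), (0 : M)) := by
    rw [LinearMap.mem_ker.1 κ.2, map_zero]
  have h2 := LinearMap.congr_fun hs ⟨⟨((κ : X), (0 : M)), (hY _).2 (by simp)⟩, rfl⟩
  have h3 : ((LinearMap.id.prod (a ∘ₗ π)).codRestrict Y
      (fun x => (hY _).2 (by simp [hab']))) (κ : X) =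
      ⟨((κ : X), (0 : M)), (hY _).2 (by simp)⟩ := Subtype.ext h1
  simp only [LinearMap.comp_apply, Submodule.subtype_apply] at h2 ⊢
  rw [h3, h2]
  rfl

theorem ExtZero.pi_right {M : ModuleCat.{u} R} {ι : Type*} {N : ι → ModuleCat.{u} R}
    {N' : ModuleCat.{u} R} (e : N' ≃ₗ[R] ∀ i, N i)
    (h : ∀ i, ExtZero M (N i)) : ExtZero M N' := by
  intro X π hπ t
  choose s hs using fun i => h i X π hπ (LinearMap.proj i ∘ₗ e.toLinearMap ∘ₗ t)
  refine ⟨e.symm.toLinearMap ∘ₗ LinearMap.pi s, ?_⟩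
  ext κ
  simp only [LinearMap.comp_apply, LinearEquiv.coe_coe, LinearEquiv.symm_apply_eq]
  funext i
  exact LinearMap.congr_fun (hs i) κ

/-- Restrict the extension to the preimage `Y i` of each factor and solve there. Since `X` is the
sum of `ker π` and the `Y i`, the solutions glue, as all of them agree with `t` on `ker π`. -/
theorem ExtZero.pi_left {N M : ModuleCat.{u} R} {ι : Type*} [Fintype ι]
    {L : ι → ModuleCat.{u} R} (e : M ≃ₗ[R] ∀ i, L i)
    (h : ∀ i, ExtZero (L i) N) : ExtZero M N := by
  classical
  intro X π hπ t
  let Y (i : ι) : Submodule R X :=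
    (LinearMap.range (LinearMap.single R (fun i => (L i : Type u)) i)).comap (e.toLinearMap ∘ₗ π)
  have hY (i : ι) (y : Y i) : e (π y) = Pi.single i (e (π y) i) := by
    obtain ⟨y, z, hz⟩ := y
    have hz' : Pi.single i z = e (π y) := hz
    rw [← hz', Pi.single_eq_same]
  let f (i : ι) : Y i →ₗ[R] L i := LinearMap.proj i ∘ₗ e.toLinearMap ∘ₗ π ∘ₗ (Y i).subtype
  have hf (i : ι) : Function.Surjective (f i) := fun z => by
    obtain ⟨x, hx⟩ := hπ (e.symm (Pi.single i z))
    have hx' : e (π x) = Pi.single i z := by rw [hx, LinearEquiv.apply_symm_apply]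
    refine ⟨⟨x, z, hx'.symm⟩, ?_⟩
    simp [f, hx']
  have hk (i : ι) (y : LinearMap.ker (f i)) : π y.1.1 = 0 := by
    have h1 : e (π y.1.1) i = 0 := y.2
    have h2 := hY i y.1
    rw [h1, Pi.single_zero] at h2
    exact (LinearEquiv.map_eq_zero_iff e).1 h2
  choose s hs using fun i => h i (ModuleCat.of R (Y i)) (f i) (hf i)
    (t ∘ₗ ((Y i).subtype ∘ₗ (LinearMap.ker (f i)).subtype).codRestrict (LinearMap.ker π) (hk i))
  have hs' (i : ι) (y : Y i) (hy : π y = 0) : s i y = t ⟨y, hy⟩ :=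
    LinearMap.congr_fun (hs i) ⟨y, by simp [f, hy]⟩
  let a : (LinearMap.ker π × ∀ i, Y i) →ₗ[R] X :=
    (LinearMap.ker π).subtype.coprod (LinearMap.lsum R (fun i => Y i) ℕ fun i => (Y i).subtype)
  have ha (κ y) : a (κ, y) = κ + ∑ i, (y i : X) := by simp [a]
  have hsurj : Function.Surjective a := by
    intro x
    have (i : ι) : ∃ y : Y i, e (π y) = Pi.single i (e (π x) i) := by
      obtain ⟨y, hy⟩ := hπ (e.symm (Pi.single i (e (π x) i)))
      have hy' : e (π y) = Pi.single i (e (π x) i) := by rw [hy, LinearEquiv.apply_symm_apply]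
      exact ⟨⟨y, _, hy'.symm⟩, hy'⟩
    choose y hy using this
    refine ⟨(⟨x - ∑ i, (y i : X), ?_⟩, y), by rw [ha]; simp⟩
    rw [LinearMap.mem_ker, ← LinearEquiv.map_eq_zero_iff e]
    simp only [map_sub, map_sum, hy]
    rw [Finset.univ_sum_single, sub_self]
  obtain ⟨v, hv⟩ := exists_comp_eq_of_ker_le hsurj
    (m := t.coprod (LinearMap.lsum R (fun i => Y i) ℕ s)) (by
      rintro ⟨κ, y⟩ hy
      rw [LinearMap.mem_ker, ha] at hy
      have h1 : ∑ i, e (π (y i)) = 0 := by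
        have := congrArg (fun x => e (π x)) hy
        simpa [LinearMap.mem_ker.1 κ.2] using this
      have h2 (i : ι) : π (y i) = 0 := by
        rw [← LinearEquiv.map_eq_zero_iff e, hY]
        have h3 := congrFun h1 i
        rw [Finset.sum_apply, Finset.sum_eq_single i] at h3
        · rw [h3]; simp
        · intro j _ hj
          rw [hY]
          exact Pi.single_eq_of_ne (Ne.symm hj) _
        · simp
      have h4 : (t.coprod (LinearMap.lsum R (fun i => Y i) ℕ s)) (κ, y) =
          t (κ + ∑ i, ⟨y i, h2 i⟩) := by
        simp only [LinearMap.coprod_apply, LinearMap.lsum_apply, LinearMap.sum_apply,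
          LinearMap.comp_apply, LinearMap.proj_apply, map_add, map_sum]
        congr 1
        exact Finset.sum_congr rfl fun i _ => hs' i _ _
      rw [LinearMap.mem_ker, h4]
      convert map_zero t
      apply Subtype.ext
      simpa using hy)
  refine ⟨v, ?_⟩
  ext κ
  have := LinearMap.congr_fun hv (κ, 0)
  simp only [LinearMap.comp_apply, ha] at this
  simpa using this

/-- The condition on kernels replaces injectivity of `i` and keeps `a` injective. The last two
clauses present `E` by `P₁ → P₀ × N`, which becomes a projective resolution of `E` when `N` is
projective. -/
theorem exists_pushout {P₁ P₀ M N : ModuleCat.{u} R} {i : P₁ →ₗ[R] P₀} {p : P₀ →ₗ[R] M}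
    (he : Function.Exact i p) (hp : Function.Surjective p) {t : P₁ →ₗ[R] N}
    (ht : LinearMap.ker i ≤ LinearMap.ker t) :
    ∃ (E : ModuleCat.{u} R) (a : N →ₗ[R] E) (π : E →ₗ[R] M) (j : P₀ →ₗ[R] E),
      Function.Injective a ∧ Function.Exact a π ∧ Function.Surjective π ∧ j ∘ₗ i = a ∘ₗ t ∧
      π ∘ₗ j = p ∧ Function.Surjective (j.coprod a) ∧
      Function.Exact (i.prod (-t)) (j.coprod a) := by
  let K : Submodule R (P₀ × N) := LinearMap.range (i.prod (-t))
  have hK : ∀ z : P₀ × N, z ∈ K ↔ ∃ x, i x = z.1 ∧ -t x = z.2 := fun z => by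
    simp [K, Prod.ext_iff]
  let j : P₀ →ₗ[R] ((P₀ × N) ⧸ K) := K.mkQ ∘ₗ LinearMap.inl R P₀ N
  let a : N →ₗ[R] ((P₀ × N) ⧸ K) := K.mkQ ∘ₗ LinearMap.inr R P₀ N
  have hja : j.coprod a = K.mkQ := by
    ext x <;> simp [j, a]
  let π : ((P₀ × N) ⧸ K) →ₗ[R] M := K.liftQ (p ∘ₗ LinearMap.fst R P₀ N) (by
    intro z hz
    obtain ⟨x, hx, -⟩ := (hK z).1 hz
    simp [← hx, he.apply_apply_eq_zero])
  have hπ : ∀ z, π (K.mkQ z) = p z.1 := fun z => by simp [π]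
  refine ⟨ModuleCat.of R ((P₀ × N) ⧸ K), a, π, j, ?_, ?_, ?_, ?_, ?_, ?_, ?_⟩
  · rw [← LinearMap.ker_eq_bot, eq_bot_iff]
    intro n hn
    have h1 : ((0 : P₀), n) ∈ K := (Submodule.Quotient.mk_eq_zero K).1 hn
    obtain ⟨x, hx, hx'⟩ := (hK _).1 h1
    have h2 : t x = 0 := ht hx
    have h3 : -t x = n := hx'
    rw [Submodule.mem_bot, ← h3, h2, neg_zero]
  · intro z
    obtain ⟨⟨x, n⟩, rfl⟩ := K.mkQ_surjective z
    rw [hπ]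
    constructor
    · intro hx
      obtain ⟨y, hy⟩ := (he x).1 hx
      refine ⟨n + t y, ?_⟩
      have h1 : ((x, n) : P₀ × N) - (0, n + t y) ∈ K := (hK _).2 ⟨y, by simpa using hy, by simp⟩
      exact ((Submodule.Quotient.eq K).2 h1).symm
    · rintro ⟨m, hm⟩
      have h1 : π (a m) = 0 := (hπ (0, m)).trans (map_zero p)
      rw [hm, hπ] at h1
      exact h1
  · intro m
    obtain ⟨x, hx⟩ := hp m
    exact ⟨K.mkQ (x, 0), by rw [hπ]; exact hx⟩
  · ext x
    refine (Submodule.Quotient.eq K).2 ((hK _).2 ⟨x, ?_, ?_⟩) <;> simp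
  · ext x
    exact hπ (x, 0)
  · rw [hja]
    exact K.mkQ_surjective
  · rw [hja]
    intro z
    rw [← LinearMap.mem_ker, Submodule.ker_mkQ]
    rfl

/-- A retraction onto the sub in a short exact sequence yields a section of the quotient map and
conversely. -/
theorem exists_retraction_of_section {N E M : Type*} [AddCommGroup N] [Module R N]
    [AddCommGroup E] [Module R E] [AddCommGroup M] [Module R M] {a : N →ₗ[R] E} {π : E →ₗ[R] M}
    (ha : Function.Injective a) (he : Function.Exact a π) {σ : M →ₗ[R] E}
    (hσ : π ∘ₗ σ = LinearMap.id) : ∃ r : E →ₗ[R] N, r ∘ₗ a = LinearMap.id := by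
  have hσ' : ∀ x, π (σ x) = x := LinearMap.congr_fun hσ
  let e := LinearEquiv.ofInjective a ha
  refine ⟨e.symm.toLinearMap ∘ₗ (LinearMap.id - σ ∘ₗ π).codRestrict (LinearMap.range a)
    (fun x => (he _).1 (by simp [hσ'])), ?_⟩
  ext x
  simp only [LinearMap.comp_apply, LinearEquiv.coe_coe, LinearMap.id_apply,
    LinearEquiv.symm_apply_eq]
  apply Subtype.ext
  change a x - σ (π (a x)) = a x
  rw [he.apply_apply_eq_zero, map_zero, sub_zero]

end Extensions

/-! ### Paths of nonzero maps coming from non-split sequences. -/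

section Paths

variable {R : Type u} [Ring R]

theorem Leads.of_ne_zero {M N : ModuleCat.{u} R} (hM : IsInd M) (hN : IsInd N) {f : M →ₗ[R] N}
    (hf : f ≠ 0) : Leads M N :=
  Relation.ReflTransGen.single ⟨hM, hN, ModuleCat.ofHom f, fun h => hf (by
    simpa using congrArg ModuleCat.Hom.hom h)⟩

theorem Leads.trans {L M N : ModuleCat.{u} R} (h : Leads L M) (h' : Leads M N) : Leads L N :=
  Relation.ReflTransGen.trans h h'

theorem exists_component_ne_zero {N E M : ModuleCat.{u} R} {ι : Type*} [Fintype ι]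
    {X : ι → ModuleCat.{u} R} (e : E ≃ₗ[R] ∀ i, X i) {a : N →ₗ[R] E} {π : E →ₗ[R] M}
    (h : π ∘ₗ a ≠ 0) [DecidableEq ι] : ∃ i, (π ∘ₗ e.symm.toLinearMap ∘ₗ
      LinearMap.single R (fun i => (X i : Type u)) i) ∘ₗ (LinearMap.proj i ∘ₗ e.toLinearMap ∘ₗ a)
      ≠ 0 := by
  by_contra! hne
  apply h
  ext x
  have h1 : a x = e.symm (∑ i, Pi.single i (e (a x) i)) := by
    rw [Finset.univ_sum_single, LinearEquiv.symm_apply_apply]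
  rw [LinearMap.comp_apply, h1, map_sum, map_sum]
  exact Finset.sum_eq_zero fun i _ => LinearMap.congr_fun (hne i) x

theorem exists_proj_ne_zero {N E : ModuleCat.{u} R} {ι : Type*}
    {X : ι → ModuleCat.{u} R} (e : E ≃ₗ[R] ∀ i, X i) {a : N →ₗ[R] E} (h : a ≠ 0) :
    ∃ i, (LinearMap.proj i ∘ₗ e.toLinearMap ∘ₗ a : N →ₗ[R] X i) ≠ 0 := by
  by_contra! hne
  apply h
  ext x
  rw [LinearMap.zero_apply, ← LinearEquiv.map_eq_zero_iff e]
  funext i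
  exact LinearMap.congr_fun (hne i) x

variable [IsArtinianRing R]

/-- Some indecomposable summand of the middle term has nonzero components from `N` and to `M`;
otherwise the sequence splits. -/
theorem Leads.of_nonsplit {N E M : ModuleCat.{u} R} [Module.Finite R E] (hN : IsInd N)
    (hM : IsInd M) {a : N →ₗ[R] E} {π : E →ₗ[R] M} (ha : Function.Injective a)
    (he : Function.Exact a π) (hπ : Function.Surjective π)
    (hns : ¬ ∃ r : E →ₗ[R] N, r ∘ₗ a = LinearMap.id) : Leads N M := by
  classical
  obtain ⟨ι, _, X, hX, ⟨e⟩⟩ := exists_linearEquiv_pi E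
  let π' (i : ι) : X i →ₗ[R] M :=
    π ∘ₗ e.symm.toLinearMap ∘ₗ LinearMap.single R (fun i => (X i : Type u)) i
  let a' (i : ι) : N →ₗ[R] X i := LinearMap.proj i ∘ₗ e.toLinearMap ∘ₗ a
  by_cases H : ∃ i, π' i ≠ 0 ∧ a' i ≠ 0
  · obtain ⟨i, h1, h2⟩ := H
    exact (Leads.of_ne_zero hN (hX i) h2).trans (Leads.of_ne_zero (hX i) hM h1)
  push Not at H
  exfalso
  -- If no summand meets both `a` and `π`, the projection onto the summands not killed by `π`
  -- vanishes on `a` and does not change `π`. It therefore descends to a section of `π`.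
  let q : E →ₗ[R] E := ∑ i with π' i ≠ 0, e.symm.toLinearMap ∘ₗ
    LinearMap.single R (fun i => (X i : Type u)) i ∘ₗ LinearMap.proj i ∘ₗ e.toLinearMap
  have hqa (x : N) : q (a x) = 0 := by
    simp only [q, LinearMap.sum_apply]
    refine Finset.sum_eq_zero fun i hi => ?_
    have h1 : e (a x) i = 0 := LinearMap.congr_fun (H i (Finset.mem_filter.1 hi).2) x
    simp [h1]
  have hπq (x : E) : π (q x) = π x := by
    have h1 : x = e.symm (∑ i, Pi.single i (e x i)) := by
      rw [Finset.univ_sum_single, LinearEquiv.symm_apply_apply]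
    conv_rhs => rw [h1]
    simp only [q, LinearMap.sum_apply, map_sum]
    refine Finset.sum_subset (Finset.subset_univ _) fun i _ hi => ?_
    have h2 : π' i = 0 := by simpa using hi
    exact LinearMap.congr_fun h2 _
  obtain ⟨σ, hσ⟩ := exists_comp_eq_of_ker_le hπ (m := q) (by
    intro x hx
    obtain ⟨y, rfl⟩ := (he x).1 hx
    exact hqa y)
  refine hns (exists_retraction_of_section ha he (σ := σ) ?_)
  ext m
  obtain ⟨x, rfl⟩ := hπ m
  have : σ (π x) = q x := LinearMap.congr_fun hσ x
  simp [this, hπq]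

end Paths

/-! ### Projective covers and minimal presentations. -/

section ProjectiveCovers

variable {R : Type u} [Ring R] [IsArtinianRing R]

/-- Take a projective of minimal length mapping onto `M`. A supplement `L` of the kernel yields an
endomorphism over `M` with image in `L`; the stable range of its powers is a projective summand
still mapping onto `M`, hence everything. -/
theorem exists_projective_cover (M : ModuleCat.{u} R) [Module.Finite R M] :
    ∃ (P : ModuleCat.{u} R) (p : P →ₗ[R] M), Module.Finite R P ∧ Module.Projective R P ∧
      Function.Surjective p ∧ IsSuperfluous (LinearMap.ker p) := by
  classical
  have hex : ∃ n : ℕ, ∃ (P : ModuleCat.{u} R) (p : P →ₗ[R] M), Module.Finite R P ∧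
      Module.Projective R P ∧ Function.Surjective p ∧ Module.length R P = n := by
    obtain ⟨m, f, hf⟩ := Module.Finite.exists_fin' R M
    exact ⟨_, ModuleCat.of R (Fin m → R), f, inferInstance, inferInstance, hf,
      (ENat.natCast_toNat Module.length_ne_top).symm⟩
  obtain ⟨P, p, h1, h2, h3, h4⟩ := Nat.find_spec hex
  have hmin := @Nat.find_min _ _ hex
  refine ⟨P, p, h1, h2, h3, fun L hL => ?_⟩
  have hsurj : Function.Surjective (p ∘ₗ L.subtype) := by
    intro m
    obtain ⟨x, rfl⟩ := h3 m
    obtain ⟨y, hy, z, hz, rfl⟩ := Submodule.mem_sup.1 (hL ▸ Submodule.mem_top : x ∈ _ ⊔ L)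
    exact ⟨⟨z, hz⟩, by simp [LinearMap.mem_ker.1 hy]⟩
  obtain ⟨s, hs⟩ := Module.projective_lifting_property _ p hsurj
  let f : Module.End R P := L.subtype ∘ₗ s
  have hf : ∀ x, p (f x) = p x := LinearMap.congr_fun hs
  have hfn : ∀ n x, p ((f ^ n) x) = p x := by
    intro n
    induction n with
    | zero => simp
    | succ n ih => intro x; rw [pow_succ']; exact (hf _).trans (ih x)
  obtain ⟨n, hn, hpos⟩ := ((f.eventually_isCompl_ker_pow_range_pow).and
    (Filter.eventually_ge_atTop 1)).exists
  have hrange : LinearMap.range (f ^ n) = ⊤ := by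
    by_contra hne
    have hlt := Submodule.length_lt hne
    rw [h4] at hlt
    have h5 : Module.length R (LinearMap.range (f ^ n)) ≠ ⊤ :=
      (hlt.trans (ENat.natCast_lt_top _)).ne
    rw [← ENat.natCast_toNat h5] at hlt
    refine hmin (by exact_mod_cast hlt) ⟨ModuleCat.of R (LinearMap.range (f ^ n)),
      p ∘ₗ (LinearMap.range (f ^ n)).subtype, inferInstance, ?_, ?_,
      (ENat.natCast_toNat h5).symm⟩
    · exact Module.Projective.of_split (LinearMap.range (f ^ n)).subtype
        (Submodule.projectionOnto _ _ hn.symm) (Submodule.projectionOnto_comp_subtype hn.symm)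
    · intro m
      obtain ⟨x, rfl⟩ := h3 m
      exact ⟨⟨_, x, rfl⟩, hfn n x⟩
  rw [eq_top_iff, ← hrange]
  rintro _ ⟨x, rfl⟩
  obtain ⟨m, rfl⟩ : ∃ m, n = m + 1 := ⟨n - 1, by omega⟩
  rw [pow_succ']
  exact (s _).2

theorem exists_minPresentation (M : ModuleCat.{u} R) [Module.Finite R M] :
    ∃ (P₁ P₀ : ModuleCat.{u} R) (p₁ : P₁ →ₗ[R] P₀) (p₀ : P₀ →ₗ[R] M),
      IsMinPresentation p₁ p₀ := by
  obtain ⟨P₀, p₀, h1, h2, h3, h4⟩ := exists_projective_cover M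
  have : Module.Finite R (LinearMap.ker p₀) := inferInstance
  obtain ⟨P₁, q, h5, h6, h7, h8⟩ :=
    exists_projective_cover (ModuleCat.of R (LinearMap.ker p₀))
  have hk : LinearMap.ker ((LinearMap.ker p₀).subtype ∘ₗ q) = LinearMap.ker q := by
    ext x; simp
  have hr : LinearMap.range ((LinearMap.ker p₀).subtype ∘ₗ q) = LinearMap.ker p₀ := by
    rw [LinearMap.range_comp, LinearMap.range_eq_top.2 h7, Submodule.map_top,
      Submodule.range_subtype]
  refine ⟨P₁, P₀, (LinearMap.ker p₀).subtype ∘ₗ q, p₀, h5, h1, h6, h2, ?_, h3, ?_, h4⟩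
  · rw [LinearMap.exact_iff]
    exact hr.symm
  · rw [hk]
    exact h8

end ProjectiveCovers

open scoped ModuleCat.Algebra

/-! ### The duality `D` on finite dimensional modules. -/

section KDual

variable {k : Type u} [Field k]

section

variable {X : Type u} [AddCommGroup X] [Module k X]

instance : FunLike (KDual k X) X k := inferInstanceAs (FunLike (X →ₗ[k] k) X k)

instance : LinearMapClass (KDual k X) k X k :=
  inferInstanceAs (LinearMapClass (X →ₗ[k] k) k X k)

/-- A linear form, seen as an element of the dual. -/
def toKDual (φ : X →ₗ[k] k) : KDual k X := φ

theorem KDual.ext {φ ψ : KDual k X} (h : ∀ x, φ x = ψ x) : φ = ψ := LinearMap.ext h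

theorem KDual.add_apply (φ ψ : KDual k X) (x : X) : (φ + ψ) x = φ x + ψ x := rfl

theorem KDual.zero_apply (x : X) : (0 : KDual k X) x = 0 := rfl

end

variable {C : Type u} [Ring C] [Algebra k C]
variable {X Y : Type u} [AddCommGroup X] [Module k X] [Module C X] [IsScalarTower k C X]
  [AddCommGroup Y] [Module k Y] [Module C Y] [IsScalarTower k C Y]

theorem KDual.smul_apply (c : Cᵐᵒᵖ) (φ : KDual k X) (x : X) : (c • φ) x = φ (c.unop • x) := rfl

theorem KDual.algebraMap_smul_apply (a : k) (φ : KDual k X) (x : X) :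
    (algebraMap k Cᵐᵒᵖ a • φ) x = a * φ x := by
  rw [KDual.smul_apply, MulOpposite.algebraMap_apply, unop_op, algebraMap_smul, map_smul,
    smul_eq_mul]

instance KDual.finite [FiniteDimensional k X] : Module.Finite Cᵐᵒᵖ (KDual k X) := by
  let i1 : Module k (KDual k X) := inferInstanceAs (Module k (X →ₗ[k] k))
  have i2 : IsScalarTower k Cᵐᵒᵖ (KDual k X) := ⟨fun a c φ => KDual.ext fun x => by
    have h : ∀ ψ : KDual k X, (a • ψ) x = a * ψ x := fun ψ => rfl
    rw [h, KDual.smul_apply, KDual.smul_apply, unop_smul, smul_assoc, map_smul, smul_eq_mul]⟩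
  have i3 : Module.Finite k (KDual k X) := inferInstanceAs (Module.Finite k (X →ₗ[k] k))
  exact Module.Finite.of_restrictScalars_finite k Cᵐᵒᵖ _

/-- A linear form on the (abstract) dual is evaluation at a point. -/
theorem KDual.exists_eval [FiniteDimensional k X] (g : KDual k X → k)
    (hadd : ∀ φ ψ, g (φ + ψ) = g φ + g ψ)
    (hsmul : ∀ (a : k) (φ : KDual k X), g (algebraMap k Cᵐᵒᵖ a • φ) = a * g φ) :
    ∃ x : X, ∀ φ : KDual k X, g φ = φ x := by
  let G : Module.Dual k (Module.Dual k X) :=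
    { toFun := g
      map_add' := hadd
      map_smul' := fun a φ => by
        have : (a • φ : Module.Dual k X) = (algebraMap k Cᵐᵒᵖ a • (toKDual φ) : KDual k X) :=
          KDual.ext fun x => (KDual.algebraMap_smul_apply a (toKDual φ) x).symm
        rw [this]
        exact hsmul a φ }
  refine ⟨(Module.evalEquiv k X).symm G, fun φ => ?_⟩
  have h := LinearMap.congr_fun ((Module.evalEquiv k X).apply_symm_apply G) φ
  exact h.symm

theorem KDual.eq_of_forall {x y : X} (h : ∀ φ : KDual k X, φ x = φ y) : x = y :=
  (Module.forall_dual_apply_eq_zero_iff k (x - y)).1 (fun φ => by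
    have := h φ
    rw [map_sub, sub_eq_zero]
    exact this) |> sub_eq_zero.1

/-- Fullness of the duality: for fixed `y`, the form `φ ↦ ε φ y` on the dual is evaluation at a
unique point of `X`. -/
theorem KDual.exists_transpose [FiniteDimensional k X] (ε : KDual k X →ₗ[Cᵐᵒᵖ] KDual k Y) :
    ∃ ε' : Y →ₗ[C] X, ∀ (φ : KDual k X) (y : Y), ε φ y = φ (ε' y) := by
  have (y : Y) : ∃ x : X, ∀ φ : KDual k X, ε φ y = φ x := by
    refine KDual.exists_eval (C := C) (fun φ => ε φ y) (fun φ ψ => ?_) (fun a φ => ?_)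
    · rw [map_add, KDual.add_apply]
    · rw [map_smul, KDual.algebraMap_smul_apply]
  choose f hf using this
  refine ⟨{ toFun := f, map_add' := fun y z => ?_, map_smul' := fun c y => ?_ }, fun φ y => hf y φ⟩
  · refine KDual.eq_of_forall (k := k) fun φ => ?_
    rw [map_add, ← hf, ← hf, ← hf, map_add]
  · refine KDual.eq_of_forall (k := k) fun φ => ?_
    have h := KDual.smul_apply (op c) φ (f y)
    rw [unop_op] at h
    rw [← hf, RingHom.id_apply, ← h, ← hf, map_smul ε, KDual.smul_apply (op c) (ε φ), unop_op]

theorem KDual.nontrivial [Nontrivial X] : Nontrivial (KDual k X) := by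
  obtain ⟨x, hx⟩ := exists_ne (0 : X)
  by_contra h
  rw [not_nontrivial_iff_subsingleton] at h
  refine hx (KDual.eq_of_forall (k := k) fun φ => ?_)
  rw [h.elim φ 0, KDual.zero_apply, map_zero]

/-- The dual of a finite dimensional indecomposable left module is indecomposable. -/
theorem isInd_kDual [FiniteDimensional k X] [Nontrivial X]
    (h : ∀ e : X →ₗ[C] X, e ∘ₗ e = e → e = 0 ∨ e = LinearMap.id) :
    IsInd (ModuleCat.of Cᵐᵒᵖ (KDual k X)) := by
  rw [isInd_iff]
  refine ⟨KDual.finite, KDual.nontrivial, fun ε hε => ?_⟩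
  obtain ⟨e, he⟩ := KDual.exists_transpose ε
  have hee : e ∘ₗ e = e := by
    ext x
    refine KDual.eq_of_forall (k := k) fun φ => ?_
    rw [LinearMap.comp_apply, ← he, ← he, ← he]
    exact congrArg (fun ψ : KDual k X => ψ x) (LinearMap.congr_fun hε φ)
  rcases h e hee with h | h
  · left
    ext φ
    refine KDual.ext fun x => ?_
    have := he φ x
    rw [h, LinearMap.zero_apply, map_zero] at this
    exact this
  · right
    ext φ
    refine KDual.ext fun x => ?_
    have := he φ x
    rw [h] at this
    exact this

end KDual

/-! ### The Auslander–Reiten formula in terms of linear forms on `Hom(P₁, N)`. -/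

section Translate

variable {k : Type u} [Field k] {C : Type u} [Ring C] [Algebra k C]

theorem exists_dualBasis (P : ModuleCat.{u} Cᵐᵒᵖ) [Module.Finite Cᵐᵒᵖ P]
    [Module.Projective Cᵐᵒᵖ P] : ∃ (n : ℕ) (x : Fin n → P) (f : Fin n → (P →ₗ[Cᵐᵒᵖ] C)),
      ∀ p : P, p = ∑ i, op (f i p) • x i := by
  obtain ⟨n, q, hq⟩ := Module.Finite.exists_fin' Cᵐᵒᵖ P
  obtain ⟨s, hs⟩ := Module.projective_lifting_property q LinearMap.id hq
  let un : Cᵐᵒᵖ →ₗ[Cᵐᵒᵖ] C :=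
    { toFun := unop, map_add' := fun _ _ => rfl, map_smul' := fun _ _ => rfl }
  refine ⟨n, fun i => q (Pi.single i 1), fun i => un ∘ₗ LinearMap.proj i ∘ₗ s, fun p => ?_⟩
  have h1 : q (s p) = p := LinearMap.congr_fun hs p
  have h2 : s p = ∑ i, s p i • Pi.single i (1 : Cᵐᵒᵖ) := by
    funext j
    simp [Finset.sum_apply, Pi.single_apply]
  conv_lhs => rw [← h1, h2, map_sum]
  exact Finset.sum_congr rfl fun i _ => map_smul _ _ _

/-- The map `c ↦ n c` from the regular module. -/
def orbitMap {N : ModuleCat.{u} Cᵐᵒᵖ} (n : N) : C →ₗ[Cᵐᵒᵖ] N where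
  toFun c := op c • n
  map_add' c d := by rw [MulOpposite.op_add, add_smul]
  map_smul' c d := by
    rw [RingHom.id_apply, ← mul_smul]
    rfl

/-- The rank one map `p ↦ n f(p)`. -/
def rankOne {P N : ModuleCat.{u} Cᵐᵒᵖ} (n : N) (f : P →ₗ[Cᵐᵒᵖ] C) : P →ₗ[Cᵐᵒᵖ] N := orbitMap n ∘ₗ f

section

variable {P N N' : ModuleCat.{u} Cᵐᵒᵖ}

theorem rankOne_apply (n : N) (f : P →ₗ[Cᵐᵒᵖ] C) (p : P) : rankOne n f p = op (f p) • n := rfl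

theorem rankOne_add_left (n n' : N) (f : P →ₗ[Cᵐᵒᵖ] C) :
    rankOne (n + n') f = rankOne n f + rankOne n' f := by
  ext p; simp [rankOne_apply]

theorem rankOne_add_right (n : N) (f f' : P →ₗ[Cᵐᵒᵖ] C) :
    rankOne n (f + f') = rankOne n f + rankOne n f' := by
  ext p; simp [rankOne_apply, add_smul]

theorem rankOne_smul (n : N) (c : C) (f : P →ₗ[Cᵐᵒᵖ] C) :
    rankOne n (c • f) = rankOne (op c • n) f := by
  ext p; simp [rankOne_apply, mul_smul]

theorem rankOne_smul_right (a : k) (n : N) (f : P →ₗ[Cᵐᵒᵖ] C) :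
    rankOne n (a • f) = a • rankOne n f := by
  ext p
  simp [rankOne_apply]

theorem comp_rankOne (u : N →ₗ[Cᵐᵒᵖ] N') (n : N) (f : P →ₗ[Cᵐᵒᵖ] C) :
    u ∘ₗ rankOne n f = rankOne (u n) f := by
  ext p; simp [rankOne_apply]

theorem eq_sum_rankOne {n : ℕ} {x : Fin n → P} {f : Fin n → (P →ₗ[Cᵐᵒᵖ] C)}
    (hx : ∀ p : P, p = ∑ i, op (f i p) • x i) (h : P →ₗ[Cᵐᵒᵖ] N) :
    h = ∑ i, rankOne (h (x i)) (f i) := by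
  ext p
  conv_lhs => rw [hx p, map_sum]
  rw [LinearMap.sum_apply]
  exact Finset.sum_congr rfl fun i _ => map_smul _ _ _

end

variable {P₁ P₀ M N : ModuleCat.{u} Cᵐᵒᵖ}

variable (k) in
/-- The module `D Tr` computed from a presentation. -/
noncomputable abbrev tauOf (p : P₁ →ₗ[Cᵐᵒᵖ] P₀) : ModuleCat.{u} Cᵐᵒᵖ :=
  ModuleCat.of Cᵐᵒᵖ (KDual k (Transpose p))

/-- The class of a form in the transpose. -/
abbrev trMk (p : P₁ →ₗ[Cᵐᵒᵖ] P₀) : (P₁ →ₗ[Cᵐᵒᵖ] C) →ₗ[C] Transpose p :=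
  (LinearMap.range (transposeMap p)).mkQ

theorem trMk_comp (p : P₁ →ₗ[Cᵐᵒᵖ] P₀) (g : P₀ →ₗ[Cᵐᵒᵖ] C) : trMk p (g ∘ₗ p) = 0 :=
  (Submodule.Quotient.mk_eq_zero _).2 ⟨g, rfl⟩

theorem exists_of_trMk_eq_zero (p : P₁ →ₗ[Cᵐᵒᵖ] P₀) {f : P₁ →ₗ[Cᵐᵒᵖ] C} (h : trMk p f = 0) :
    ∃ g : P₀ →ₗ[Cᵐᵒᵖ] C, g ∘ₗ p = f := (Submodule.Quotient.mk_eq_zero _).1 h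

theorem tauOf_ext {p : P₁ →ₗ[Cᵐᵒᵖ] P₀} {φ ψ : KDual k (Transpose p)}
    (h : ∀ f, φ (trMk p f) = ψ (trMk p f)) : φ = ψ :=
  KDual.ext fun t => by
    obtain ⟨f, rfl⟩ := Submodule.mkQ_surjective _ t
    exact h f

/-- A linear form on `Hom(P₁, N)` vanishing on the maps that factor through `p` gives a map
`N → D Tr`. -/
theorem exists_tauMap (p : P₁ →ₗ[Cᵐᵒᵖ] P₀) (l : (P₁ →ₗ[Cᵐᵒᵖ] N) →ₗ[k] k)
    (hl : ∀ s : P₀ →ₗ[Cᵐᵒᵖ] N, l (s ∘ₗ p) = 0) :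
    ∃ φ : N →ₗ[Cᵐᵒᵖ] KDual k (Transpose p), ∀ n f, φ n (trMk p f) = l (rankOne n f) := by
  let F (n : N) : (P₁ →ₗ[Cᵐᵒᵖ] C) →ₗ[k] k :=
    { toFun := fun f => l (rankOne n f)
      map_add' := fun f f' => by rw [rankOne_add_right, map_add]
      map_smul' := fun a f => by rw [rankOne_smul_right, map_smul, RingHom.id_apply] }
  let G (n : N) : KDual k (Transpose p) :=
    toKDual (((LinearMap.range (transposeMap p)).restrictScalars k).liftQ (F n) (by
      rintro _ ⟨g, rfl⟩
      exact hl (rankOne n g)))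
  have hG : ∀ n f, G n (trMk p f) = l (rankOne n f) := fun n f => rfl
  refine ⟨{ toFun := G, map_add' := fun n n' => ?_, map_smul' := fun c n => ?_ }, hG⟩
  · refine tauOf_ext fun f => ?_
    rw [KDual.add_apply, hG, hG, hG, rankOne_add_left, map_add]
  · refine tauOf_ext fun f => ?_
    rw [hG, RingHom.id_apply, KDual.smul_apply, ← map_smul, hG, rankOne_smul, op_unop]

/-- Every map `N → D Tr` comes from a linear form on `Hom(P₁, N)`. -/
theorem exists_form_of_tauMap [Module.Finite Cᵐᵒᵖ P₁] [Module.Projective Cᵐᵒᵖ P₁]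
    [Module.Finite Cᵐᵒᵖ P₀] [Module.Projective Cᵐᵒᵖ P₀] (p : P₁ →ₗ[Cᵐᵒᵖ] P₀)
    (φ : N →ₗ[Cᵐᵒᵖ] KDual k (Transpose p)) :
    ∃ l : (P₁ →ₗ[Cᵐᵒᵖ] N) →ₗ[k] k, (∀ s : P₀ →ₗ[Cᵐᵒᵖ] N, l (s ∘ₗ p) = 0) ∧
      ∀ n f, l (rankOne n f) = φ n (trMk p f) := by
  obtain ⟨m, x, f, hx⟩ := exists_dualBasis P₁
  obtain ⟨m', y, g, hy⟩ := exists_dualBasis P₀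
  let l : (P₁ →ₗ[Cᵐᵒᵖ] N) →ₗ[k] k :=
    { toFun := fun h => ∑ i, φ (h (x i)) (trMk p (f i))
      map_add' := fun h h' => by
        simp [KDual.add_apply, Finset.sum_add_distrib]
      map_smul' := fun a h => by
        rw [RingHom.id_apply, smul_eq_mul, Finset.mul_sum]
        refine Finset.sum_congr rfl fun i _ => ?_
        have : (a • h) (x i) = algebraMap k Cᵐᵒᵖ a • h (x i) := rfl
        rw [this, map_smul, KDual.algebraMap_smul_apply] }
  have hl : ∀ n f', l (rankOne n f') = φ n (trMk p f') := by
    intro n f'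
    have h1 : f' = ∑ i, f' (x i) • f i := by
      ext q
      conv_lhs => rw [hx q, map_sum]
      rw [LinearMap.sum_apply]
      exact Finset.sum_congr rfl fun i _ => map_smul f' _ _
    change ∑ i, φ (rankOne n f' (x i)) (trMk p (f i)) = _
    conv_rhs => rw [h1, map_sum (trMk p), map_sum]
    refine Finset.sum_congr rfl fun i _ => ?_
    rw [rankOne_apply, map_smul, map_smul]
    rfl
  refine ⟨l, fun s => ?_, hl⟩
  have h1 : s ∘ₗ p = ∑ j, rankOne (s (y j)) (g j ∘ₗ p) := by
    conv_lhs => rw [eq_sum_rankOne hy s]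
    ext q
    simp [rankOne_apply]
  rw [h1, map_sum]
  refine Finset.sum_eq_zero fun j _ => ?_
  rw [hl, trMk_comp, map_zero]

/-- The dual basis writes every map out of `P₁` as a sum of rank one maps. -/
theorem form_ext [Module.Finite Cᵐᵒᵖ P₁] [Module.Projective Cᵐᵒᵖ P₁]
    {l l' : (P₁ →ₗ[Cᵐᵒᵖ] N) →ₗ[k] k} (h : ∀ n f, l (rankOne n f) = l' (rankOne n f)) : l = l' := by
  obtain ⟨m, x, f, hx⟩ := exists_dualBasis P₁
  ext t
  rw [eq_sum_rankOne hx t, map_sum, map_sum]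
  exact Finset.sum_congr rfl fun i _ => h _ _

/-- The subspace of the maps `P₁ → N` that factor through `p`. -/
def factorSubspace (k : Type u) [Field k] [Algebra k C] (p : P₁ →ₗ[Cᵐᵒᵖ] P₀)
    (N : ModuleCat.{u} Cᵐᵒᵖ) : Submodule k (P₁ →ₗ[Cᵐᵒᵖ] N) :=
  LinearMap.range
    ({ toFun := fun s => s ∘ₗ p, map_add' := fun _ _ => rfl, map_smul' := fun _ _ => rfl } :
      (P₀ →ₗ[Cᵐᵒᵖ] N) →ₗ[k] (P₁ →ₗ[Cᵐᵒᵖ] N))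

theorem mem_factorSubspace {p : P₁ →ₗ[Cᵐᵒᵖ] P₀} {h : P₁ →ₗ[Cᵐᵒᵖ] N} :
    h ∈ factorSubspace k p N ↔ ∃ s : P₀ →ₗ[Cᵐᵒᵖ] N, s ∘ₗ p = h := Iff.rfl

theorem exists_form_of_not_factor {p : P₁ →ₗ[Cᵐᵒᵖ] P₀} {h : P₁ →ₗ[Cᵐᵒᵖ] N}
    (hh : ¬ ∃ s : P₀ →ₗ[Cᵐᵒᵖ] N, s ∘ₗ p = h) :
    ∃ l : (P₁ →ₗ[Cᵐᵒᵖ] N) →ₗ[k] k, (∀ s : P₀ →ₗ[Cᵐᵒᵖ] N, l (s ∘ₗ p) = 0) ∧ l h ≠ 0 := by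
  obtain ⟨l, h1, h2⟩ := Submodule.exists_le_ker_of_notMem
    (fun hm => hh ((mem_factorSubspace (k := k)).1 hm))
  exact ⟨l, fun s => h2 (mem_factorSubspace.2 ⟨s, rfl⟩), h1⟩

/-- The half of the Auslander–Reiten formula used to deduce `Ext¹ = 0` from `Hom(N, D Tr M) = 0`: a
form detecting the map that does not factor is a nonzero map to `D Tr M`. -/
theorem exists_ne_zero_of_not_factor [Module.Finite Cᵐᵒᵖ P₁] [Module.Projective Cᵐᵒᵖ P₁]
    {p : P₁ →ₗ[Cᵐᵒᵖ] P₀} {h : P₁ →ₗ[Cᵐᵒᵖ] N}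
    (hh : ¬ ∃ s : P₀ →ₗ[Cᵐᵒᵖ] N, s ∘ₗ p = h) : ∃ φ : N →ₗ[Cᵐᵒᵖ] tauOf k p, φ ≠ 0 := by
  obtain ⟨l, h1, h2⟩ := exists_form_of_not_factor (k := k) hh
  obtain ⟨φ, hφ⟩ := exists_tauMap p l h1
  refine ⟨φ, fun h0 => h2 ?_⟩
  have : l = 0 := form_ext fun n f => by
    rw [← hφ, h0]; rfl
  rw [this]; rfl

/-- The converse half. It contradicts `Ext¹ = 0` only when `p` is injective, that is, in projective
dimension at most one. -/
theorem exists_not_factor_of_ne_zero [Module.Finite Cᵐᵒᵖ P₁] [Module.Projective Cᵐᵒᵖ P₁]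
    [Module.Finite Cᵐᵒᵖ P₀] [Module.Projective Cᵐᵒᵖ P₀] {p : P₁ →ₗ[Cᵐᵒᵖ] P₀}
    {φ : N →ₗ[Cᵐᵒᵖ] tauOf k p} (hφ : φ ≠ 0) :
    ∃ h : P₁ →ₗ[Cᵐᵒᵖ] N, ¬ ∃ s : P₀ →ₗ[Cᵐᵒᵖ] N, s ∘ₗ p = h := by
  obtain ⟨l, h1, h2⟩ := exists_form_of_tauMap p φ
  by_contra! H
  apply hφ
  ext n
  refine tauOf_ext fun f => ?_
  obtain ⟨s, hs⟩ := H (rankOne n f)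
  rw [← h2, ← hs, h1]
  rfl

end Translate

section FiniteDimension

theorem isArtinianRing_of_finiteDimensional (k R : Type u) [Field k] [Ring R] [Algebra k R]
    [FiniteDimensional k R] : IsArtinianRing R := IsArtinianRing.of_finite k R

variable (k : Type u) [Field k] {R : Type u} [Ring R] [Algebra k R] [FiniteDimensional k R]

theorem finiteDimensional_of_finite (M : Type u) [AddCommGroup M] [Module k M] [Module R M]
    [IsScalarTower k R M] [Module.Finite R M] : FiniteDimensional k M := Module.Finite.trans R M

theorem finiteDimensional_hom (M N : Type u) [AddCommGroup M] [Module k M] [Module R M]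
    [IsScalarTower k R M] [Module.Finite R M] [AddCommGroup N] [Module k N] [Module R N]
    [IsScalarTower k R N] [Module.Finite R N] : FiniteDimensional k (M →ₗ[R] N) := by
  have := finiteDimensional_of_finite k (R := R) M
  have := finiteDimensional_of_finite k (R := R) N
  exact Module.Finite.of_injective (LinearMap.restrictScalarsₗ k R M N k)
    (LinearMap.restrictScalars_injective k)

end FiniteDimension

/-! ### Endomorphisms of minimal presentations. -/

section Presentations

theorem exists_section_of_retraction {R N E M : Type*} [Ring R] [AddCommGroup N] [Module R N]
    [AddCommGroup E] [Module R E] [AddCommGroup M] [Module R M] {a : N →ₗ[R] E} {π : E →ₗ[R] M}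
    (he : Function.Exact a π) (hπ : Function.Surjective π) {r : E →ₗ[R] N}
    (hr : r ∘ₗ a = LinearMap.id) : ∃ σ : M →ₗ[R] E, π ∘ₗ σ = LinearMap.id := by
  have hr' : ∀ x, r (a x) = x := LinearMap.congr_fun hr
  obtain ⟨σ, hσ⟩ := exists_comp_eq_of_ker_le hπ (m := LinearMap.id - a ∘ₗ r) (by
    intro x hx
    obtain ⟨y, rfl⟩ := (he x).1 hx
    simp [hr'])
  refine ⟨σ, ?_⟩
  ext m
  obtain ⟨x, rfl⟩ := hπ m
  have h1 : σ (π x) = x - a (r x) := LinearMap.congr_fun hσ x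
  simp [h1, he.apply_apply_eq_zero]

variable {R : Type u} [Ring R] {P₁ P₀ M : ModuleCat.{u} R}
  {p₁ : P₁ →ₗ[R] P₀} {p₀ : P₀ →ₗ[R] M}

/-- Superfluous kernels turn surjectivity on `M` into surjectivity of `q₀`. Then `q₀` is bijective,
so it restricts to a bijection of `ker p₀` by finite length, and the same argument applies to `q₁`.
-/
theorem IsMinPresentation.bijective_of_surjective [IsArtinianRing R]
    (h : IsMinPresentation p₁ p₀) {q₁ : P₁ →ₗ[R] P₁} {q₀ : P₀ →ₗ[R] P₀} {φ : M →ₗ[R] M}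
    (h₁ : ∀ x, p₁ (q₁ x) = q₀ (p₁ x)) (h₀ : ∀ x, p₀ (q₀ x) = φ (p₀ x))
    (hφ : Function.Surjective φ) : Function.Bijective q₁ := by
  have := h.finite₁
  have := h.finite₀
  have hq₀ : Function.Surjective q₀ := by
    rw [← LinearMap.range_eq_top]
    refine h.minimal₀ _ (eq_top_iff.2 fun x _ => ?_)
    obtain ⟨m, hm⟩ := hφ (p₀ x)
    obtain ⟨y, rfl⟩ := h.surjective m
    exact Submodule.mem_sup.2 ⟨x - q₀ y, by simp [h₀, hm], q₀ y, ⟨y, rfl⟩, by simp⟩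
  have hq₀' : Function.Injective q₀ := IsNoetherian.injective_of_surjective_endomorphism q₀ hq₀
  have hres : ∀ x ∈ LinearMap.ker p₀, q₀ x ∈ LinearMap.ker p₀ := fun x hx => by
    rw [LinearMap.mem_ker, h₀, LinearMap.mem_ker.1 hx, map_zero]
  have hs : Function.Surjective (q₀.restrict hres) := by
    refine IsArtinian.surjective_of_injective_endomorphism _ fun x y hxy => ?_
    exact Subtype.ext (hq₀' (congrArg Subtype.val hxy))
  have hq₁ : Function.Surjective q₁ := by
    rw [← LinearMap.range_eq_top]
    refine h.minimal₁ _ (eq_top_iff.2 fun x _ => ?_)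
    obtain ⟨⟨y, hy⟩, hy'⟩ := hs ⟨p₁ x, h.exact.apply_apply_eq_zero x⟩
    obtain ⟨z, rfl⟩ := (h.exact y).1 hy
    have hz : q₀ (p₁ z) = p₁ x := congrArg Subtype.val hy'
    exact Submodule.mem_sup.2 ⟨x - q₁ z, by simp [h₁, hz], q₁ z, ⟨z, rfl⟩, by simp⟩
  exact ⟨IsNoetherian.injective_of_surjective_endomorphism q₁ hq₁, hq₁⟩

end Presentations

/-! ### Properties of `D Tr`: indecomposability, extensions of `M` by `D Tr M`, almost split
sequences. -/

section Translate

variable {k : Type u} [Field k] {C : Type u} [Ring C] [Algebra k C]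
  {P₁ P₀ M : ModuleCat.{u} Cᵐᵒᵖ} {p₁ : P₁ →ₗ[Cᵐᵒᵖ] P₀} {p₀ : P₀ →ₗ[Cᵐᵒᵖ] M}

/-- An endomorphism `p ↦ ∑ xᵢ tᵢ(p)` of a module with given generators. -/
theorem exists_end_of_forms {P Q : ModuleCat.{u} Cᵐᵒᵖ} {n : ℕ} (x : Fin n → Q)
    (t : Fin n → (P →ₗ[Cᵐᵒᵖ] C)) : ∃ q : P →ₗ[Cᵐᵒᵖ] Q, (∀ p, q p = ∑ i, op (t i p) • x i) ∧
      ∀ f : Q →ₗ[Cᵐᵒᵖ] C, f ∘ₗ q = ∑ i, f (x i) • t i := by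
  refine ⟨∑ i, rankOne (x i) (t i), fun p => by simp [rankOne_apply], fun f => ?_⟩
  ext p
  simp [rankOne_apply]

/-- If the transpose vanished, every form on `P₁` would extend along `p₁`. A dual basis of `P₁`
would then give a retraction of `p₁`, so `p₀` would split. -/
theorem nontrivial_transpose (h : IsMinPresentation p₁ p₀) (hM : ¬ Module.Projective Cᵐᵒᵖ M) :
    Nontrivial (Transpose p₁) := by
  by_contra hT
  rw [not_nontrivial_iff_subsingleton] at hT
  have := h.finite₁
  have := h.projective₁
  have := h.projective₀
  obtain ⟨n, x, f, hx⟩ := exists_dualBasis P₁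
  choose g hg using fun i => exists_of_trMk_eq_zero p₁ (hT.elim (trMk p₁ (f i)) 0)
  obtain ⟨r, hr, -⟩ := exists_end_of_forms x g
  obtain ⟨σ, hσ⟩ := exists_section_of_retraction h.exact h.surjective (r := r) (by
    ext p
    conv_rhs => rw [LinearMap.id_apply, hx p]
    rw [LinearMap.comp_apply, hr]
    exact Finset.sum_congr rfl fun i _ => by rw [← hg i]; rfl)
  exact hM (Module.Projective.of_split σ p₀ hσ)

theorem finiteDimensional_transpose [FiniteDimensional k C] [Module.Finite Cᵐᵒᵖ P₁]
    [Module.Projective Cᵐᵒᵖ P₁] : FiniteDimensional k (Transpose p₁) := by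
  obtain ⟨n, x, f, hx⟩ := exists_dualBasis P₁
  let F : (Fin n → C) →ₗ[k] Transpose p₁ :=
    { toFun := fun c => ∑ i, c i • trMk p₁ (f i)
      map_add' := fun c d => by simp [add_smul, Finset.sum_add_distrib]
      map_smul' := fun a c => by simp [Finset.smul_sum, smul_assoc] }
  refine Module.Finite.of_surjective F fun t => ?_
  obtain ⟨t, rfl⟩ := Submodule.mkQ_surjective _ t
  refine ⟨fun i => t (x i), ?_⟩
  change ∑ i, t (x i) • trMk p₁ (f i) = _
  simp only [← map_smul, ← map_sum]
  congr 1
  ext q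
  conv_rhs => rw [hx q, map_sum]
  rw [LinearMap.sum_apply]
  exact Finset.sum_congr rfl fun i _ => (map_smul t _ _).symm

/-- `D Tr M` is indecomposable if `M` is indecomposable and not projective. -/
theorem isInd_tauOf [FiniteDimensional k C] (h : IsMinPresentation p₁ p₀) (hI : IsInd M)
    (hM : ¬ Module.Projective Cᵐᵒᵖ M) : IsInd (tauOf k p₁) := by
  have := isArtinianRing_of_finiteDimensional k Cᵐᵒᵖ
  have := h.finite₁
  have := h.projective₁
  have := h.finite₀
  have := h.projective₀
  have := nontrivial_transpose h hM
  have := finiteDimensional_transpose (k := k) (p₁ := p₁)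
  refine isInd_kDual fun ε hε => ?_
  have hε' : ∀ t, ε (ε t) = ε t := LinearMap.congr_fun hε
  obtain ⟨n, x, f, hx⟩ := exists_dualBasis P₁
  obtain ⟨m, y, g, hy⟩ := exists_dualBasis P₀
  -- An idempotent of the transpose lifts to an endomorphism of the presentation, hence induces an
  -- endomorphism `φ` of `M`. Either `φ` or `1 - φ` is bijective, and this carries over to `q₁` or
  -- `1 - q₁` by minimality.
  choose t ht using fun i => Submodule.mkQ_surjective _ (ε (trMk p₁ (f i)))
  obtain ⟨q₁, -, hq₁⟩ := exists_end_of_forms x t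
  have hf (f' : P₁ →ₗ[Cᵐᵒᵖ] C) : f' = ∑ i, f' (x i) • f i := by
    ext q
    conv_lhs => rw [hx q, map_sum]
    rw [LinearMap.sum_apply]
    exact Finset.sum_congr rfl fun i _ => map_smul f' _ _
  have hlift (f' : P₁ →ₗ[Cᵐᵒᵖ] C) : trMk p₁ (f' ∘ₗ q₁) = ε (trMk p₁ f') := by
    rw [hq₁, map_sum]
    conv_rhs => rw [hf f', map_sum (trMk p₁), map_sum]
    refine Finset.sum_congr rfl fun i _ => ?_
    rw [map_smul, map_smul, map_smul]
    exact congrArg _ (ht i)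
  have hg (j : Fin m) : ∃ g' : P₀ →ₗ[Cᵐᵒᵖ] C, g' ∘ₗ p₁ = g j ∘ₗ p₁ ∘ₗ q₁ := by
    apply exists_of_trMk_eq_zero
    rw [← LinearMap.comp_assoc, hlift, trMk_comp, map_zero]
  choose g' hg' using hg
  obtain ⟨q₀, hq₀, -⟩ := exists_end_of_forms y g'
  have h₁ (z : P₁) : p₁ (q₁ z) = q₀ (p₁ z) := by
    rw [hq₀, hy (p₁ (q₁ z))]
    exact Finset.sum_congr rfl fun j _ => by
      rw [show g j (p₁ (q₁ z)) = g' j (p₁ z) from (LinearMap.congr_fun (hg' j) z).symm]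
  obtain ⟨φ, hφ⟩ := exists_comp_eq_of_ker_le h.surjective (m := p₀ ∘ₗ q₀) (by
    intro z hz
    obtain ⟨w, rfl⟩ := (h.exact z).1 hz
    rw [LinearMap.mem_ker, LinearMap.comp_apply, ← h₁, h.exact.apply_apply_eq_zero])
  have h₀ (z : P₀) : p₀ (q₀ z) = φ (p₀ z) := (LinearMap.congr_fun hφ z).symm
  rcases hI.bijective_of_add (f := φ) (g := LinearMap.id - φ) (by abel) with hb | hb
  · right
    have hq := h.bijective_of_surjective h₁ h₀ hb.2
    let e := LinearEquiv.ofBijective q₁ hq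
    ext s
    have h2 := hlift (s ∘ₗ e.symm.toLinearMap)
    have h3 : (s ∘ₗ e.symm.toLinearMap) ∘ₗ q₁ = s := by
      ext z
      exact congrArg s (e.symm_apply_apply z)
    rw [h3] at h2
    change ε (trMk p₁ s) = trMk p₁ s
    rw [h2, hε']
  · left
    have hq := h.bijective_of_surjective (q₁ := LinearMap.id - q₁) (q₀ := LinearMap.id - q₀)
      (φ := LinearMap.id - φ) (fun z => by simp [h₁]) (fun z => by simp [h₀]) hb.2
    let e := LinearEquiv.ofBijective _ hq
    ext s
    have h2 := hlift (s ∘ₗ e.symm.toLinearMap)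
    have h3 : s ∘ₗ e.symm.toLinearMap - (s ∘ₗ e.symm.toLinearMap) ∘ₗ q₁ = s := by
      ext z
      have h4 : e.symm z - e.symm (q₁ z) = z := by
        rw [← map_sub]
        exact e.symm_apply_apply z
      change s (e.symm z) - s (e.symm (q₁ z)) = s z
      rw [← map_sub, h4]
    change ε (trMk p₁ s) = 0
    rw [← h3, map_sub (trMk p₁), map_sub, h2, hε', sub_self]

/-- There is a map `P₁ → D Tr M` that vanishes on the kernel of `P₁ → P₀` and does not factor
through `P₁ → P₀`; that is, `Ext¹(M, D Tr M)` does not vanish. -/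
theorem exists_not_factor_tauOf [FiniteDimensional k C] (h : IsMinPresentation p₁ p₀)
    (hM : ¬ Module.Projective Cᵐᵒᵖ M) {N : ModuleCat.{u} Cᵐᵒᵖ}
    (e : N ≃ₗ[Cᵐᵒᵖ] KDual k (Transpose p₁)) :
    ∃ t : P₁ →ₗ[Cᵐᵒᵖ] N, LinearMap.ker p₁ ≤ LinearMap.ker t ∧
      ¬ ∃ s : P₀ →ₗ[Cᵐᵒᵖ] N, s ∘ₗ p₁ = t := by
  have := isArtinianRing_of_finiteDimensional k Cᵐᵒᵖ
  have := h.finite₁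
  have := h.projective₁
  have := h.finite₀
  have := h.projective₀
  have := finiteDimensional_transpose (k := k) (p₁ := p₁)
  have hnt := nontrivial_transpose h hM
  by_contra! H
  -- The form `l` of the isomorphism `e` vanishes on maps factoring through `p₁`, hence by
  -- assumption on all maps killing `ker p₁`. So it depends only on the values at generators `z j`
  -- of this kernel.
  obtain ⟨l, hl, hl'⟩ := exists_form_of_tauMap (k := k) p₁ e.toLinearMap
  obtain ⟨n, w, hw⟩ := Module.Finite.exists_fin' Cᵐᵒᵖ (LinearMap.ker p₁)
  let z (j : Fin n) : P₁ := w (Pi.single j 1)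
  have hz (j : Fin n) : p₁ (z j) = 0 := (w (Pi.single j 1)).2
  let A : (P₁ →ₗ[Cᵐᵒᵖ] N) →ₗ[k] (Fin n → N) :=
    { toFun := fun t j => t (z j), map_add' := fun _ _ => rfl, map_smul' := fun _ _ => rfl }
  have hA : LinearMap.ker A.rangeRestrict ≤ LinearMap.ker l := by
    intro t ht
    rw [LinearMap.ker_rangeRestrict] at ht
    have ht' : ∀ j, t (z j) = 0 := congrFun (LinearMap.mem_ker.1 ht)
    obtain ⟨s, rfl⟩ := H t (by
      intro y hy
      obtain ⟨c, hc⟩ := hw ⟨y, hy⟩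
      have h1 : t ∘ₗ (LinearMap.ker p₁).subtype ∘ₗ w = 0 := by
        ext j
        exact ht' j
      have h2 := LinearMap.congr_fun h1 c
      simp only [LinearMap.comp_apply, hc] at h2
      exact h2)
    exact hl s
  obtain ⟨μ', hμ'⟩ := exists_comp_eq_of_ker_le A.surjective_rangeRestrict hA
  obtain ⟨μ, hμ⟩ := μ'.exists_extend
  have hμA (t) : l t = μ (A t) := by
    rw [← hμ'] 
    exact (LinearMap.congr_fun hμ (A.rangeRestrict t)).symm
  have (j : Fin n) : ∃ s : Transpose p₁, ∀ φ : KDual k (Transpose p₁),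
      μ (Pi.single j (e.symm φ)) = φ s := by
    refine KDual.exists_eval (C := C) (fun φ => μ (Pi.single j (e.symm φ)))
      (fun φ ψ => ?_) (fun a φ => ?_)
    · rw [← map_add, ← Pi.single_add, map_add]
    · have h1 : e.symm (algebraMap k Cᵐᵒᵖ a • φ) = a • e.symm φ := by
        rw [← algebraMap_smul Cᵐᵒᵖ a (e.symm φ)]
        exact map_smul e.symm _ φ
      rw [h1, Pi.single_smul, map_smul, smul_eq_mul]
  choose s hs using this
  choose t ht using fun j => Submodule.mkQ_surjective _ (s j)
  obtain ⟨q, hq, hq'⟩ := exists_end_of_forms z t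
  -- By biduality the dependence of `l` on the values at the `z j` is given by elements of the
  -- transpose. Their lifts assemble to an endomorphism `q` of `P₁`, with image in `ker p₁`, that
  -- acts as the identity on the transpose.
  have key (f : P₁ →ₗ[Cᵐᵒᵖ] C) : trMk p₁ f = trMk p₁ (f ∘ₗ q) := by
    refine KDual.eq_of_forall (k := k) fun φ => ?_
    have h1 := hl' (e.symm φ) f
    rw [LinearEquiv.coe_coe, LinearEquiv.apply_symm_apply, hμA, ← Finset.univ_sum_single (A _), map_sum] at h1
    rw [← h1, hq', map_sum, map_sum]
    refine Finset.sum_congr rfl fun j _ => ?_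
    have h2 : A (rankOne (e.symm φ) f) j = e.symm (op (f (z j)) • φ) := (map_smul _ _ _).symm
    rw [h2, hs, map_smul (trMk p₁), KDual.smul_apply, unop_op, ← ht j]
  -- The image of `q` is superfluous, so `1 - q` is bijective. But precomposition with it kills the
  -- transpose, which is nonzero.
  have hsurj : Function.Surjective (LinearMap.id - q : P₁ →ₗ[Cᵐᵒᵖ] P₁) := by
    rw [← LinearMap.range_eq_top]
    refine h.minimal₁ _ (eq_top_iff.2 fun y _ => Submodule.mem_sup.2
      ⟨q y, ?_, (LinearMap.id - q : P₁ →ₗ[Cᵐᵒᵖ] P₁) y, ⟨y, rfl⟩, by simp⟩)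
    rw [LinearMap.mem_ker, hq, map_sum]
    exact Finset.sum_eq_zero fun j _ => by rw [map_smul, hz, smul_zero]
  have hbij : Function.Bijective (LinearMap.id - q : P₁ →ₗ[Cᵐᵒᵖ] P₁) :=
    ⟨IsNoetherian.injective_of_surjective_endomorphism _ hsurj, hsurj⟩
  let e' := LinearEquiv.ofBijective _ hbij
  obtain ⟨x, hx⟩ := exists_ne (0 : Transpose p₁)
  obtain ⟨f, rfl⟩ := Submodule.mkQ_surjective _ x
  apply hx
  have h1 := key (f ∘ₗ e'.symm.toLinearMap)
  have h2 : f ∘ₗ e'.symm.toLinearMap - (f ∘ₗ e'.symm.toLinearMap) ∘ₗ q = f := by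
    ext z
    have h4 : e'.symm z - e'.symm (q z) = z := by
      rw [← map_sub]
      exact e'.symm_apply_apply z
    change f (e'.symm z) - f (e'.symm (q z)) = f z
    rw [← map_sub, h4]
  change trMk p₁ f = 0
  rw [← h2, map_sub (trMk p₁), ← h1, sub_self]

/-- Pushing the presentation out along a map `P₁ → D Tr M` that does not factor through `P₀` gives a
non-split extension. This path is what makes convexity of a slice applicable to translates. -/
theorem leads_tauOf [FiniteDimensional k C] (h : IsMinPresentation p₁ p₀) (hI : IsInd M)
    (hM : ¬ Module.Projective Cᵐᵒᵖ M) : Leads (tauOf k p₁) M := by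
  have := isArtinianRing_of_finiteDimensional k Cᵐᵒᵖ
  have := h.finite₀
  obtain ⟨t, ht, hns⟩ := exists_not_factor_tauOf h hM (N := tauOf k p₁) (LinearEquiv.refl _ _)
  obtain ⟨E, a, π, j, ha, he, hπ, hj, -, hs, -⟩ := exists_pushout h.exact h.surjective ht
  have hτ := isInd_tauOf (k := k) h hI hM
  have := hτ.finite
  have : Module.Finite Cᵐᵒᵖ E := Module.Finite.of_surjective _ hs
  refine Leads.of_nonsplit hτ hI ha he hπ ?_
  rintro ⟨r, hr⟩
  refine hns ⟨r ∘ₗ j, ?_⟩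
  rw [LinearMap.comp_assoc, hj, ← LinearMap.comp_assoc, hr, LinearMap.id_comp]

/-- A nonzero element of the kernel of `P₁ → P₀` yields a nonzero map `I_x → D Tr M`. -/
theorem exists_injAt_ne_zero {ι : Type*} [Fintype ι] {e : ι → C}
    (he : CompleteOrthogonalIdempotents e) [Module.Finite Cᵐᵒᵖ P₁] [Module.Projective Cᵐᵒᵖ P₁]
    {z : P₁} (hz : p₁ z = 0) (hz0 : z ≠ 0) :
    ∃ (x : ι) (φ : injAt k (e x) →ₗ[Cᵐᵒᵖ] tauOf k p₁), φ ≠ 0 := by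
  obtain ⟨x, hx⟩ : ∃ x, op (e x) • z ≠ 0 := by
    by_contra! H
    apply hz0
    rw [← one_smul Cᵐᵒᵖ z, ← op_one, ← he.complete, Finset.op_sum, Finset.sum_smul]
    exact Finset.sum_eq_zero fun x _ => H x
  obtain ⟨n, y, f, hy⟩ := exists_dualBasis P₁
  obtain ⟨i, hi⟩ : ∃ i, f i (op (e x) • z) ≠ 0 := by
    by_contra! H
    apply hx
    rw [hy (op (e x) • z)]
    exact Finset.sum_eq_zero fun i _ => by rw [H i, op_zero, zero_smul]
  have hmem (f : P₁ →ₗ[Cᵐᵒᵖ] C) : f (op (e x) • z) ∈ projLeft (e x) := by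
    rw [map_smul]
    exact Submodule.mem_span_singleton.2 ⟨f z, rfl⟩
  -- Evaluation at `z e_x` kills the forms that come from `P₀`, because `p₁ z = 0`. So it descends
  -- to the transpose, and its dual is the required map.
  let ev : (P₁ →ₗ[Cᵐᵒᵖ] C) →ₗ[C] projLeft (e x) :=
    { toFun := fun f => ⟨f (op (e x) • z), hmem f⟩
      map_add' := fun _ _ => rfl
      map_smul' := fun _ _ => rfl }
  let ev' : Transpose p₁ →ₗ[C] projLeft (e x) := (LinearMap.range (transposeMap p₁)).liftQ ev (by
    rintro _ ⟨g, rfl⟩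
    refine Subtype.ext ?_
    change g (p₁ (op (e x) • z)) = 0
    rw [map_smul, hz, smul_zero, map_zero])
  let φ : KDual k (projLeft (e x)) →ₗ[Cᵐᵒᵖ] KDual k (Transpose p₁) :=
    { toFun := fun ψ => toKDual ((show projLeft (e x) →ₗ[k] k from ψ) ∘ₗ ev'.restrictScalars k)
      map_add' := fun _ _ => rfl
      map_smul' := fun c ψ => KDual.ext fun t => by
        change ψ (c.unop • ev' t) = ψ (ev' (c.unop • t))
        rw [map_smul ev'] }
  refine ⟨x, φ, fun h0 => hi ?_⟩
  have h1 : ev (f i) = 0 := KDual.eq_of_forall (k := k) fun ψ => by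
    have h2 : φ ψ (trMk p₁ (f i)) = ψ (ev (f i)) := rfl
    have h3 : φ ψ = 0 := LinearMap.congr_fun h0 ψ
    rw [← h2, h3, KDual.zero_apply, map_zero]
  exact congrArg Subtype.val h1

/-- There is a map `h : P₁ → D Tr M` not factoring through `P₁ → P₀` such that `u ∘ h` does
factor for every map `u` that is not a split monomorphism. -/
theorem exists_almost_factor [FiniteDimensional k C] [Module.Finite Cᵐᵒᵖ P₁]
    [Module.Projective Cᵐᵒᵖ P₁] [Module.Finite Cᵐᵒᵖ P₀] [Module.Projective Cᵐᵒᵖ P₀]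
    {N : ModuleCat.{u} Cᵐᵒᵖ} (e : N ≃ₗ[Cᵐᵒᵖ] KDual k (Transpose p₁)) (hN : IsInd N) :
    ∃ h : P₁ →ₗ[Cᵐᵒᵖ] N, (¬ ∃ s : P₀ →ₗ[Cᵐᵒᵖ] N, s ∘ₗ p₁ = h) ∧
      ∀ (W : ModuleCat.{u} Cᵐᵒᵖ) (u : N →ₗ[Cᵐᵒᵖ] W),
        (¬ ∃ r : W →ₗ[Cᵐᵒᵖ] N, r ∘ₗ u = LinearMap.id) →
        ∃ s : P₀ →ₗ[Cᵐᵒᵖ] W, s ∘ₗ p₁ = u ∘ₗ h := by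
  have := isArtinianRing_of_finiteDimensional k Cᵐᵒᵖ
  have := hN.finite
  have := hN.nontrivial
  have := finiteDimensional_hom k (R := Cᵐᵒᵖ) P₁ N
  have key (φ : N →ₗ[Cᵐᵒᵖ] N) := exists_form_of_tauMap (k := k) p₁ (e.toLinearMap ∘ₗ φ)
  choose l hl hl' using key
  have hadd (φ ψ) : l (φ + ψ) = l φ + l ψ := form_ext fun n f => by
    rw [LinearMap.add_apply, hl', hl', hl', LinearMap.comp_add]
    rfl
  have hsmul (a : k) (φ) : l (a • φ) = a • l φ := form_ext fun n f => by
    rw [LinearMap.smul_apply, hl', hl', smul_eq_mul, ← KDual.algebraMap_smul_apply (C := C)]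
    change e (a • φ n) _ = _
    rw [← algebraMap_smul Cᵐᵒᵖ a (φ n), map_smul]
    rfl
  -- The forms attached to non-bijective endomorphisms of `N` make up a subspace, by locality, and
  -- it misses the form of the identity. So some `h` is annihilated by `J` but not by that form.
  let J : Submodule k (Module.Dual k (P₁ →ₗ[Cᵐᵒᵖ] N)) :=
    { carrier := {m | ∃ φ : N →ₗ[Cᵐᵒᵖ] N, ¬ Function.Bijective φ ∧ l φ = m}
      add_mem' := by
        rintro _ _ ⟨φ, hφ, rfl⟩ ⟨ψ, hψ, rfl⟩
        exact ⟨φ + ψ, hN.not_bijective_add hφ hψ, hadd φ ψ⟩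
      zero_mem' := ⟨0, not_bijective_of_isNilpotent IsNilpotent.zero, by
        have := hsmul 0 0
        rwa [zero_smul, zero_smul] at this⟩
      smul_mem' := by
        rintro a _ ⟨φ, hφ, rfl⟩
        refine ⟨a • φ, fun hb => ?_, hsmul a φ⟩
        rcases eq_or_ne a 0 with rfl | ha
        · rw [zero_smul] at hb
          exact not_bijective_of_isNilpotent IsNilpotent.zero hb
        · apply hφ
          have hsm : Function.Bijective fun n : N => a⁻¹ • n :=
            (LinearEquiv.smulOfNeZero k N a⁻¹ (inv_ne_zero ha)).bijective
          have hc := hsm.comp hb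
          have hc' : ((fun n : N => a⁻¹ • n) ∘ (a • φ : N →ₗ[Cᵐᵒᵖ] N)) = φ := by
            funext n
            simp [smul_smul, inv_mul_cancel₀ ha]
          rwa [hc'] at hc }
  have hinj (φ ψ) (h : l φ = l ψ) : φ = ψ := by
    ext n
    apply e.injective
    refine tauOf_ext fun f => ?_
    have h1 := hl' φ n f
    rw [h, hl'] at h1
    exact h1.symm
  have hid : l LinearMap.id ∉ J := by
    rintro ⟨φ, hφ, h⟩
    rw [hinj _ _ h] at hφ
    exact hφ Function.bijective_id
  obtain ⟨h, hh, hh'⟩ : ∃ h, h ∈ J.dualCoannihilator ∧ l LinearMap.id h ≠ 0 := by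
    by_contra! H
    apply hid
    rw [← Subspace.dualCoannihilator_dualAnnihilator_eq (W := J)]
    exact (Submodule.mem_dualAnnihilator _).2 H
  refine ⟨h, ?_, fun W u hu => ?_⟩
  · rintro ⟨s, rfl⟩
    exact hh' (hl _ s)
  · by_contra hns
    obtain ⟨m, hm, hm'⟩ := exists_form_of_not_factor (k := k) hns
    obtain ⟨φ, hφ⟩ := exists_tauMap p₁ m hm
    -- A form detecting `u ∘ h` gives a map `φ` from `W` to the translate. Since `u` is not a split
    -- monomorphism, `φ ∘ u` is not bijective, so its form lies in `J` and vanishes at `h`; yet its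
    -- value there is the nonzero value of `m` at `u ∘ h`.
    have h1 : l (e.symm.toLinearMap ∘ₗ φ ∘ₗ u) ∈ J := by
      refine ⟨_, fun hb => hu ?_, rfl⟩
      let e' := LinearEquiv.ofBijective _ hb
      exact ⟨e'.symm.toLinearMap ∘ₗ e.symm.toLinearMap ∘ₗ φ,
        LinearMap.ext fun n => e'.symm_apply_apply n⟩
    have h2 := (Submodule.mem_dualCoannihilator _).1 hh _ h1
    apply hm'
    let m' : (P₁ →ₗ[Cᵐᵒᵖ] N) →ₗ[k] k :=
      { toFun := fun t => m (u ∘ₗ t)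
        map_add' := fun t t' => by rw [LinearMap.comp_add, map_add]
        map_smul' := fun a t => by
          rw [RingHom.id_apply, ← map_smul m]
          congr 1
          ext y
          exact map_smul u (algebraMap k Cᵐᵒᵖ a) (t y) }
    have h3 : l (e.symm.toLinearMap ∘ₗ φ ∘ₗ u) = m' := form_ext fun n f => by
      rw [hl']
      change e (e.symm (φ (u n))) (trMk p₁ f) = m (u ∘ₗ rankOne n f)
      rw [LinearEquiv.apply_symm_apply, hφ, comp_rankOne]
    rw [h3] at h2
    exact h2

end Translate

/-! ### Projective and injective modules at the points. -/

section Points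

variable {k : Type u} [Field k] {C : Type u} [Ring C] [Algebra k C]

theorem IsPrimitiveIdem.eq_zero_or_eq {e c : C} (he : IsPrimitiveIdem e) (hc : c * c = c)
    (hec : e * c = c) (hce : c * e = c) : c = 0 ∨ c = e := by
  obtain ⟨hee, -, h⟩ := he
  have hee' : e * e = e := hee
  rcases h c (e - c) hc (by simp [IsIdempotentElem, sub_mul, mul_sub, hee', hec, hce, hc])
    (by simp [mul_sub, hce, hc]) (by simp [sub_mul, hec, hc]) (by abel) with h | h
  · exact Or.inl h
  · exact Or.inr (sub_eq_zero.1 h).symm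

/-- An endomorphism of `C e` is right multiplication by its value at `e`, so idempotent
endomorphisms are idempotents of `e C e`. The dual inherits indecomposability. -/
theorem isInd_injAt [FiniteDimensional k C] {e : C} (he : IsPrimitiveIdem e) :
    IsInd (injAt k e) := by
  have hee : e * e = e := he.1
  have hmem : e ∈ projLeft e := Submodule.mem_span_singleton_self e
  have hgen : ∀ x ∈ projLeft e, x * e = x := fun x hx => by
    obtain ⟨c, rfl⟩ := Submodule.mem_span_singleton.1 hx
    rw [smul_eq_mul, mul_assoc, hee]
  have : Nontrivial (projLeft e) :=
    ⟨⟨e, hmem⟩, 0, fun h => he.2.1 (congrArg Subtype.val h)⟩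
  refine isInd_kDual fun ε hε => ?_
  have hval (x : projLeft e) : (ε x : C) = x * (ε ⟨e, hmem⟩ : projLeft e).1 := by
    have h1 : x = (x : C) • (⟨e, hmem⟩ : projLeft e) := Subtype.ext (hgen x x.2).symm
    conv_lhs => rw [h1, map_smul]
    rfl
  set c : C := (ε ⟨e, hmem⟩ : projLeft e).1 with hc
  have h1 : c * c = c := by
    rw [← hval (ε ⟨e, hmem⟩)]
    exact congrArg Subtype.val (LinearMap.congr_fun hε ⟨e, hmem⟩)
  rcases he.eq_zero_or_eq h1 (hval ⟨e, hmem⟩).symm (hgen c (ε ⟨e, hmem⟩).2) with h | h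
  · left
    ext x
    rw [hval, h, mul_zero]; rfl
  · right
    ext x
    rw [hval, h, hgen x x.2]; rfl

/-- The indecomposable projective right module at the point `e`. -/
abbrev projAt (e : C) : ModuleCat.{u} Cᵐᵒᵖ := ModuleCat.of Cᵐᵒᵖ (projRight e)

theorem mem_projRight {e : C} (he : e * e = e) {x : C} : x ∈ projRight e ↔ e * x = x := by
  refine ⟨fun hx => ?_, fun hx => Submodule.mem_span_singleton.2 ⟨op x, hx⟩⟩
  obtain ⟨c, rfl⟩ := Submodule.mem_span_singleton.1 hx
  change e * (e * c.unop) = e * c.unop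
  rw [← mul_assoc, he]

theorem isInd_projAt {e : C} (he : IsPrimitiveIdem e) : IsInd (projAt e) := by
  have hee : e * e = e := he.1
  have hmem : e ∈ projRight e := Submodule.mem_span_singleton_self e
  rw [isInd_iff]
  refine ⟨inferInstance, ⟨⟨e, hmem⟩, 0, fun h => he.2.1 (congrArg Subtype.val h)⟩, fun ε hε => ?_⟩
  have hval (x : projRight e) : (ε x : projRight e).1 = (ε ⟨e, hmem⟩ : projRight e).1 * x := by
    have h1 : x = op (x : C) • (⟨e, hmem⟩ : projRight e) :=
      Subtype.ext ((mem_projRight hee).1 x.2).symm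
    conv_lhs => rw [h1, map_smul]
    rfl
  set c : C := (ε ⟨e, hmem⟩ : projRight e).1 with hc
  have h1 : c * c = c := by
    rw [← hval (ε ⟨e, hmem⟩)]
    exact congrArg Subtype.val (LinearMap.congr_fun hε ⟨e, hmem⟩)
  rcases he.eq_zero_or_eq h1 ((mem_projRight hee).1 (ε ⟨e, hmem⟩).2) (hval ⟨e, hmem⟩).symm
    with h | h
  · left
    ext x
    rw [hval, h, zero_mul]; rfl
  · right
    ext x
    rw [hval, h, (mem_projRight hee).1 x.2]; rfl

/-- The map `N → D (C e)` given by a linear form on `N`. -/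
noncomputable def formMap {N : ModuleCat.{u} Cᵐᵒᵖ} (χ : N →ₗ[k] k) (e : C) :
    N →ₗ[Cᵐᵒᵖ] KDual k (projLeft e) where
  toFun n := toKDual
    { toFun := fun y => χ (op (y : C) • n)
      map_add' := fun y z => by
        rw [Submodule.coe_add, MulOpposite.op_add, add_smul, map_add]
      map_smul' := fun a y => by
        rw [RingHom.id_apply, ← map_smul χ, Submodule.coe_smul_of_tower, op_smul, smul_assoc] }
  map_add' n n' := KDual.ext fun y => by
    change χ (op (y : C) • (n + n')) = χ (op (y : C) • n) + χ (op (y : C) • n')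
    rw [smul_add, map_add]
  map_smul' c n := KDual.ext fun y => by
    change χ (op (y : C) • c • n) = χ (op (c.unop * (y : C)) • n)
    rw [← mul_smul]
    rfl

theorem formMap_apply {N : ModuleCat.{u} Cᵐᵒᵖ} (χ : N →ₗ[k] k) (e : C) (n : N)
    (y : projLeft e) : formMap χ e n y = χ (op (y : C) • n) := rfl

theorem exists_ne_zero_injAt {N : ModuleCat.{u} Cᵐᵒᵖ} {e : C} {m : N} (hm : op e • m ≠ 0) :
    ∃ φ : N →ₗ[Cᵐᵒᵖ] injAt k e, φ ≠ 0 := by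
  obtain ⟨χ, hχ⟩ : ∃ χ : Module.Dual k N, χ (op e • m) ≠ 0 := by
    by_contra! H
    exact hm ((Module.forall_dual_apply_eq_zero_iff k _).1 H)
  refine ⟨formMap χ e, fun h0 => hχ ?_⟩
  have h1 : formMap χ e m = 0 := LinearMap.congr_fun h0 m
  rw [← formMap_apply χ e m ⟨e, Submodule.mem_span_singleton_self e⟩, h1, KDual.zero_apply]

/-- An indecomposable injective module is `I_x` for some point `x`. -/
theorem exists_linearEquiv_injAt [FiniteDimensional k C] {ι : Type*} [Fintype ι] {e : ι → C}
    (he : IsPointSystem e) {M : ModuleCat.{u} Cᵐᵒᵖ} (hM : IsInd M) (hI : Injective M) :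
    ∃ x, Nonempty (M ≃ₗ[Cᵐᵒᵖ] injAt k (e x)) := by
  have := isArtinianRing_of_finiteDimensional k Cᵐᵒᵖ
  have := hM.finite
  have := finiteDimensional_of_finite k (R := Cᵐᵒᵖ) M
  let b := Module.finBasis k M
  -- The points may live in another universe; a `Fin` index keeps the product of injectives below in
  -- `Type u`. Coordinates at all points embed `M` into this product, and injectivity of `M` splits
  -- the embedding.
  let ν := (Fintype.equivFin ι).symm
  let L : Fin (Module.finrank k M) × Fin (Fintype.card ι) → ModuleCat.{u} Cᵐᵒᵖ :=
    fun j => injAt k (e (ν j.2))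
  let i : M →ₗ[Cᵐᵒᵖ] ∀ j, L j := LinearMap.pi fun j => formMap (b.coord j.1) (e (ν j.2))
  have hi : Function.Injective i := by
    rw [← LinearMap.ker_eq_bot, eq_bot_iff]
    intro m hm
    have h1 : ∀ x, op (e x) • m = 0 := fun x => by
      apply b.ext_elem
      intro j
      have h2 : formMap (b.coord j) (e (ν (ν.symm x))) m = 0 :=
        congrFun (LinearMap.mem_ker.1 hm) (j, ν.symm x)
      rw [Equiv.apply_symm_apply] at h2
      have h3 := formMap_apply (b.coord j) (e x) m ⟨e x, Submodule.mem_span_singleton_self _⟩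
      rw [h2, KDual.zero_apply] at h3
      rw [map_zero, Finsupp.zero_apply]
      exact h3.symm
    rw [Submodule.mem_bot, ← one_smul Cᵐᵒᵖ m, ← op_one, ← he.complete.complete, Finset.op_sum,
      Finset.sum_smul]
    exact Finset.sum_eq_zero fun x _ => h1 x
  let ic : M ⟶ ModuleCat.of Cᵐᵒᵖ (∀ j, L j) := ModuleCat.ofHom i
  have : Mono ic := (ModuleCat.mono_iff_injective _).2 hi
  let r := Injective.factorThru (𝟙 M) ic
  have hr : ic ≫ r = 𝟙 M := Injective.comp_factorThru _ _
  obtain ⟨j, hj⟩ := hM.exists_linearEquiv_of_retract (L := L)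
    (fun j => isInd_injAt (he.primitive _)) i r.hom
    (congrArg ModuleCat.Hom.hom hr)
  exact ⟨_, hj⟩

end Points

/-! ### Minimal right almost split maps. -/

section Sinks

variable {R : Type u} [Ring R]

theorem isSplitMono_iff {M N : ModuleCat.{u} R} (f : M →ₗ[R] N) :
    IsSplitMono (ModuleCat.ofHom f) ↔ ∃ r : N →ₗ[R] M, r ∘ₗ f = LinearMap.id := by
  constructor
  · rintro ⟨⟨r, hr⟩⟩
    exact ⟨r.hom, congrArg ModuleCat.Hom.hom hr⟩
  · rintro ⟨r, hr⟩
    exact ⟨⟨⟨ModuleCat.ofHom r, ModuleCat.hom_ext hr⟩⟩⟩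

theorem isSplitEpi_iff {M N : ModuleCat.{u} R} (f : M →ₗ[R] N) :
    IsSplitEpi (ModuleCat.ofHom f) ↔ ∃ s : N →ₗ[R] M, f ∘ₗ s = LinearMap.id := by
  constructor
  · rintro ⟨⟨r, hr⟩⟩
    exact ⟨r.hom, congrArg ModuleCat.Hom.hom hr⟩
  · rintro ⟨r, hr⟩
    exact ⟨⟨⟨ModuleCat.ofHom r, ModuleCat.hom_ext hr⟩⟩⟩

/-- `p` is a minimal right almost split map. -/
structure IsSink {E M : ModuleCat.{u} R} (p : E →ₗ[R] M) : Prop where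
  finite : Module.Finite R E
  not_split : ¬ ∃ s : M →ₗ[R] E, p ∘ₗ s = LinearMap.id
  lift : ∀ (X : ModuleCat.{u} R) (f : X →ₗ[R] M), Module.Finite R X →
    (¬ ∃ s : M →ₗ[R] X, f ∘ₗ s = LinearMap.id) → ∃ f' : X →ₗ[R] E, p ∘ₗ f' = f
  minimal : ∀ θ : E →ₗ[R] E, p ∘ₗ θ = p → Function.Bijective θ

/-- Components of a sink map at indecomposable summands are irreducible, so summands of `E` are
predecessors in the Auslander–Reiten quiver. -/
theorem IsSink.arrow {E M : ModuleCat.{u} R} {p : E →ₗ[R] M} (hp : IsSink p) (hM : IsInd M)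
    {ι : Type*} [Fintype ι] {X : ι → ModuleCat.{u} R} (e : E ≃ₗ[R] ∀ i, X i) (i : ι)
    (hX : IsInd (X i)) : Arrow (X i) M := by
  classical
  let inc : X i →ₗ[R] E := e.symm.toLinearMap ∘ₗ LinearMap.single R (fun i => (X i : Type u)) i
  let pr : E →ₗ[R] X i := LinearMap.proj i ∘ₗ e.toLinearMap
  have hpr : ∀ x, pr (inc x) = x := fun x => by simp [pr, inc]
  have hse : ¬ ∃ s : M →ₗ[R] X i, (p ∘ₗ inc) ∘ₗ s = LinearMap.id := by
    rintro ⟨s, hs⟩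
    exact hp.not_split ⟨inc ∘ₗ s, hs⟩
  refine ⟨hX, hM, ModuleCat.ofHom (p ∘ₗ inc), ?_, ?_, ?_⟩
  · rw [isSplitMono_iff]
    rintro ⟨r, hr⟩
    have hb := (hX.bijective_of_comp hM (f := p ∘ₗ inc) (g := r)
      (by rw [hr]; exact Function.bijective_id)).1
    let e' := LinearEquiv.ofBijective _ hb
    exact hse ⟨e'.symm.toLinearMap, LinearMap.ext fun x => e'.apply_symm_apply x⟩
  · rw [isSplitEpi_iff]
    exact hse
  · intro Y g h hY hgh
    by_cases hh : IsSplitEpi h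
    · exact Or.inr hh
    left
    have hh' : ¬ ∃ s : M →ₗ[R] Y, h.hom ∘ₗ s = LinearMap.id := by
      rw [← isSplitEpi_iff]
      exact hh
    obtain ⟨h', hh''⟩ := hp.lift Y h.hom hY hh'
    have hgh' : ∀ x, h.hom (g.hom x) = p (inc x) := fun x =>
      LinearMap.congr_fun (congrArg ModuleCat.Hom.hom hgh) x
    have hp' : ∀ y, p (h' y) = h.hom y := LinearMap.congr_fun hh''
    -- Replacing the component `inc` by `h' ∘ g` does not change `p`. By minimality the result is an
    -- automorphism, which makes `g` a split monomorphism.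
    let θ : E →ₗ[R] E := h' ∘ₗ g.hom ∘ₗ pr + (LinearMap.id - inc ∘ₗ pr)
    have hθ := hp.minimal θ (by
      ext x
      simp [θ, hp', hgh'])
    let e' := LinearEquiv.ofBijective θ hθ
    refine (isSplitMono_iff g.hom).2 ⟨pr ∘ₗ e'.symm.toLinearMap ∘ₗ h', ?_⟩
    ext x
    have h1 : θ (inc x) = h' (g.hom x) := by simp [θ, hpr]
    change pr (e'.symm (h' (g.hom x))) = x
    rw [← h1]
    have h2 : e'.symm (θ (inc x)) = inc x := e'.symm_apply_apply _
    rw [h2, hpr]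

/-- The inclusion of a maximal submodule is a sink map of an indecomposable projective module. -/
theorem isSink_of_isCoatom [IsArtinianRing R] {M : ModuleCat.{u} R} (hM : IsInd M)
    [Module.Projective R M] {E : Submodule R M} (hE : IsCoatom E) :
    IsSink (E := ModuleCat.of R E) E.subtype := by
  have := hM.finite
  refine ⟨inferInstance, ?_, ?_, ?_⟩
  · rintro ⟨s, hs⟩
    apply hE.1
    rw [eq_top_iff]
    intro x _
    have h1 : (s x : M) = x := LinearMap.congr_fun hs x
    rw [← h1]
    exact (s x).2
  · intro X f _ hf
    have hle : LinearMap.range f ≤ E := by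
      by_contra hne
      have hsup : LinearMap.range f ⊔ E = ⊤ := by
        rw [sup_comm]
        exact hE.2 _ (left_lt_sup.2 hne)
      have hsurj : Function.Surjective (f.coprod E.subtype) := by
        rw [← LinearMap.range_eq_top, LinearMap.range_coprod, Submodule.range_subtype, hsup]
      -- A section writes the identity of `M` as a map through `f` plus a map into `E`. One of them
      -- is bijective: the first would split `f`, the second would make `E` everything.
      obtain ⟨s, hs⟩ := Module.projective_lifting_property (f.coprod E.subtype) LinearMap.id hsurj
      have h1 : (f ∘ₗ LinearMap.fst R X E ∘ₗ s) + (E.subtype ∘ₗ LinearMap.snd R X E ∘ₗ s) =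
          LinearMap.id := by
        rw [← hs]
        ext x
        simp
      rcases hM.bijective_of_add h1 with h2 | h2
      · let e' := LinearEquiv.ofBijective _ h2
        exact hf ⟨(LinearMap.fst R X E ∘ₗ s) ∘ₗ e'.symm.toLinearMap,
          LinearMap.ext fun x => e'.apply_symm_apply x⟩
      · apply hE.1
        rw [eq_top_iff]
        intro x _
        obtain ⟨y, rfl⟩ := h2.2 x
        exact Subtype.coe_prop _
    exact ⟨f.codRestrict E fun x => hle ⟨x, rfl⟩, rfl⟩
  · intro θ hθ
    have : θ = LinearMap.id := by
      ext x
      exact LinearMap.congr_fun hθ x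
    rw [this]
    exact Function.bijective_id

theorem exists_isSink_of_projective [IsArtinianRing R] {M : ModuleCat.{u} R} (hM : IsInd M)
    [Module.Projective R M] :
    ∃ (E : ModuleCat.{u} R) (p : E →ₗ[R] M), IsSink p ∧ Function.Injective p := by
  have := hM.finite
  have := hM.nontrivial
  obtain ⟨E, hE, -⟩ := (eq_top_or_exists_le_coatom (⊥ : Submodule R M)).resolve_left bot_ne_top
  exact ⟨ModuleCat.of R E, E.subtype, isSink_of_isCoatom hM hE, E.injective_subtype⟩

end Sinks

/-! ### Almost split sequences ending at bricks of projective dimension one. -/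

section AlmostSplit

variable {k : Type u} [Field k] {C : Type u} [Ring C] [Algebra k C] [FiniteDimensional k C]
  {P₁ P₀ M : ModuleCat.{u} Cᵐᵒᵖ} {p₁ : P₁ →ₗ[Cᵐᵒᵖ] P₀} {p₀ : P₀ →ₗ[Cᵐᵒᵖ] M}

/-- The almost split sequence ending at a module of projective dimension one all of whose nonzero
endomorphisms are bijective. -/
theorem exists_isSink_of_brick (h : IsMinPresentation p₁ p₀) (hI : IsInd M)
    (hM : ¬ Module.Projective Cᵐᵒᵖ M) (hinj : Function.Injective p₁)
    (hbrick : ∀ f : M →ₗ[Cᵐᵒᵖ] M, f ≠ 0 → Function.Bijective f) {N : ModuleCat.{u} Cᵐᵒᵖ}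
    (eN : N ≃ₗ[Cᵐᵒᵖ] KDual k (Transpose p₁)) :
    ∃ (E : ModuleCat.{u} Cᵐᵒᵖ) (a : N →ₗ[Cᵐᵒᵖ] E) (π : E →ₗ[Cᵐᵒᵖ] M), IsSink π ∧
      Function.Injective a ∧ Function.Exact a π := by
  have := isArtinianRing_of_finiteDimensional k Cᵐᵒᵖ
  have := h.finite₁
  have := h.finite₀
  have := h.projective₁
  have := h.projective₀
  have hτ : IsInd N := (isInd_tauOf (k := k) h hI hM).of_linearEquiv eN.symm
  have := hτ.finite
  have := hτ.nontrivial
  obtain ⟨t, hns, hext⟩ := exists_almost_factor eN hτ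
  obtain ⟨E, a, π, j, ha, he, hπ, hj, hjp, hs, hexact⟩ := exists_pushout h.exact h.surjective
    (t := t) (by rw [LinearMap.ker_eq_bot.2 hinj]; exact bot_le)
  have hfin : Module.Finite Cᵐᵒᵖ E := Module.Finite.of_surjective _ hs
  have hnr : ¬ ∃ r : E →ₗ[Cᵐᵒᵖ] N, r ∘ₗ a = LinearMap.id := by
    rintro ⟨r, hr⟩
    refine hns ⟨r ∘ₗ j, ?_⟩
    rw [LinearMap.comp_assoc, hj, ← LinearMap.comp_assoc, hr, LinearMap.id_comp]
  have hnse : ¬ ∃ s : M →ₗ[Cᵐᵒᵖ] E, π ∘ₗ s = LinearMap.id := by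
    rintro ⟨s, hs⟩
    exact hnr (exists_retraction_of_section ha he hs)
  refine ⟨E, a, π, ⟨hfin, hnse, ?_, ?_⟩, ha, he⟩
  · intro X f hX hf
    let Y : Submodule Cᵐᵒᵖ (E × X) :=
      LinearMap.ker (π ∘ₗ LinearMap.fst Cᵐᵒᵖ E X - f ∘ₗ LinearMap.snd Cᵐᵒᵖ E X)
    have hY : ∀ z : E × X, z ∈ Y ↔ π z.1 = f z.2 := fun z => by simp [Y, sub_eq_zero]
    let pr₁ : Y →ₗ[Cᵐᵒᵖ] E := LinearMap.fst Cᵐᵒᵖ E X ∘ₗ Y.subtype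
    let pr₂ : Y →ₗ[Cᵐᵒᵖ] X := LinearMap.snd Cᵐᵒᵖ E X ∘ₗ Y.subtype
    have hpr (y : Y) : π (pr₁ y) = f (pr₂ y) := (hY _).1 y.2
    let v : N →ₗ[Cᵐᵒᵖ] Y := (LinearMap.inl Cᵐᵒᵖ E X ∘ₗ a).codRestrict Y fun n =>
      (hY _).2 (by simp [he.apply_apply_eq_zero])
    have hv₁ (n : N) : pr₁ (v n) = a n := rfl
    have hv₂ (n : N) : pr₂ (v n) = 0 := rfl
    -- The pullback `Y` of the sequence along `f` splits exactly when `f` lifts to `E`. If `v` does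
    -- not split, then `v ∘ t` factors through `p₁`, so `v` extends to `w : E → Y`.
    by_cases hsm : ∃ r : Y →ₗ[Cᵐᵒᵖ] N, r ∘ₗ v = LinearMap.id
    · obtain ⟨r, hr⟩ := hsm
      have hex : Function.Exact v pr₂ := by
        intro y
        constructor
        · intro hy
          have h1 : π (pr₁ y) = 0 := by rw [hpr, hy, map_zero]
          obtain ⟨n, hn⟩ := (he _).1 h1
          exact ⟨n, Subtype.ext (Prod.ext hn hy.symm)⟩
        · rintro ⟨n, rfl⟩
          rfl
      have hsurj : Function.Surjective pr₂ := fun x => by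
        obtain ⟨z, hz⟩ := hπ (f x)
        exact ⟨⟨(z, x), (hY _).2 hz⟩, rfl⟩
      obtain ⟨σ, hσ⟩ := exists_section_of_retraction hex hsurj hr
      refine ⟨pr₁ ∘ₗ σ, ?_⟩
      ext x
      have h1 : pr₂ (σ x) = x := LinearMap.congr_fun hσ x
      simp [hpr, h1]
    · exfalso
      obtain ⟨s, hs'⟩ := hext (ModuleCat.of Cᵐᵒᵖ Y) v hsm
      have hs'' : ∀ x, s (p₁ x) = v (t x) := LinearMap.congr_fun hs'
      obtain ⟨w, hw⟩ := exists_comp_eq_of_ker_le hs (m := s.coprod v) (by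
        intro z hz
        obtain ⟨x, rfl⟩ := (hexact z).1 hz
        simp [hs''])
      have hwa : ∀ n, w (a n) = v n := fun n => by
        simpa using LinearMap.congr_fun hw (0, n)
      obtain ⟨q, hq⟩ := exists_comp_eq_of_ker_le hπ (m := pr₂ ∘ₗ w) (by
        intro z hz
        obtain ⟨n, rfl⟩ := (he z).1 hz
        rw [LinearMap.mem_ker, LinearMap.comp_apply, hwa, hv₂])
      have hq' : ∀ z, q (π z) = pr₂ (w z) := LinearMap.congr_fun hq
      -- The map `f ∘ q` is an endomorphism of the brick `M`. If it is zero, `pr₁ ∘ w` lands in `N`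
      -- and retracts `a`; otherwise it is bijective and `f` is a split epimorphism.
      by_cases h0 : f ∘ₗ q = 0
      · have h1 (z : E) : π (pr₁ (w z)) = 0 := by
          rw [hpr, ← hq']
          exact LinearMap.congr_fun h0 _
        let e' := LinearEquiv.ofInjective a ha
        refine hnr ⟨e'.symm.toLinearMap ∘ₗ (pr₁ ∘ₗ w).codRestrict (LinearMap.range a)
          (fun z => (he _).1 (h1 z)), ?_⟩
        ext n
        simp only [LinearMap.comp_apply, LinearEquiv.coe_coe, LinearMap.id_apply,
          LinearEquiv.symm_apply_eq]
        apply Subtype.ext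
        change pr₁ (w (a n)) = a n
        rw [hwa, hv₁]
      · let e' := LinearEquiv.ofBijective _ (hbrick _ h0)
        exact hf ⟨q ∘ₗ e'.symm.toLinearMap, LinearMap.ext fun x => e'.apply_symm_apply x⟩
  · intro θ hθ
    have hθ' : ∀ z, π (θ z) = π z := LinearMap.congr_fun hθ
    let e' := LinearEquiv.ofInjective a ha
    let ψ : Module.End Cᵐᵒᵖ N := e'.symm.toLinearMap ∘ₗ (θ ∘ₗ a).codRestrict (LinearMap.range a)
      (fun n => (he _).1 (by rw [LinearMap.comp_apply, hθ', he.apply_apply_eq_zero]))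
    have hψ (n : N) : a (ψ n) = θ (a n) := by
      have h1 : e' (ψ n) = _ := e'.apply_symm_apply _
      exact congrArg Subtype.val h1
    -- If the restriction of `θ` to `N` were nilpotent, a power of `θ` would kill `N` while still
    -- lying over the identity of `M`, which would split `π`.
    rcases hτ.bijective_or_isNilpotent ψ with hb | ⟨m, hm⟩
    · refine IsArtinian.bijective_of_injective_endomorphism θ ?_
      rw [← LinearMap.ker_eq_bot, eq_bot_iff]
      intro z hz
      have h1 : π z = 0 := by rw [← hθ', LinearMap.mem_ker.1 hz, map_zero]
      obtain ⟨n, rfl⟩ := (he z).1 h1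
      have h2 : a (ψ n) = 0 := by rw [hψ, LinearMap.mem_ker.1 hz]
      have h3 : ψ n = 0 := ha (by rw [h2, map_zero])
      have h4 : n = 0 := hb.1 (by rw [h3, map_zero])
      simp [h4]
    · exfalso
      have h1 : ∀ (i : ℕ) n, ((θ : Module.End Cᵐᵒᵖ E) ^ i) (a n) = a ((ψ ^ i) n) := by
        intro i
        induction i with
        | zero => simp
        | succ i ih => intro n; rw [pow_succ', pow_succ', Module.End.mul_apply, ih,
            Module.End.mul_apply, hψ]
      have h2 : ∀ (i : ℕ) z, π (((θ : Module.End Cᵐᵒᵖ E) ^ i) z) = π z := by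
        intro i
        induction i with
        | zero => simp
        | succ i ih => intro z; rw [pow_succ', Module.End.mul_apply, hθ', ih]
      obtain ⟨σ, hσ⟩ := exists_comp_eq_of_ker_le hπ (m := (θ : Module.End Cᵐᵒᵖ E) ^ m) (by
        intro z hz
        obtain ⟨n, rfl⟩ := (he z).1 hz
        rw [LinearMap.mem_ker, h1, hm]
        simp)
      refine hnse ⟨σ, ?_⟩
      ext x
      obtain ⟨z, rfl⟩ := hπ x
      have h3 : σ (π z) = _ := LinearMap.congr_fun hσ z
      rw [LinearMap.comp_apply, h3, h2]
      rfl

end AlmostSplit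

section Resolutions

variable {R : Type u} [Ring R]

/-- `0 → P₁ → P₀ → M → 0` is a projective resolution by finitely generated modules. -/
structure IsRes {P₁ P₀ M : ModuleCat.{u} R} (i : P₁ →ₗ[R] P₀) (p : P₀ →ₗ[R] M) : Prop where
  finite₁ : Module.Finite R P₁
  finite₀ : Module.Finite R P₀
  projective₁ : Module.Projective R P₁
  projective₀ : Module.Projective R P₀
  injective : Function.Injective i
  exact : Function.Exact i p
  surjective : Function.Surjective p

theorem IsRes.of_projective (M : ModuleCat.{u} R) [Module.Finite R M] [Module.Projective R M] :
    IsRes (P₁ := ModuleCat.of R PUnit.{u + 1}) (0 : PUnit.{u + 1} →ₗ[R] M) LinearMap.id where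
  finite₁ := inferInstance
  finite₀ := inferInstance
  projective₁ := inferInstance
  projective₀ := inferInstance
  injective _ _ _ := rfl
  exact x := ⟨fun h => ⟨PUnit.unit, h.symm⟩, by rintro ⟨y, rfl⟩; rfl⟩
  surjective := Function.surjective_id

theorem ExtZero.of_projective {M N : ModuleCat.{u} R} [Module.Finite R M]
    [Module.Projective R M] : ExtZero M N :=
  have h := IsRes.of_projective M
  ExtZero.of_exact h.exact h.surjective fun t => ⟨0, LinearMap.ext fun x => by
    rw [Subsingleton.elim x 0, map_zero, map_zero]⟩

theorem projective_iff (M : ModuleCat.{u} R) : Projective M ↔ Module.Projective R M :=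
  (IsProjective.iff_projective (R := R) M).symm

end Resolutions

/-! ### Homological properties of complete slices. -/

section Slices

variable {k : Type u} [Field k] {C : Type u} [Ring C] [Algebra k C] [FiniteDimensional k C]
  {S : Set (ModuleCat.{u} Cᵐᵒᵖ)}

theorem IsCompleteSlice.mem_of_ne_zero (hS : IsCompleteSlice k S) {M N X : ModuleCat.{u} Cᵐᵒᵖ}
    (hM : M ∈ S) (hN : N ∈ S) (hX : IsInd X) {f : M →ₗ[Cᵐᵒᵖ] X} (hf : f ≠ 0)
    {g : X →ₗ[Cᵐᵒᵖ] N} (hg : g ≠ 0) : X ∈ S :=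
  hS.convex M hM N hN X (.of_ne_zero (hS.points.ind M hM) hX hf)
    (.of_ne_zero hX (hS.points.ind N hN) hg)

theorem IsCompleteSlice.mem_of_linearEquiv (hS : IsCompleteSlice k S) {M N : ModuleCat.{u} Cᵐᵒᵖ}
    (hM : M ∈ S) (e : M ≃ₗ[Cᵐᵒᵖ] N) : N ∈ S :=
  hS.points.iso M hM N ⟨e.toModuleIso⟩

section Presentation

variable {M N P₁ P₀ : ModuleCat.{u} Cᵐᵒᵖ} {p₁ : P₁ →ₗ[Cᵐᵒᵖ] P₀} {p₀ : P₀ →ₗ[Cᵐᵒᵖ] M}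

/-- Since `D Tr M ⇝ M`, convexity would put `D Tr M` in the slice together with `M`. -/
theorem IsCompleteSlice.not_leads_tauOf (hS : IsCompleteSlice k S) (hM : M ∈ S)
    (hp : ¬ Module.Projective Cᵐᵒᵖ M) (h : IsMinPresentation p₁ p₀) (hN : N ∈ S) :
    ¬ Leads N (tauOf k p₁) := by
  intro hl
  have hI := hS.points.ind M hM
  exact hS.tau M (tauOf k p₁) hI (by rwa [projective_iff])
    ⟨P₁, P₀, p₁, p₀, h, ⟨LinearEquiv.refl _ _⟩⟩
    ⟨hM, hS.convex N hN M hM _ hl (leads_tauOf h hI hp)⟩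

theorem IsCompleteSlice.hom_tauOf_eq_zero (hS : IsCompleteSlice k S) (hM : M ∈ S)
    (hp : ¬ Module.Projective Cᵐᵒᵖ M) (h : IsMinPresentation p₁ p₀) (hN : N ∈ S)
    (φ : N →ₗ[Cᵐᵒᵖ] tauOf k p₁) : φ = 0 := by
  by_contra hφ
  exact hS.not_leads_tauOf hM hp h hN
    (.of_ne_zero (hS.points.ind N hN) (isInd_tauOf h (hS.points.ind M hM) hp) hφ)

/-- A nonzero kernel gives a nonzero map `I_x → D Tr M`. Sincerity supplies a slice module mapping
nontrivially to `I_x`, hence a forbidden path to `D Tr M`. So slice modules have projective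
dimension at most one. -/
theorem IsCompleteSlice.injective_of_minPresentation (hS : IsCompleteSlice k S) {ι : Type*}
    [Fintype ι] {e : ι → C} (he : IsPointSystem e) (hM : M ∈ S)
    (hp : ¬ Module.Projective Cᵐᵒᵖ M) (h : IsMinPresentation p₁ p₀) :
    Function.Injective p₁ := by
  have := h.finite₁
  have := h.projective₁
  rw [← LinearMap.ker_eq_bot, eq_bot_iff]
  intro z hz
  by_contra hz0
  obtain ⟨x, φ, hφ⟩ := exists_injAt_ne_zero (k := k) he.complete (LinearMap.mem_ker.1 hz) hz0
  have hx := he.primitive x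
  obtain ⟨N, hN, m, hm⟩ := hS.sincere (e x) hx.1 hx.2.1
  obtain ⟨ψ, hψ⟩ := exists_ne_zero_injAt (k := k) hm
  have hJ := isInd_injAt (k := k) hx
  exact hS.not_leads_tauOf hM hp h hN ((Leads.of_ne_zero (hS.points.ind N hN) hJ hψ).trans
    (.of_ne_zero hJ (isInd_tauOf h (hS.points.ind M hM) hp) hφ))

end Presentation

theorem IsCompleteSlice.extZero (hS : IsCompleteSlice k S) {M N : ModuleCat.{u} Cᵐᵒᵖ}
    (hM : M ∈ S) (hN : N ∈ S) : ExtZero M N := by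
  have := isArtinianRing_of_finiteDimensional k Cᵐᵒᵖ
  have := (hS.points.ind M hM).finite
  by_cases hp : Module.Projective Cᵐᵒᵖ M
  · exact ExtZero.of_projective
  obtain ⟨P₁, P₀, p₁, p₀, h⟩ := exists_minPresentation M
  have := h.finite₁
  have := h.projective₁
  have := h.projective₀
  refine ExtZero.of_exact h.exact h.surjective fun t => ?_
  by_contra ht
  obtain ⟨φ, hφ⟩ := exists_ne_zero_of_not_factor (k := k) ht
  exact hφ (hS.hom_tauOf_eq_zero hM hp h hN φ)

theorem IsCompleteSlice.exists_isRes (hS : IsCompleteSlice k S) {ι : Type*}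
    [Fintype ι] {e : ι → C} (he : IsPointSystem e) {M : ModuleCat.{u} Cᵐᵒᵖ} (hM : M ∈ S) :
    ∃ (P₁ P₀ : ModuleCat.{u} Cᵐᵒᵖ) (i : P₁ →ₗ[Cᵐᵒᵖ] P₀) (p : P₀ →ₗ[Cᵐᵒᵖ] M), IsRes i p := by
  have := isArtinianRing_of_finiteDimensional k Cᵐᵒᵖ
  have := (hS.points.ind M hM).finite
  by_cases hp : Module.Projective Cᵐᵒᵖ M
  · exact ⟨_, _, _, _, IsRes.of_projective M⟩
  obtain ⟨P₁, P₀, p₁, p₀, h⟩ := exists_minPresentation M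
  exact ⟨P₁, P₀, p₁, p₀, h.finite₁, h.finite₀, h.projective₁, h.projective₀,
    hS.injective_of_minPresentation he hM hp h, h.exact, h.surjective⟩

/-- Compositions of nonzero maps in a complete slice are nonzero. -/
theorem IsCompleteSlice.comp_ne_zero (hS : IsCompleteSlice k S) {X' X Y : ModuleCat.{u} Cᵐᵒᵖ}
    (hX' : X' ∈ S) (hX : X ∈ S) (hY : Y ∈ S) {f : X →ₗ[Cᵐᵒᵖ] Y} {g : X' →ₗ[Cᵐᵒᵖ] X}
    (hf : f ≠ 0) (hg : g ≠ 0) : f ∘ₗ g ≠ 0 := by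
  classical
  intro hfg
  have := isArtinianRing_of_finiteDimensional k Cᵐᵒᵖ
  have hXi := hS.points.ind X hX
  have := hXi.finite
  have : IsNoetherianRing Cᵐᵒᵖ := inferInstance
  let Z := ModuleCat.of Cᵐᵒᵖ (LinearMap.range f)
  let K := ModuleCat.of Cᵐᵒᵖ (LinearMap.ker f.rangeRestrict)
  obtain ⟨α, _, A, hA, ⟨eA⟩⟩ := exists_linearEquiv_pi Z
  obtain ⟨β, _, B, hB, ⟨eB⟩⟩ := exists_linearEquiv_pi K
  have hAS (i : α) : A i ∈ S := by
    have := (hA i).nontrivial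
    obtain ⟨x, hx⟩ := exists_ne (0 : A i)
    let s : A i →ₗ[Cᵐᵒᵖ] Z := eA.symm.toLinearMap ∘ₗ LinearMap.single Cᵐᵒᵖ (fun i => (A i : Type u)) i
    have hs : s x ≠ 0 := by simpa [s] using hx
    refine hS.mem_of_ne_zero hX hY (hA i) (f := LinearMap.proj i ∘ₗ eA.toLinearMap ∘ₗ f.rangeRestrict)
      (g := (LinearMap.range f).subtype ∘ₗ s) ?_ ?_
    · intro h0
      obtain ⟨y, hy⟩ := f.surjective_rangeRestrict (s x)
      have h1 := LinearMap.congr_fun h0 y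
      simp only [LinearMap.comp_apply, hy] at h1
      simp [s] at h1
      exact hx h1
    · intro h0
      exact hs (Subtype.ext (LinearMap.congr_fun h0 x))
  let g' : X' →ₗ[Cᵐᵒᵖ] K := g.codRestrict _ fun x => by
    rw [LinearMap.ker_rangeRestrict]
    exact LinearMap.congr_fun hfg x
  have hg' : g' ≠ 0 := fun h0 => hg (by
    ext x
    exact congrArg Subtype.val (LinearMap.congr_fun h0 x))
  obtain ⟨j, hj⟩ := exists_proj_ne_zero eB hg'
  let s : B j →ₗ[Cᵐᵒᵖ] K := eB.symm.toLinearMap ∘ₗ LinearMap.single Cᵐᵒᵖ (fun i => (B i : Type u)) j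
  have := (hB j).nontrivial
  have hs : (LinearMap.ker f.rangeRestrict).subtype ∘ₗ s ≠ 0 := by
    obtain ⟨x, hx⟩ := exists_ne (0 : B j)
    intro h0
    have h1 : s x = 0 := Subtype.ext (LinearMap.congr_fun h0 x)
    exact hx (by simpa [s] using h1)
  have hBS : B j ∈ S := hS.mem_of_ne_zero hX' hX (hB j) hj hs
  -- The summands of the image of `f`, and the summand `B j` of its kernel reached by `g`, lie in
  -- the slice. So the projection of the kernel onto `B j` extends to `X`, which makes `B j` a
  -- summand of `X`, hence all of `X`, and forces `f = 0`.
  have hext : ExtZero Z (B j) := ExtZero.pi_left eA fun i => hS.extZero (hAS i) hBS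
  obtain ⟨r, hr⟩ := hext X f.rangeRestrict f.surjective_rangeRestrict
    (LinearMap.proj j ∘ₗ eB.toLinearMap)
  have hrs : r ∘ₗ ((LinearMap.ker f.rangeRestrict).subtype ∘ₗ s) = LinearMap.id := by
    rw [← LinearMap.comp_assoc, hr]
    ext x
    simp [s]
  have hb := ((hB j).bijective_of_comp hXi (f := (LinearMap.ker f.rangeRestrict).subtype ∘ₗ s)
    (g := r) (by rw [hrs]; exact Function.bijective_id)).1
  apply hf
  ext x
  obtain ⟨y, rfl⟩ := hb.2 x
  have h2 : f.rangeRestrict (s y).1 = 0 := (s y).2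
  exact congrArg Subtype.val h2

/-- Powers of a nonzero endomorphism stay nonzero, so Fitting's lemma leaves only the bijective
case: slice modules are bricks. -/
theorem IsCompleteSlice.bijective_of_ne_zero (hS : IsCompleteSlice k S) {X : ModuleCat.{u} Cᵐᵒᵖ}
    (hX : X ∈ S) {f : X →ₗ[Cᵐᵒᵖ] X} (hf : f ≠ 0) : Function.Bijective f := by
  have := isArtinianRing_of_finiteDimensional k Cᵐᵒᵖ
  have hXi := hS.points.ind X hX
  have := hXi.nontrivial
  refine (hXi.bijective_or_isNilpotent f).resolve_right ?_
  rintro ⟨n, hn⟩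
  have h : ∀ n, (f : Module.End Cᵐᵒᵖ X) ^ n ≠ 0 := by
    intro n
    induction n with
    | zero => rw [pow_zero]; exact one_ne_zero
    | succ n ih => rw [pow_succ]; exact hS.comp_ne_zero hX hX hX ih hf
  exact h n hn

theorem IsCompleteSlice.bijective_of_cycle (hS : IsCompleteSlice k S) {X Y : ModuleCat.{u} Cᵐᵒᵖ}
    (hX : X ∈ S) (hY : Y ∈ S) {f : X →ₗ[Cᵐᵒᵖ] Y} (hf : f ≠ 0) {g : Y →ₗ[Cᵐᵒᵖ] X} (hg : g ≠ 0) :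
    Function.Bijective f :=
  ((hS.points.ind X hX).bijective_of_comp (hS.points.ind Y hY)
    (hS.bijective_of_ne_zero hX (hS.comp_ne_zero hX hY hX hg hf))).1

theorem finrank_end_eq_one [IsAlgClosed k] {R : Type u} [Ring R] [Algebra k R]
    [FiniteDimensional k R] {X : ModuleCat.{u} R} [Module.Finite R X] [Nontrivial X]
    (h : ∀ f : X →ₗ[R] X, f ≠ 0 → Function.Bijective f) :
    Module.finrank k (X →ₗ[R] X) = 1 := by
  have := finiteDimensional_of_finite k (R := R) X
  refine finrank_eq_one (LinearMap.id : X →ₗ[R] X) (fun h0 => ?_) fun f => ?_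
  · obtain ⟨x, hx⟩ := exists_ne (0 : X)
    exact hx (LinearMap.congr_fun h0 x)
  · obtain ⟨c, hc⟩ := Module.End.exists_eigenvalue (f.restrictScalars k)
    obtain ⟨v, hv⟩ := hc.exists_hasEigenvector
    refine ⟨c, ?_⟩
    by_contra hne
    have h1 : f - c • LinearMap.id ≠ 0 := fun h0 => hne (sub_eq_zero.1 h0).symm
    apply hv.2
    apply (h _ h1).1
    have h2 : f v = c • v := hv.apply_eq_smul
    simp [h2]

/-- The sink map of a module in a complete slice. -/
theorem IsCompleteSlice.exists_isSink (hS : IsCompleteSlice k S) {ι : Type*}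
    [Fintype ι] {e : ι → C} (he : IsPointSystem e) {M : ModuleCat.{u} Cᵐᵒᵖ} (hM : M ∈ S) :
    ∃ (E : ModuleCat.{u} Cᵐᵒᵖ) (p : E →ₗ[Cᵐᵒᵖ] M), IsSink p ∧
      ∀ X ∈ S, ∀ g : X →ₗ[Cᵐᵒᵖ] E, p ∘ₗ g = 0 → g = 0 := by
  have := isArtinianRing_of_finiteDimensional k Cᵐᵒᵖ
  have hI := hS.points.ind M hM
  have := hI.finite
  by_cases hp : Module.Projective Cᵐᵒᵖ M
  · obtain ⟨E, p, hp, hinj⟩ := exists_isSink_of_projective hI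
    refine ⟨E, p, hp, fun X _ g hg => ?_⟩
    ext x
    apply hinj
    rw [LinearMap.zero_apply, map_zero]
    exact LinearMap.congr_fun hg x
  · obtain ⟨P₁, P₀, p₁, p₀, h⟩ := exists_minPresentation M
    obtain ⟨E, a, π, hπ, ha, hexact⟩ := exists_isSink_of_brick (k := k) h hI hp
      (hS.injective_of_minPresentation he hM hp h) (fun f hf => hS.bijective_of_ne_zero hM hf)
      (N := tauOf k p₁) (LinearEquiv.refl _ _)
    -- The kernel of the sink map is `D Tr M`, which receives no nonzero map from the slice.
    refine ⟨E, π, hπ, fun X hX g hg => ?_⟩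
    let e' := LinearEquiv.ofInjective a ha
    let g' : X →ₗ[Cᵐᵒᵖ] tauOf k p₁ := e'.symm.toLinearMap ∘ₗ
      g.codRestrict (LinearMap.range a) (fun x => (hexact _).1 (LinearMap.congr_fun hg x))
    have hg' (x : X) : a (g' x) = g x := by
      have h1 : e' (g' x) = _ := e'.apply_symm_apply _
      exact congrArg Subtype.val h1
    ext x
    rw [← hg', hS.hom_tauOf_eq_zero hM hp h hX g', LinearMap.zero_apply, LinearMap.zero_apply,
      map_zero]

/-- A predecessor of a slice module that lies outside the slice is a translate of a slice module.
-/
theorem IsCompleteSlice.exists_tau_of_arrow (hS : IsCompleteSlice k S) {M Y : ModuleCat.{u} Cᵐᵒᵖ}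
    (hM : M ∈ S) (h : Arrow Y M) (hY : Y ∉ S) :
    ∃ L ∈ S, ¬ Module.Projective Cᵐᵒᵖ L ∧ IsTau k Y L := by
  rcases hS.arrow Y M hM h with h1 | ⟨-, L, hL, hp, hτ⟩
  · exact absurd h1 hY
  · exact ⟨L, hL, by rwa [← projective_iff], hτ⟩

theorem IsCompleteSlice.hom_eq_zero_of_isTau (hS : IsCompleteSlice k S)
    {X Y L : ModuleCat.{u} Cᵐᵒᵖ} (hX : X ∈ S) (hL : L ∈ S) (hp : ¬ Module.Projective Cᵐᵒᵖ L)
    (h : IsTau k Y L) (f : X →ₗ[Cᵐᵒᵖ] Y) : f = 0 := by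
  obtain ⟨P₁, P₀, p₁, p₀, hmin, ⟨e⟩⟩ := h
  have h1 := hS.hom_tauOf_eq_zero hL hp hmin hX (e.toLinearMap ∘ₗ f)
  ext x
  apply e.injective
  rw [LinearMap.zero_apply, map_zero]
  exact LinearMap.congr_fun h1 x

/-- Projective dimension at most one makes the converse half of the Auslander–Reiten formula
available, for a module `W` that need not belong to the slice. -/
theorem IsCompleteSlice.hom_eq_zero_of_extZero (hS : IsCompleteSlice k S) {ι : Type*}
    [Fintype ι] {e : ι → C} (he : IsPointSystem e)
    {W Y L : ModuleCat.{u} Cᵐᵒᵖ} (hL : L ∈ S) (hp : ¬ Module.Projective Cᵐᵒᵖ L)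
    (h : IsTau k Y L) (hW : ExtZero L W) (f : W →ₗ[Cᵐᵒᵖ] Y) : f = 0 := by
  obtain ⟨P₁, P₀, p₁, p₀, hmin, ⟨eY⟩⟩ := h
  have := hmin.finite₁
  have := hmin.finite₀
  have := hmin.projective₁
  have := hmin.projective₀
  by_contra hf
  obtain ⟨t, ht⟩ := exists_not_factor_of_ne_zero (k := k) (p := p₁)
    (φ := eY.toLinearMap ∘ₗ f) (fun h0 => hf (by
      ext x
      apply eY.injective
      rw [LinearMap.zero_apply, map_zero]
      exact LinearMap.congr_fun h0 x))
  exact ht (hW.exists_extend (hS.injective_of_minPresentation he hL hp hmin) hmin.exact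
    hmin.surjective t)

end Slices

/-! ### Dimensions of Hom-spaces in direct sums and exact sequences. -/

section HomDimensions

variable (k : Type u) [Field k] {R : Type u} [Ring R] [Algebra k R]

/-- The dimension of `Hom(M, N)`. -/
noncomputable def hdim (M N : ModuleCat.{u} R) : ℕ := Module.finrank k (M →ₗ[R] N)

variable {k}

/-- Composition with `f` on the right, as a `k`-linear map. -/
def precomp {M M' : ModuleCat.{u} R} (f : M →ₗ[R] M') (N : ModuleCat.{u} R) :
    (M' →ₗ[R] N) →ₗ[k] (M →ₗ[R] N) where
  toFun g := g ∘ₗ f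
  map_add' _ _ := rfl
  map_smul' _ _ := rfl

/-- Composition with `f` on the left, as a `k`-linear map. -/
def postcomp {N N' : ModuleCat.{u} R} (f : N →ₗ[R] N') (M : ModuleCat.{u} R) :
    (M →ₗ[R] N) →ₗ[k] (M →ₗ[R] N') where
  toFun g := f ∘ₗ g
  map_add' _ _ := LinearMap.comp_add _ _ _
  map_smul' c g := by
    have h : ∀ x, f (c • x) = c • f x := (f.restrictScalars k).map_smul c
    ext x
    exact h (g x)

theorem hdim_congr {M M' N N' : ModuleCat.{u} R} (e : M ≃ₗ[R] M') (e' : N ≃ₗ[R] N') :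
    hdim k M N = hdim k M' N' := by
  refine LinearEquiv.finrank_eq (LinearEquiv.ofBijective
    (postcomp (k := k) e'.toLinearMap M' ∘ₗ precomp e.symm.toLinearMap N)
    ⟨fun f g h => ?_, fun f => ⟨e'.symm.toLinearMap ∘ₗ f ∘ₗ e.toLinearMap, ?_⟩⟩)
  · ext x
    apply e'.injective
    simpa [postcomp, precomp] using LinearMap.congr_fun h (e x)
  · ext x
    simp [postcomp, precomp]

variable [FiniteDimensional k R]

theorem hdim_pi_right {M N' : ModuleCat.{u} R} [Module.Finite R M] {ι : Type*} [Fintype ι]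
    {N : ι → ModuleCat.{u} R} [∀ i, Module.Finite R (N i)] (e : N' ≃ₗ[R] ∀ i, N i) :
    hdim k M N' = ∑ i, hdim k M (N i) := by
  have := fun i => finiteDimensional_hom k (R := R) M (N i)
  refine Eq.trans ?_ (Module.finrank_pi_fintype k (M := fun i => M →ₗ[R] N i))
  refine LinearEquiv.finrank_eq (LinearEquiv.ofBijective
    (LinearMap.pi fun i => postcomp (k := k) (LinearMap.proj (φ := fun i => N i) i ∘ₗ e.toLinearMap) M)
    ⟨fun f g h => ?_, fun f => ⟨e.symm.toLinearMap ∘ₗ LinearMap.pi f, ?_⟩⟩)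
  · ext x
    apply e.injective
    funext i
    exact LinearMap.congr_fun (congrFun h i) x
  · funext i
    ext x
    simp [postcomp]

theorem hdim_pi_left {M' N : ModuleCat.{u} R} [Module.Finite R N] {ι : Type*} [Fintype ι]
    {M : ι → ModuleCat.{u} R} [∀ i, Module.Finite R (M i)] (e : M' ≃ₗ[R] ∀ i, M i) :
    hdim k M' N = ∑ i, hdim k (M i) N := by
  classical
  have := fun i => finiteDimensional_hom k (R := R) (M i) N
  refine Eq.trans ?_ (Module.finrank_pi_fintype k (M := fun i => M i →ₗ[R] N))
  refine LinearEquiv.finrank_eq (LinearEquiv.ofBijective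
    (LinearMap.pi fun i => precomp (k := k)
      (e.symm.toLinearMap ∘ₗ LinearMap.single R (fun i => (M i : Type u)) i) N)
    ⟨fun f g h => ?_, fun f => ⟨LinearMap.lsum R (fun i => (M i : Type u)) ℕ f ∘ₗ e.toLinearMap,
      ?_⟩⟩)
  · have h1 : f ∘ₗ e.symm.toLinearMap = g ∘ₗ e.symm.toLinearMap :=
      LinearMap.pi_ext' fun i => congrFun h i
    ext x
    simpa using LinearMap.congr_fun h1 (e x)
  · funext i
    ext x
    simp only [LinearMap.pi_apply, precomp, LinearMap.coe_mk, AddHom.coe_mk, LinearMap.comp_apply,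
      LinearEquiv.coe_coe, LinearEquiv.apply_symm_apply, LinearMap.lsum_apply, LinearMap.coe_sum,
      Finset.sum_apply, LinearMap.proj_apply, LinearMap.single_apply]
    rw [Finset.sum_eq_single i (fun j _ hj => by rw [Pi.single_eq_of_ne hj, map_zero]) (by simp),
      Pi.single_eq_same]

theorem hdim_exact_right {P A B D : ModuleCat.{u} R} [Module.Finite R P] [Module.Projective R P]
    [Module.Finite R B] {i : A →ₗ[R] B} {p : B →ₗ[R] D} (hi : Function.Injective i)
    (he : Function.Exact i p) (hp : Function.Surjective p) :
    hdim k P B = hdim k P A + hdim k P D := by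
  have := finiteDimensional_hom k (R := R) P B
  have h1 := LinearMap.finrank_range_add_finrank_ker (postcomp (k := k) p P)
  have h2 : LinearMap.range (postcomp (k := k) p P) = ⊤ :=
    LinearMap.range_eq_top.2 fun f => Module.projective_lifting_property p f hp
  have h3 : LinearMap.ker (postcomp (k := k) p P) = LinearMap.range (postcomp (k := k) i P) := by
    ext f
    constructor
    · intro hf
      have hf' : ∀ x, f x ∈ LinearMap.range i := fun x => (he _).1 (LinearMap.congr_fun hf x)
      let e := LinearEquiv.ofInjective i hi
      refine ⟨e.symm.toLinearMap ∘ₗ f.codRestrict _ hf', ?_⟩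
      ext x
      have h4 : e (e.symm ⟨f x, hf' x⟩) = ⟨f x, hf' x⟩ := e.apply_symm_apply _
      exact congrArg Subtype.val h4
    · rintro ⟨g, rfl⟩
      ext x
      exact he.apply_apply_eq_zero (g x)
  have h4 : Function.Injective (postcomp (k := k) i P) := fun f g h => by
    ext x
    exact hi (LinearMap.congr_fun h x)
  rw [h2, finrank_top, h3, LinearMap.finrank_range_of_inj h4] at h1
  rw [hdim, hdim, hdim, ← h1, add_comm]

theorem hdim_exact_left {A B D N : ModuleCat.{u} R} [Module.Finite R N] [Module.Finite R B]
    (hN : ExtZero D N) {i : A →ₗ[R] B} {p : B →ₗ[R] D} (hi : Function.Injective i)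
    (he : Function.Exact i p) (hp : Function.Surjective p) :
    hdim k B N = hdim k A N + hdim k D N := by
  have := finiteDimensional_hom k (R := R) B N
  have h1 := LinearMap.finrank_range_add_finrank_ker (precomp (k := k) i N)
  have h2 : LinearMap.range (precomp (k := k) i N) = ⊤ :=
    LinearMap.range_eq_top.2 fun f => hN.exists_extend hi he hp f
  have h3 : LinearMap.ker (precomp (k := k) i N) = LinearMap.range (precomp (k := k) p N) := by
    ext f
    constructor
    · intro hf
      refine exists_comp_eq_of_ker_le hp fun x hx => ?_
      obtain ⟨y, rfl⟩ := (he x).1 hx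
      exact LinearMap.congr_fun hf y
    · rintro ⟨g, rfl⟩
      ext x
      have h4 : g (p (i x)) = 0 := by rw [he.apply_apply_eq_zero, map_zero]
      exact h4
  have h4 : Function.Injective (precomp (k := k) p N) := fun f g h => by
    ext x
    obtain ⟨y, rfl⟩ := hp x
    exact LinearMap.congr_fun h y
  rw [h2, finrank_top, h3, LinearMap.finrank_range_of_inj h4] at h1
  rw [hdim, hdim, hdim, ← h1]

theorem hdim_eq_zero {M N : ModuleCat.{u} R} (h : ∀ f : M →ₗ[R] N, f = 0) : hdim k M N = 0 := by
  have : Subsingleton (M →ₗ[R] N) := ⟨fun f g => (h f).trans (h g).symm⟩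
  exact Module.finrank_zero_of_subsingleton

theorem hdim_ne_zero {M N : ModuleCat.{u} R} [Module.Finite R M] [Module.Finite R N]
    {f : M →ₗ[R] N} (h : f ≠ 0) : hdim k M N ≠ 0 := by
  have := finiteDimensional_hom k (R := R) M N
  have : Nontrivial (M →ₗ[R] N) := ⟨f, 0, h⟩
  exact Module.finrank_pos.ne'

end HomDimensions

/-! ### Indecomposable projective modules and classes in their Grothendieck group. -/

section ProjectiveSystems

variable {R : Type u} [Ring R]

/-- A complete irredundant family of indecomposable projective modules. -/
structure IsProjSystem {κ : Type*} (Q : κ → ModuleCat.{u} R) : Prop where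
  ind : ∀ x, IsInd (Q x)
  projective : ∀ x, Module.Projective R (Q x)
  eq_of_equiv : ∀ x y, Nonempty (Q x ≃ₗ[R] Q y) → x = y
  decomp : ∀ P : ModuleCat.{u} R, Module.Finite R P → Module.Projective R P →
    ∃ (ι : Type) (_ : Fintype ι) (c : ι → κ), Nonempty (P ≃ₗ[R] ∀ i, Q (c i))

theorem IsPointSystem.isProjSystem {k C : Type u} [Field k] [Ring C] [Algebra k C]
    [FiniteDimensional k C] {ι : Type*} [Fintype ι] {e : ι → C} (he : IsPointSystem e) :
    IsProjSystem fun x => projAt (e x) where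
  ind x := isInd_projAt (he.primitive x)
  projective x := by
    have hee : e x * e x = e x := (he.primitive x).1
    let r : Cᵐᵒᵖ →ₗ[Cᵐᵒᵖ] projRight (e x) :=
      { toFun c := ⟨e x * c.unop, Submodule.mem_span_singleton.2 ⟨c, rfl⟩⟩
        map_add' _ _ := Subtype.ext (mul_add _ _ _)
        map_smul' _ _ := Subtype.ext (mul_assoc _ _ _).symm }
    let i : projRight (e x) →ₗ[Cᵐᵒᵖ] Cᵐᵒᵖ :=
      { toFun c := op c.1
        map_add' _ _ := rfl
        map_smul' _ _ := rfl }
    exact Module.Projective.of_split i r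
      (LinearMap.ext fun c => Subtype.ext ((mem_projRight hee).1 c.2))
  eq_of_equiv := he.basic
  decomp P _ _ := by
    have := isArtinianRing_of_finiteDimensional k Cᵐᵒᵖ
    obtain ⟨m, s, hs⟩ := Module.Finite.exists_fin' Cᵐᵒᵖ P
    obtain ⟨σ, hσ⟩ := Module.projective_lifting_property s LinearMap.id hs
    let a : (Fin m → Cᵐᵒᵖ) →ₗ[Cᵐᵒᵖ] ∀ p : Fin m × ι, projAt (e p.2) :=
      { toFun v p := ⟨e p.2 * (v p.1).unop, Submodule.mem_span_singleton.2 ⟨v p.1, rfl⟩⟩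
        map_add' _ _ := funext fun _ => Subtype.ext (mul_add _ _ _)
        map_smul' _ _ := funext fun _ => Subtype.ext (mul_assoc _ _ _).symm }
    let b : (∀ p : Fin m × ι, projAt (e p.2)) →ₗ[Cᵐᵒᵖ] (Fin m → Cᵐᵒᵖ) :=
      { toFun w j := op (∑ x, (w (j, x)).1)
        map_add' v w := funext fun _ => congrArg op Finset.sum_add_distrib
        map_smul' c w := funext fun _ => congrArg op (Finset.sum_mul _ _ _).symm }
    have hba : b ∘ₗ a = LinearMap.id := LinearMap.ext fun v => funext fun j => by
      change op (∑ x, e x * (v j).unop) = v j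
      rw [← Finset.sum_mul, he.complete.complete, one_mul, op_unop]
    obtain ⟨κ, hκ, c, ⟨eq⟩⟩ := exists_linearEquiv_pi_of_retract (Q := P)
      (L := fun p : Fin m × ι => projAt (e p.2)) (fun p => isInd_projAt (he.primitive p.2))
      (a ∘ₗ σ) (s ∘ₗ b) (by
        rw [LinearMap.comp_assoc, ← LinearMap.comp_assoc σ a b, hba, LinearMap.id_comp, hσ])
    exact ⟨κ, hκ, fun i => (c i).2, ⟨eq⟩⟩

end ProjectiveSystems

section GVectors

variable {k : Type u} [Field k] {R : Type u} [Ring R] [Algebra k R] [FiniteDimensional k R]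
  {κ : Type*} [Fintype κ] [DecidableEq κ] {Q : κ → ModuleCat.{u} R}

/-- The number of times `x` occurs in the family `c`. -/
def mult {ι : Type} [Fintype ι] (c : ι → κ) (x : κ) : ℕ := Fintype.card {i // c i = x}

theorem sum_mult {ι : Type} [Fintype ι] (c : ι → κ) (f : κ → ℕ) :
    ∑ i, f (c i) = ∑ x, mult c x * f x := by
  rw [← Finset.sum_fiberwise Finset.univ c]
  refine Finset.sum_congr rfl fun x _ => ?_
  rw [Finset.sum_congr rfl fun i hi => by rw [(Finset.mem_filter.1 hi).2], Finset.sum_const,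
    smul_eq_mul, mult, Fintype.card_subtype]

/-- `g` is the class of `M` in the Grothendieck group of projective modules, computed from some
projective resolution of length one. -/
def IsGVector (Q : κ → ModuleCat.{u} R) (M : ModuleCat.{u} R) (g : κ → ℚ) : Prop :=
  ∃ (P₁ P₀ : ModuleCat.{u} R) (i : P₁ →ₗ[R] P₀) (p : P₀ →ₗ[R] M)
    (ι₁ ι₀ : Type) (_ : Fintype ι₁) (_ : Fintype ι₀) (c₁ : ι₁ → κ) (c₀ : ι₀ → κ),
    IsRes i p ∧ Nonempty (P₁ ≃ₗ[R] ∀ j, Q (c₁ j)) ∧ Nonempty (P₀ ≃ₗ[R] ∀ j, Q (c₀ j)) ∧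
      ∀ x, g x = mult c₀ x - mult c₁ x

theorem IsProjSystem.exists_isGVector (hQ : IsProjSystem Q) {P₁ P₀ M : ModuleCat.{u} R}
    {i : P₁ →ₗ[R] P₀} {p : P₀ →ₗ[R] M} (h : IsRes i p) : ∃ g, IsGVector Q M g := by
  obtain ⟨ι₁, h₁, c₁, e₁⟩ := hQ.decomp P₁ h.finite₁ h.projective₁
  obtain ⟨ι₀, h₀, c₀, e₀⟩ := hQ.decomp P₀ h.finite₀ h.projective₀
  exact ⟨_, P₁, P₀, i, p, ι₁, ι₀, h₁, h₀, c₁, c₀, h, e₁, e₀, fun _ => rfl⟩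

theorem IsProjSystem.hdim_left (hQ : IsProjSystem Q) {ι : Type} [Fintype ι] {c : ι → κ}
    {P N : ModuleCat.{u} R} [Module.Finite R N] (e : P ≃ₗ[R] ∀ j, Q (c j)) :
    hdim k P N = ∑ x, mult c x * hdim k (Q x) N := by
  have := fun x => (hQ.ind x).finite
  rw [hdim_pi_left (M := fun j => Q (c j)) e, sum_mult c fun x => hdim k (Q x) N]

theorem IsProjSystem.hdim_right (hQ : IsProjSystem Q) {ι : Type} [Fintype ι] {c : ι → κ}
    {P N : ModuleCat.{u} R} [Module.Finite R N] (e : P ≃ₗ[R] ∀ j, Q (c j)) :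
    hdim k N P = ∑ x, mult c x * hdim k N (Q x) := by
  have := fun x => (hQ.ind x).finite
  rw [hdim_pi_right (N := fun j => Q (c j)) e, sum_mult c fun x => hdim k N (Q x)]

/-- The dimension vector in terms of the `g`-vector. -/
theorem IsGVector.hdim_proj (hQ : IsProjSystem Q) {M : ModuleCat.{u} R} {g : κ → ℚ}
    (hg : IsGVector Q M g) (x : κ) :
    (hdim k (Q x) M : ℚ) = ∑ y, g y * hdim k (Q x) (Q y) := by
  obtain ⟨P₁, P₀, i, p, ι₁, ι₀, _, _, c₁, c₀, h, ⟨e₁⟩, ⟨e₀⟩, hg⟩ := hg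
  have := (hQ.ind x).finite
  have := hQ.projective x
  have := h.finite₀
  have h1 := hdim_exact_right (k := k) (P := Q x) h.injective h.exact h.surjective
  rw [hQ.hdim_right e₀, hQ.hdim_right e₁] at h1
  have h2 : (hdim k (Q x) M : ℚ) = (∑ y, mult c₀ y * hdim k (Q x) (Q y) : ℕ) -
      (∑ y, mult c₁ y * hdim k (Q x) (Q y) : ℕ) := by rw [h1]; push_cast; ring
  rw [h2]
  push_cast
  rw [← Finset.sum_sub_distrib]
  exact Finset.sum_congr rfl fun y _ => by rw [hg]; ring

theorem IsGVector.hdim_left (hQ : IsProjSystem Q) {M N : ModuleCat.{u} R} [Module.Finite R N]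
    {g : κ → ℚ} (hg : IsGVector Q M g) (hMN : ExtZero M N) :
    (hdim k M N : ℚ) = ∑ x, g x * hdim k (Q x) N := by
  obtain ⟨P₁, P₀, i, p, ι₁, ι₀, _, _, c₁, c₀, h, ⟨e₁⟩, ⟨e₀⟩, hg⟩ := hg
  have := h.finite₀
  have h1 := hdim_exact_left (k := k) hMN h.injective h.exact h.surjective
  rw [hQ.hdim_left e₀, hQ.hdim_left e₁] at h1
  have h2 : (hdim k M N : ℚ) = (∑ y, mult c₀ y * hdim k (Q y) N : ℕ) -
      (∑ y, mult c₁ y * hdim k (Q y) N : ℕ) := by rw [h1]; push_cast; ring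
  rw [h2]
  push_cast
  rw [← Finset.sum_sub_distrib]
  exact Finset.sum_congr rfl fun y _ => by rw [hg]; ring

/-- Without extensions, the dimension of Hom is the Euler form: the Cartan matrix of the projectives
evaluated at the two classes. This is the source of all matrix congruences below. -/
theorem IsGVector.hdim_eq (hQ : IsProjSystem Q) {M N : ModuleCat.{u} R} [Module.Finite R N]
    {g h : κ → ℚ} (hg : IsGVector Q M g) (hh : IsGVector Q N h) (hMN : ExtZero M N) :
    (hdim k M N : ℚ) = ∑ x, ∑ y, g x * hdim k (Q x) (Q y) * h y := by
  rw [hg.hdim_left hQ hMN]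
  refine Finset.sum_congr rfl fun x _ => ?_
  rw [hh.hdim_proj hQ, Finset.mul_sum]
  exact Finset.sum_congr rfl fun y _ => by ring

end GVectors

/-! ### Independence of the Euler form from the resolution. -/

section Resolutions

variable {R : Type u} [Ring R]

theorem projective_pi {ι : Type*} [Fintype ι] (P : ι → ModuleCat.{u} R)
    [h : ∀ i, Module.Projective R (P i)] : Module.Projective R (∀ i, P i) := by
  classical
  exact Module.Projective.of_equiv (DirectSum.linearEquivFunOnFintype R ι fun i => P i)

theorem IsRes.pi {ι : Type} [Fintype ι] {P₁ P₀ M : ι → ModuleCat.{u} R}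
    {i : ∀ j, P₁ j →ₗ[R] P₀ j} {p : ∀ j, P₀ j →ₗ[R] M j} (h : ∀ j, IsRes (i j) (p j)) :
    IsRes (P₁ := ModuleCat.of R (∀ j, P₁ j)) (P₀ := ModuleCat.of R (∀ j, P₀ j))
      (M := ModuleCat.of R (∀ j, M j)) (LinearMap.piMap i) (LinearMap.piMap p) where
  finite₁ := have := fun j => (h j).finite₁; Module.Finite.pi
  finite₀ := have := fun j => (h j).finite₀; Module.Finite.pi
  projective₁ := projective_pi P₁ (h := fun j => (h j).projective₁)
  projective₀ := projective_pi P₀ (h := fun j => (h j).projective₀)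
  injective v w hvw := funext fun j => (h j).injective (congrFun hvw j)
  exact v := by
    refine ⟨fun hv => ?_, ?_⟩
    · choose w hw using fun j => ((h j).exact (v j)).1 (congrFun hv j)
      exact ⟨w, funext hw⟩
    · rintro ⟨w, rfl⟩
      exact funext fun j => (h j).exact.apply_apply_eq_zero (w j)
  surjective v := by
    choose w hw using fun j => (h j).surjective (v j)
    exact ⟨w, funext hw⟩

theorem IsRes.congr {P₁ P₀ M N : ModuleCat.{u} R} {i : P₁ →ₗ[R] P₀} {p : P₀ →ₗ[R] M}
    (h : IsRes i p) (e : M ≃ₗ[R] N) : IsRes i (e.toLinearMap ∘ₗ p) where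
  finite₁ := h.finite₁
  finite₀ := h.finite₀
  projective₁ := h.projective₁
  projective₀ := h.projective₀
  injective := h.injective
  exact x := by rw [← h.exact x]; simp
  surjective := e.surjective.comp h.surjective

variable {k : Type u} [Field k] [Algebra k R] [FiniteDimensional k R]

/-- Schanuel's argument: the pullback `X` of `P` and `P₀` over `M` is an extension of the projective
`P` by `P₁`. It is described by its universal properties so that the two resolutions can exchange
roles. -/
theorem IsRes.hdim_pullback {P₁ P₀ P M X N : ModuleCat.{u} R} {i : P₁ →ₗ[R] P₀} {p : P₀ →ₗ[R] M}
    (h : IsRes i p) [Module.Finite R P] [Module.Projective R P] [Module.Finite R N]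
    [Module.Finite R X] {q : P →ₗ[R] M} {a : X →ₗ[R] P} {b : X →ₗ[R] P₀}
    (hab : ∀ x, q (a x) = p (b x)) (hX : ∀ u v, q u = p v → ∃ x, a x = u ∧ b x = v)
    (hinj : ∀ x, a x = 0 → b x = 0 → x = 0) :
    hdim k X N = hdim k P₁ N + hdim k P N := by
  have h1 (y : P₁) : ∃ x, a x = 0 ∧ b x = i y :=
    hX 0 (i y) (by rw [map_zero, h.exact.apply_apply_eq_zero])
  choose l hl using h1
  have huniq (x x' : X) (h1 : a x = a x') (h2 : b x = b x') : x = x' :=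
    sub_eq_zero.1 (hinj _ (by rw [map_sub, h1, sub_self]) (by rw [map_sub, h2, sub_self]))
  let l' : P₁ →ₗ[R] X :=
    { toFun := l
      map_add' y z := huniq _ _ (by simp [(hl _).1]) (by simp [(hl _).2])
      map_smul' c y := huniq _ _ (by simp [(hl _).1]) (by simp [(hl _).2]) }
  refine hdim_exact_left (N := N) ExtZero.of_projective (i := l') (p := a) ?_ ?_ ?_
  · intro y z hyz
    apply h.injective
    rw [← (hl y).2, ← (hl z).2]
    exact congrArg b hyz
  · intro x
    constructor
    · intro hx
      obtain ⟨y, hy⟩ := (h.exact (b x)).1 (by rw [← hab, hx, map_zero])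
      exact ⟨y, huniq _ _ ((hl y).1.trans hx.symm) ((hl y).2.trans hy)⟩
    · rintro ⟨y, rfl⟩
      exact (hl y).1
  · intro u
    obtain ⟨v, hv⟩ := h.surjective (q u)
    obtain ⟨x, hx, -⟩ := hX u v hv.symm
    exact ⟨x, hx⟩

/-- The Euler form does not depend on the resolution. -/
theorem IsRes.hdim_add_eq {P₁ P₀ P₁' P₀' M N : ModuleCat.{u} R} {i : P₁ →ₗ[R] P₀}
    {p : P₀ →ₗ[R] M} {i' : P₁' →ₗ[R] P₀'} {p' : P₀' →ₗ[R] M} (h : IsRes i p) (h' : IsRes i' p')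
    [Module.Finite R N] : hdim k P₁ N + hdim k P₀' N = hdim k P₁' N + hdim k P₀ N := by
  have := isArtinianRing_of_finiteDimensional k R
  have := h.finite₀
  have := h'.finite₀
  have := h.projective₀
  have := h'.projective₀
  let K : Submodule R (P₀ × P₀') :=
    LinearMap.ker (p ∘ₗ LinearMap.fst R P₀ P₀' - p' ∘ₗ LinearMap.snd R P₀ P₀')
  let X := ModuleCat.of R K
  let a : X →ₗ[R] P₀ := LinearMap.fst R P₀ P₀' ∘ₗ K.subtype
  let b : X →ₗ[R] P₀' := LinearMap.snd R P₀ P₀' ∘ₗ K.subtype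
  have hab (x : X) : p (a x) = p' (b x) := sub_eq_zero.1 x.2
  have hX (u : P₀) (v : P₀') (huv : p u = p' v) : ∃ x : X, a x = u ∧ b x = v :=
    ⟨⟨(u, v), sub_eq_zero.2 huv⟩, rfl, rfl⟩
  have hinj (x : X) (h1 : a x = 0) (h2 : b x = 0) : x = 0 := Subtype.ext (Prod.ext h1 h2)
  have : Module.Finite R X := inferInstanceAs (Module.Finite R K)
  rw [← h.hdim_pullback (a := b) (b := a) (q := p') (fun x => (hab x).symm)
    (fun u v huv => (hX v u huv.symm).imp fun x hx => ⟨hx.2, hx.1⟩) fun x h1 h2 => hinj x h2 h1,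
    h'.hdim_pullback (a := a) (b := b) (q := p) hab hX hinj]

variable {κ : Type*} [Fintype κ] [DecidableEq κ] {Q : κ → ModuleCat.{u} R}

/-- Simple modules separate the indecomposable projective modules. -/
theorem IsProjSystem.exists_simple (k : Type u) [Field k] [Algebra k R] [FiniteDimensional k R]
    (hQ : IsProjSystem Q) (x : κ) :
    ∃ N : ModuleCat.{u} R, Module.Finite R N ∧ hdim k (Q x) N ≠ 0 ∧
      ∀ y, y ≠ x → hdim k (Q y) N = 0 := by
  have := isArtinianRing_of_finiteDimensional k R
  have hx := hQ.ind x
  have := hx.finite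
  have := hx.nontrivial
  obtain ⟨K, hK, -⟩ :=
    (eq_top_or_exists_le_coatom (⊥ : Submodule R (Q x))).resolve_left bot_ne_top
  have hmk : K.mkQ ≠ 0 := fun h0 => hK.1 (by rw [← Submodule.ker_mkQ K, h0, LinearMap.ker_zero])
  refine ⟨ModuleCat.of R (Q x ⧸ K), inferInstanceAs (Module.Finite R (Q x ⧸ K)), ?_,
    fun y hy => hdim_eq_zero fun f => ?_⟩
  · have : Module.Finite R (ModuleCat.of R (Q x ⧸ K)) :=
      inferInstanceAs (Module.Finite R (Q x ⧸ K))
    exact hdim_ne_zero (N := ModuleCat.of R (Q x ⧸ K)) (f := K.mkQ) hmk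
  · by_contra hf
    have := isSimpleModule_iff_isCoatom.2 hK
    have hf' : Function.Surjective f := LinearMap.surjective_of_ne_zero (N := Q x ⧸ K) hf
    have := hQ.projective x
    have := hQ.projective y
    obtain ⟨f', h1⟩ := Module.projective_lifting_property K.mkQ f K.mkQ_surjective
    obtain ⟨g', h2⟩ := Module.projective_lifting_property f K.mkQ hf'
    have h3 : K.mkQ ∘ₗ (LinearMap.id - f' ∘ₗ g') = 0 := by
      rw [LinearMap.comp_sub, ← LinearMap.comp_assoc, h1, h2, LinearMap.comp_id, sub_self]
    have h4 : Function.Bijective (f' ∘ₗ g') := by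
      refine (hx.bijective_of_add (f := f' ∘ₗ g') (g := LinearMap.id - f' ∘ₗ g') ?_).resolve_right
        fun h4 => hmk ?_
      · rw [add_sub_cancel]
      · ext z
        obtain ⟨z, rfl⟩ := h4.2 z
        exact LinearMap.congr_fun h3 z
    have h5 := hx.bijective_of_comp (hQ.ind y) h4
    exact hy (hQ.eq_of_equiv _ _ ⟨LinearEquiv.ofBijective _ h5.2⟩)

theorem IsGVector.euler (hQ : IsProjSystem Q) {P₁ P₀ M N : ModuleCat.{u} R} [Module.Finite R N]
    {i : P₁ →ₗ[R] P₀} {p : P₀ →ₗ[R] M} (h : IsRes i p) {g : κ → ℚ} (hg : IsGVector Q M g) :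
    ∑ x, g x * hdim k (Q x) N = hdim k P₀ N - hdim k P₁ N := by
  obtain ⟨P₁', P₀', i', p', ι₁, ι₀, _, _, c₁, c₀, h', ⟨e₁⟩, ⟨e₀⟩, hg⟩ := hg
  have h1 := h.hdim_add_eq h' (k := k) (N := N)
  rw [hQ.hdim_left e₀, hQ.hdim_left e₁] at h1
  have h2 := congrArg (Nat.cast (R := ℚ)) h1
  push_cast at h2
  simp only [hg, sub_mul, Finset.sum_sub_distrib]
  linarith

/-- The simple top of `Q x` isolates the coordinate at `x`, so classes may be compared through their
Euler forms. -/
theorem IsProjSystem.ext_of_euler (k : Type u) [Field k] [Algebra k R] [FiniteDimensional k R]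
    (hQ : IsProjSystem Q) {g h : κ → ℚ}
    (H : ∀ N : ModuleCat.{u} R, Module.Finite R N →
      ∑ x, g x * hdim k (Q x) N = ∑ x, h x * hdim k (Q x) N) : g = h := by
  funext x
  obtain ⟨N, hN, h1, h2⟩ := hQ.exists_simple k x
  have h3 := H N hN
  have h4 (f : κ → ℚ) : ∑ y, f y * hdim k (Q y) N = f x * hdim k (Q x) N :=
    Finset.sum_eq_single x (fun y _ hy => by simp [h2 y hy]) (by simp)
  rw [h4, h4] at h3
  exact mul_right_cancel₀ (by exact_mod_cast h1) h3

end Resolutions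

/-! ### Bongartz's universal extension. -/

section UniversalExtensions

variable {k : Type u} [Field k] {R : Type u} [Ring R] [Algebra k R] [FiniteDimensional k R]

/-- Push out `m` copies of the resolution along a basis of all of `Hom(P₁, N)`. A map `P₁ → E` comes
from `N` modulo maps through `P₀`, as `U` has no self-extensions, and every map coming from `N`
factors through `P₀` by construction. The last two clauses resolve `E`. -/
theorem IsRes.exists_universal_extension {P₁ P₀ U N : ModuleCat.{u} R} {i : P₁ →ₗ[R] P₀}
    {p : P₀ →ₗ[R] U} (k : Type u) [Field k] [Algebra k R] [FiniteDimensional k R]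
    (h : IsRes i p) [Module.Finite R N] (hU : ExtZero U U) :
    ∃ (m : ℕ) (E : ModuleCat.{u} R) (a : N →ₗ[R] E) (π : E →ₗ[R] (Fin m → U))
      (j : (Fin m → P₀) →ₗ[R] E) (t : (Fin m → P₁) →ₗ[R] N),
      Function.Injective a ∧ Function.Exact a π ∧ Function.Surjective π ∧ ExtZero U E ∧
      Function.Surjective (j.coprod a) ∧
      Function.Exact ((LinearMap.piMap fun _ => i).prod (-t)) (j.coprod a) := by
  classical
  have := h.finite₁
  have := h.projective₀
  have := finiteDimensional_hom k (R := R) P₁ N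
  let b := Module.finBasis k (P₁ →ₗ[R] N)
  let m := Module.finrank k (P₁ →ₗ[R] N)
  have hm := IsRes.pi (ι := Fin m) fun _ => h
  let t : (Fin m → P₁) →ₗ[R] N := LinearMap.lsum R (fun _ => (P₁ : Type u)) ℕ b
  have ht (x : Fin m) (y : P₁) : t (Pi.single x y) = b x y := by
    simp only [t, LinearMap.lsum_apply, LinearMap.coe_sum, Finset.sum_apply,
      LinearMap.comp_apply, LinearMap.proj_apply]
    rw [Finset.sum_eq_single x (fun j _ hj => by rw [Pi.single_eq_of_ne hj, map_zero]) (by simp),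
      Pi.single_eq_same]
  obtain ⟨E, a, π, j, ha, haπ, hπ, hji, hπj, hs, he⟩ := exists_pushout hm.exact hm.surjective
    (t := t) (by rw [LinearMap.ker_eq_bot.2 hm.injective]; exact bot_le)
  refine ⟨m, E, a, π, j, t, ha, haπ, hπ, ExtZero.of_exact h.exact h.surjective fun s => ?_, hs, he⟩
  have hUm : ExtZero U (ModuleCat.of R (Fin m → U)) :=
    ExtZero.pi_right (N := fun _ => U) (LinearEquiv.refl _ _) fun _ => hU
  obtain ⟨s₀, hs₀⟩ := hUm.exists_extend h.injective h.exact h.surjective (π ∘ₗ s)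
  obtain ⟨s₁, hs₁⟩ := Module.projective_lifting_property π s₀ hπ
  have hmem (x : P₁) : (s - s₁ ∘ₗ i) x ∈ LinearMap.range a := by
    refine (haπ _).1 ?_
    have h1 : π (s₁ (i x)) = s₀ (i x) := LinearMap.congr_fun hs₁ _
    have h2 : s₀ (i x) = π (s x) := LinearMap.congr_fun hs₀ x
    simp [h1, h2]
  let ea := LinearEquiv.ofInjective a ha
  let r : P₁ →ₗ[R] N := ea.symm.toLinearMap ∘ₗ (s - s₁ ∘ₗ i).codRestrict _ hmem
  have hr (x : P₁) : a (r x) = s x - s₁ (i x) := by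
    have h1 : ea (r x) = _ := ea.apply_symm_apply _
    exact congrArg Subtype.val h1
  refine ⟨s₁ + j ∘ₗ LinearMap.pi fun x => b.repr r x • LinearMap.id, ?_⟩
  ext y
  have h3 : (∑ x, b.repr r x • b x) y = r y := by rw [b.sum_repr]
  have h4 : (LinearMap.pi fun x => b.repr r x • LinearMap.id : P₀ →ₗ[R] (Fin m → P₀)) (i y) =
      LinearMap.piMap (fun _ => i) (fun x => b.repr r x • y) := by
    funext x
    exact ((i.restrictScalars k).map_smul (b.repr r x) y).symm
  have h5 : t (fun x => b.repr r x • y) = r y := by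
    have h6 : (fun x => b.repr r x • y) = ∑ x, Pi.single x (b.repr r x • y) :=
      (Finset.univ_sum_single _).symm
    rw [h6, map_sum, ← h3, LinearMap.sum_apply]
    refine Finset.sum_congr rfl fun x _ => ?_
    rw [ht]
    exact ((b x).restrictScalars k).map_smul (b.repr r x) y
  have h7 := LinearMap.congr_fun hji (fun x => b.repr r x • y)
  simp only [LinearMap.comp_apply, LinearMap.add_apply] at h7 ⊢
  rw [h4]
  erw [h7]
  rw [h5, hr, add_sub_cancel]

end UniversalExtensions

section GVectors

variable {k : Type u} [Field k] {R : Type u} [Ring R] [Algebra k R] [FiniteDimensional k R]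
  {κ : Type*} [Fintype κ] [DecidableEq κ] {Q : κ → ModuleCat.{u} R}

theorem IsGVector.eq_sum_of_pi (k : Type u) [Field k] [Algebra k R] [FiniteDimensional k R]
    (hQ : IsProjSystem Q) {ι : Type} [Fintype ι] {M : ModuleCat.{u} R}
    {X : ι → ModuleCat.{u} R} (e : M ≃ₗ[R] ∀ i, X i) {G : κ → ℚ} (hG : IsGVector Q M G)
    {g : ι → κ → ℚ} (hg : ∀ i, IsGVector Q (X i) (g i)) : G = ∑ i, g i := by
  refine hQ.ext_of_euler k fun N hN => ?_
  have hg' := hg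
  choose P₁ P₀ i p _ _ _ _ _ _ h _ using hg
  have := fun i => (h i).finite₁
  have := fun i => (h i).finite₀
  rw [hG.euler hQ ((IsRes.pi h).congr (N := M) e.symm),
    hdim_pi_left (M := P₀) (LinearEquiv.refl _ _), hdim_pi_left (M := P₁) (LinearEquiv.refl _ _)]
  push_cast
  rw [← Finset.sum_sub_distrib]
  simp only [Finset.sum_apply, Finset.sum_mul]
  rw [Finset.sum_comm]
  refine Finset.sum_congr rfl fun j _ => ?_
  exact ((hg' j).euler hQ (h j)).symm

end GVectors

/-! ### Finiteness of a slice, and recognition of its members. -/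

section Slices

variable {k : Type u} [Field k] {C : Type u} [Ring C] [Algebra k C] [FiniteDimensional k C]
  {S : Set (ModuleCat.{u} Cᵐᵒᵖ)}

/-- `X` is a family of pairwise non-isomorphic members of `S`. -/
structure IsIrredundant (S : Set (ModuleCat.{u} Cᵐᵒᵖ)) {n : ℕ}
    (X : Fin n → ModuleCat.{u} Cᵐᵒᵖ) : Prop where
  mem : ∀ v, X v ∈ S
  eq_of_equiv : ∀ v w, Nonempty (X v ≃ₗ[Cᵐᵒᵖ] X w) → v = w

variable {n : ℕ} {X : Fin n → ModuleCat.{u} Cᵐᵒᵖ}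

/-- There is a nonzero map `X v → X w` and `v ≠ w`. -/
def HomLT (X : Fin n → ModuleCat.{u} Cᵐᵒᵖ) (v w : Fin n) : Prop :=
  v ≠ w ∧ ∃ f : X v →ₗ[Cᵐᵒᵖ] X w, f ≠ 0

theorem IsIrredundant.homLT_trans (hS : IsCompleteSlice k S) (hX : IsIrredundant S X)
    {u v w : Fin n} (huv : HomLT X u v) (hvw : HomLT X v w) : HomLT X u w := by
  obtain ⟨h1, f, hf⟩ := huv
  obtain ⟨-, g, hg⟩ := hvw
  refine ⟨?_, g ∘ₗ f, hS.comp_ne_zero (hX.mem u) (hX.mem v) (hX.mem w) hg hf⟩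
  rintro rfl
  exact h1 (hX.eq_of_equiv _ _
    ⟨LinearEquiv.ofBijective f (hS.bijective_of_cycle (hX.mem u) (hX.mem v) hf hg)⟩)

theorem IsIrredundant.wellFounded (hS : IsCompleteSlice k S) (hX : IsIrredundant S X) :
    WellFounded (HomLT X) := by
  have : IsTrans (Fin n) (HomLT X) := ⟨fun _ _ _ => hX.homLT_trans hS⟩
  have : Std.Irrefl (HomLT X) := ⟨fun _ h => h.1 rfl⟩
  exact Finite.wellFounded_of_trans_of_irrefl _

theorem IsIrredundant.wellFounded_swap (hS : IsCompleteSlice k S) (hX : IsIrredundant S X) :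
    WellFounded (Function.swap (HomLT X)) := by
  have : IsTrans (Fin n) (Function.swap (HomLT X)) := ⟨fun _ _ _ h h' => hX.homLT_trans hS h' h⟩
  have : Std.Irrefl (Function.swap (HomLT X)) := ⟨fun _ h => h.1 rfl⟩
  exact Finite.wellFounded_of_trans_of_irrefl _

/-- Nonzero maps order the slice modules, so the Gram matrix is triangular with nonzero diagonal. In
the row of a maximal index of the support of `f`, only the diagonal term survives. -/
theorem IsIrredundant.eq_zero_of_gram (hS : IsCompleteSlice k S) (hX : IsIrredundant S X)
    {f : Fin n → ℚ} (hf : ∀ v, ∑ w, hdim k (X v) (X w) * f w = 0) : f = 0 := by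
  by_contra h0
  obtain ⟨i, hi⟩ := Function.ne_iff.1 h0
  obtain ⟨v, hv, hmin⟩ := (hX.wellFounded_swap hS).has_min {v | f v ≠ 0} ⟨i, hi⟩
  have hI := hS.points.ind _ (hX.mem v)
  have := hI.finite
  have := hI.nontrivial
  have h1 := hf v
  rw [Finset.sum_eq_single v (fun w _ hw => ?_) (by simp)] at h1
  · have h2 : hdim k (X v) (X v) ≠ 0 := hdim_ne_zero (f := LinearMap.id) fun h => by
      obtain ⟨x, hx⟩ := exists_ne (0 : X v)
      exact hx (LinearMap.congr_fun h x)
    exact (mul_ne_zero (Nat.cast_ne_zero.2 h2) hv) h1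
  · by_contra h3
    obtain ⟨h4, h5⟩ := mul_ne_zero_iff.1 h3
    refine hmin w h5 ⟨hw.symm, ?_⟩
    by_contra! h6
    exact h4 (by rw [hdim_eq_zero h6, Nat.cast_zero])

variable {ι : Type*} [Fintype ι] {e : ι → C}

theorem IsCompleteSlice.exists_isGVector (hS : IsCompleteSlice k S) [DecidableEq ι]
    (he : IsPointSystem e) {M : ModuleCat.{u} Cᵐᵒᵖ} (hM : M ∈ S) :
    ∃ g, IsGVector (fun x => projAt (e x)) M g := by
  obtain ⟨P₁, P₀, i, p, h⟩ := hS.exists_isRes he hM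
  exact (he.isProjSystem (k := k)).exists_isGVector h

theorem IsIrredundant.eq_zero_of_gVector (hS : IsCompleteSlice k S) (hX : IsIrredundant S X)
    [DecidableEq ι] (he : IsPointSystem e) {g : Fin n → ι → ℚ}
    (hg : ∀ v, IsGVector (fun x => projAt (e x)) (X v) (g v)) {f : Fin n → ℚ}
    (hf : ∀ x, ∑ w, f w * g w x = 0) : f = 0 := by
  have hQ := he.isProjSystem (k := k)
  refine hX.eq_zero_of_gram hS fun v => ?_
  have := fun v => (hS.points.ind _ (hX.mem v)).finite
  have h1 (w : Fin n) : (hdim k (X v) (X w) : ℚ) = _ :=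
    (hg v).hdim_eq hQ (hg w) (hS.extZero (hX.mem v) (hX.mem w))
  simp only [h1, Finset.sum_mul]
  rw [Finset.sum_comm]
  refine Finset.sum_eq_zero fun x _ => ?_
  rw [Finset.sum_comm]
  refine Finset.sum_eq_zero fun y _ => ?_
  have h2 := congrArg (g v x * hdim k (projAt (e x)) (projAt (e y)) * ·) (hf y)
  simp only [mul_zero, Finset.mul_sum] at h2
  rw [← h2]
  exact Finset.sum_congr rfl fun w _ => by ring

theorem IsIrredundant.card_le (hS : IsCompleteSlice k S) (hX : IsIrredundant S X)
    (he : IsPointSystem e) : n ≤ Fintype.card ι := by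
  classical
  choose g hg using fun v => hS.exists_isGVector he (hX.mem v)
  have h1 : LinearIndependent ℚ g := by
    rw [Fintype.linearIndependent_iff]
    intro f hf
    exact congrFun (hX.eq_zero_of_gVector hS he hg fun x => by simpa using congrFun hf x)
  simpa using h1.fintype_card_le_finrank

/-- A complete slice has finitely many members up to isomorphism. -/
theorem IsCompleteSlice.exists_irredundant (hS : IsCompleteSlice k S) (he : IsPointSystem e) :
    ∃ (n : ℕ) (X : Fin n → ModuleCat.{u} Cᵐᵒᵖ), IsIrredundant S X ∧
      ∀ M ∈ S, ∃ v, Nonempty (M ≃ₗ[Cᵐᵒᵖ] X v) := by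
  classical
  let p (n : ℕ) : Prop := ∃ X : Fin n → ModuleCat.{u} Cᵐᵒᵖ, IsIrredundant S X
  have h0 : p 0 := ⟨Fin.elim0, fun v => v.elim0, fun v => v.elim0⟩
  have hmax := Nat.findGreatest_spec (P := p) (Nat.zero_le (Fintype.card ι)) h0
  obtain ⟨X, hX⟩ := hmax
  refine ⟨_, X, hX, fun M hM => ?_⟩
  by_contra! hne
  have h1 : IsIrredundant S (Fin.cons M X : Fin (_ + 1) → ModuleCat.{u} Cᵐᵒᵖ) := by
    refine ⟨fun v => ?_, fun v w => ?_⟩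
    · induction v using Fin.cases with
      | zero => exact hM
      | succ v => exact hX.mem v
    · induction v using Fin.cases with
      | zero =>
        induction w using Fin.cases with
        | zero => exact fun _ => rfl
        | succ w => exact fun ⟨f⟩ => ((hne w).false f).elim
      | succ v =>
        induction w using Fin.cases with
        | zero => exact fun ⟨f⟩ => ((hne v).false f.symm).elim
        | succ w => exact fun f => congrArg Fin.succ (hX.eq_of_equiv v w f)
  have h2 := Nat.le_findGreatest (P := p) (h1.card_le hS he) ⟨_, h1⟩
  omega

/-- Push the nonzero map back through sink maps. A component at a slice module is handled by
induction along `HomLT`; a component outside is a translate of a slice module `L`, and `Ext¹(L, W) =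
0` forbids a nonzero map to it. -/
theorem IsIrredundant.mem_of_extZero (hS : IsCompleteSlice k S) (hX : IsIrredundant S X)
    (hall : ∀ M ∈ S, ∃ v, Nonempty (M ≃ₗ[Cᵐᵒᵖ] X v)) (he : IsPointSystem e)
    {W : ModuleCat.{u} Cᵐᵒᵖ} (hW : IsInd W) (hext : ∀ v, ExtZero (X v) W) (v : Fin n)
    {φ : W →ₗ[Cᵐᵒᵖ] X v} (hφ : φ ≠ 0) : W ∈ S := by
  classical
  have := isArtinianRing_of_finiteDimensional k Cᵐᵒᵖ
  induction v using (hX.wellFounded hS).induction with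
  | _ v ih =>
  have hv := hX.mem v
  have hvI := hS.points.ind _ hv
  by_cases hb : Function.Bijective φ
  · exact hS.mem_of_linearEquiv hv (LinearEquiv.ofBijective φ hb).symm
  obtain ⟨E, p, hp, -⟩ := hS.exists_isSink he hv
  have hns : ¬ ∃ s : X v →ₗ[Cᵐᵒᵖ] W, φ ∘ₗ s = LinearMap.id := fun ⟨s, hs⟩ =>
    hb (hvI.bijective_of_comp hW (by rw [hs]; exact Function.bijective_id)).2
  obtain ⟨φ', rfl⟩ := hp.lift W φ hW.finite hns
  have := hp.finite
  obtain ⟨α, _, Y, hY, ⟨eY⟩⟩ := exists_linearEquiv_pi E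
  obtain ⟨i, hi⟩ := exists_component_ne_zero eY hφ
  have h1 : (LinearMap.proj i ∘ₗ eY.toLinearMap ∘ₗ φ' : W →ₗ[Cᵐᵒᵖ] Y i) ≠ 0 := fun h0 =>
    hi (by rw [h0, LinearMap.comp_zero])
  let q : Y i →ₗ[Cᵐᵒᵖ] X v := p ∘ₗ eY.symm.toLinearMap ∘ₗ
    LinearMap.single Cᵐᵒᵖ (fun i => (Y i : Type u)) i
  have h2 : q ≠ 0 := fun h0 => hi (by
    change q ∘ₗ _ = 0
    rw [h0, LinearMap.zero_comp])
  by_cases hYS : Y i ∈ S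
  · obtain ⟨w, ⟨ew⟩⟩ := hall _ hYS
    refine ih w ⟨?_, q ∘ₗ ew.symm.toLinearMap, fun h0 => h2 ?_⟩
      (φ := ew.toLinearMap ∘ₗ LinearMap.proj i ∘ₗ eY.toLinearMap ∘ₗ φ') fun h0 => h1 ?_
    -- If the summand were isomorphic to `X v`, its component would be a nonzero endomorphism of a
    -- brick, hence bijective, and would split the sink map.
    · rintro rfl
      have h3 : Function.Bijective (q ∘ₗ ew.symm.toLinearMap) := by
        refine hS.bijective_of_ne_zero hv fun h0 => h2 ?_
        ext x
        simpa using LinearMap.congr_fun h0 (ew x)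
      let ε := LinearEquiv.ofBijective _ h3
      refine hp.not_split ⟨(eY.symm.toLinearMap ∘ₗ
        LinearMap.single Cᵐᵒᵖ (fun i => (Y i : Type u)) i) ∘ₗ ew.symm.toLinearMap ∘ₗ
        ε.symm.toLinearMap, ?_⟩
      ext x
      exact ε.apply_symm_apply x
    · ext x
      simpa using LinearMap.congr_fun h0 (ew x)
    · ext x
      apply ew.injective
      rw [LinearMap.zero_apply, map_zero]
      exact LinearMap.congr_fun h0 x
  · obtain ⟨L, hL, hLp, hτ⟩ := hS.exists_tau_of_arrow hv (hp.arrow hvI eY i (hY i)) hYS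
    obtain ⟨w, ⟨ew⟩⟩ := hall L hL
    have h3 : ExtZero L W := (hext w).retract_left ew.toLinearMap ew.symm.toLinearMap
      (by ext x; simp)
    exact absurd (hS.hom_eq_zero_of_extZero he hL hLp hτ h3 _) h1

end Slices

/-! ### The classes of the slice modules span. -/

section Slices

variable {k : Type u} [Field k] {C : Type u} [Ring C] [Algebra k C] [FiniteDimensional k C]
  {S : Set (ModuleCat.{u} Cᵐᵒᵖ)} {n : ℕ} {X : Fin n → ModuleCat.{u} Cᵐᵒᵖ}
  {ι : Type*} [Fintype ι] {e : ι → C}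

theorem exists_projAt_ne_zero {c : C} (hc : c * c = c) {M : ModuleCat.{u} Cᵐᵒᵖ} {m : M}
    (hm : op c • m ≠ 0) : ∃ f : projAt c →ₗ[Cᵐᵒᵖ] M, f ≠ 0 := by
  let f : projRight c →ₗ[Cᵐᵒᵖ] M :=
    { toFun x := op x.1 • m
      map_add' x y := by simp [add_smul]
      map_smul' a x := by
        change op (x.1 * a.unop) • m = a • op x.1 • m
        rw [op_mul, mul_smul, op_unop] }
  refine ⟨f, fun h0 => hm ?_⟩
  exact LinearMap.congr_fun h0 ⟨c, (mem_projRight hc).2 hc⟩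

/-- With `U` the sum of the slice modules, the universal extension of copies of `U` by a projective
`P_y` has all its summands in the slice. Its class is that of `P_y` plus `m` times that of `U`, so a
functional killing the slice kills `P_y`. -/
theorem IsIrredundant.spanning (hS : IsCompleteSlice k S) (hX : IsIrredundant S X)
    (hall : ∀ M ∈ S, ∃ v, Nonempty (M ≃ₗ[Cᵐᵒᵖ] X v)) [DecidableEq ι] (he : IsPointSystem e)
    {g : Fin n → ι → ℚ} (hg : ∀ v, IsGVector (fun x => projAt (e x)) (X v) (g v)) {w : ι → ℚ}
    (hw : ∀ v, ∑ x, w x * g v x = 0) : w = 0 := by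
  have := isArtinianRing_of_finiteDimensional k Cᵐᵒᵖ
  have hQ := he.isProjSystem (k := k)
  funext y
  have hgS {M : ModuleCat.{u} Cᵐᵒᵖ} (hM : M ∈ S) {γ : ι → ℚ}
      (hγ : IsGVector (fun x => projAt (e x)) M γ) : ∑ x, w x * γ x = 0 := by
    obtain ⟨v, ⟨ev⟩⟩ := hall M hM
    have h1 : γ = g v := by
      have := hγ.eq_sum_of_pi k hQ (ι := Unit) (X := fun _ => X v)
        (ev.trans (LinearEquiv.funUnique Unit Cᵐᵒᵖ (X v)).symm) (fun _ => hg v)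
      simpa using this
    rw [h1, hw]
  choose P₁ P₀ i p hres using fun v => hS.exists_isRes he (hX.mem v)
  let U := ModuleCat.of Cᵐᵒᵖ (∀ v, X v)
  have hUres := IsRes.pi hres
  obtain ⟨gU, hgU⟩ := hQ.exists_isGVector hUres
  have hgU' := hgU.eq_sum_of_pi k hQ (X := X) (LinearEquiv.refl _ _) hg
  have hUU : ExtZero U U := ExtZero.pi_left (L := X) (LinearEquiv.refl _ _) fun v =>
    ExtZero.pi_right (N := X) (LinearEquiv.refl _ _) fun w => hS.extZero (hX.mem v) (hX.mem w)
  have hyI := hQ.ind y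
  have := hyI.finite
  have := hQ.projective y
  obtain ⟨m, E, a, π, j, t, ha, haπ, hπ, hUE, hs, hex⟩ :=
    hUres.exists_universal_extension k (N := projAt (e y)) hUU
  have hm := IsRes.pi (ι := Fin m) (P₁ := fun _ => ModuleCat.of Cᵐᵒᵖ (∀ v, P₁ v))
    (P₀ := fun _ => ModuleCat.of Cᵐᵒᵖ (∀ v, P₀ v)) (M := fun _ => U)
    (i := fun _ => LinearMap.piMap i) (p := fun _ => LinearMap.piMap p) fun _ => hUres
  have := hm.finite₀
  have := hm.projective₀
  have := hm.finite₁
  let F := ModuleCat.of Cᵐᵒᵖ ((Fin m → ModuleCat.of Cᵐᵒᵖ (∀ v, P₀ v)) × projAt (e y))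
  have hE : IsRes (P₁ := ModuleCat.of Cᵐᵒᵖ (Fin m → ModuleCat.of Cᵐᵒᵖ (∀ v, P₁ v))) (P₀ := F)
      ((LinearMap.piMap fun _ => LinearMap.piMap i).prod (-t)) (j.coprod a) :=
    { finite₁ := hm.finite₁
      finite₀ := Module.Finite.prod
      projective₁ := hm.projective₁
      projective₀ := inferInstanceAs (Module.Projective Cᵐᵒᵖ (_ × _))
      injective := fun x z hxz => hm.injective (congrArg Prod.fst hxz)
      exact := hex
      surjective := hs }
  have := hE.finite₀
  have : Module.Finite Cᵐᵒᵖ E := Module.Finite.of_surjective _ hs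
  obtain ⟨α, _, W, hW, ⟨eW⟩⟩ := exists_linearEquiv_pi E
  have hWS (l : α) : W l ∈ S := by
    classical
    let inc : W l →ₗ[Cᵐᵒᵖ] E := eW.symm.toLinearMap ∘ₗ
      LinearMap.single Cᵐᵒᵖ (fun i => (W i : Type u)) l
    let pr : E →ₗ[Cᵐᵒᵖ] W l := LinearMap.proj l ∘ₗ eW.toLinearMap
    have hpr : pr ∘ₗ inc = LinearMap.id := by
      ext x
      simp [inc, pr]
    have hext (v : Fin n) : ExtZero (X v) (W l) :=
      (hUE.retract_right inc pr hpr).retract_left (M' := X v)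
        (LinearMap.single Cᵐᵒᵖ (fun v => (X v : Type u)) v) (LinearMap.proj v)
        (by ext x; simp)
    have key (v : Fin n) (φ : W l →ₗ[Cᵐᵒᵖ] X v) (hφ : φ ≠ 0) : W l ∈ S :=
      hX.mem_of_extZero hS hall he (hW l) hext v hφ
    -- A summand on which `π` vanishes lies in `P_y`, as a retract, so it is isomorphic to `P_y`,
    -- and sincerity provides its nonzero map to the slice. Any other summand maps nontrivially to a
    -- slice module through `π`.
    by_cases h0 : π ∘ₗ inc = 0
    · have hmem (x : W l) : inc x ∈ LinearMap.range a := (haπ _).1 (LinearMap.congr_fun h0 x)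
      let ea := LinearEquiv.ofInjective a ha
      let r : W l →ₗ[Cᵐᵒᵖ] projAt (e y) := ea.symm.toLinearMap ∘ₗ inc.codRestrict _ hmem
      have hr (x : W l) : a (r x) = inc x := by
        have h1 : ea (r x) = _ := ea.apply_symm_apply _
        exact congrArg Subtype.val h1
      have hb : Function.Bijective r := ((hW l).bijective_of_comp hyI (f := r) (g := pr ∘ₗ a) (by
        have h1 : (pr ∘ₗ a) ∘ₗ r = LinearMap.id := by
          ext x
          simp only [LinearMap.comp_apply, hr]
          exact LinearMap.congr_fun hpr x
        rw [h1]
        exact Function.bijective_id)).1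
      have hy := he.primitive y
      obtain ⟨M, hM, z, hz⟩ := hS.sincere (e y) hy.1 hy.2.1
      obtain ⟨f, hf⟩ := exists_projAt_ne_zero hy.1 hz
      obtain ⟨v, ⟨ev⟩⟩ := hall M hM
      refine key v (ev.toLinearMap ∘ₗ f ∘ₗ r) fun h1 => hf ?_
      ext x
      obtain ⟨x, rfl⟩ := hb.2 x
      apply ev.injective
      rw [LinearMap.zero_apply, map_zero]
      exact LinearMap.congr_fun h1 x
    · have h1 : ∃ x s v, π (inc x) s v ≠ 0 := by
        by_contra! h1
        exact h0 (LinearMap.ext fun x => funext fun s => funext fun v => h1 x s v)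
      obtain ⟨x, s, v, h1⟩ := h1
      exact key v ((LinearMap.proj v : (∀ v, X v) →ₗ[Cᵐᵒᵖ] X v) ∘ₗ
        (LinearMap.proj s : (Fin m → U) →ₗ[Cᵐᵒᵖ] U) ∘ₗ π ∘ₗ inc)
        fun h2 => h1 (LinearMap.congr_fun h2 x)
  choose gW hgW using fun l => hS.exists_isGVector he (hWS l)
  obtain ⟨gE, hgE⟩ := hQ.exists_isGVector hE
  have hgE' := hgE.eq_sum_of_pi k hQ (X := W) eW hgW
  have hgE'' : gE = Pi.single y 1 + (m : ℚ) • gU := by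
    refine hQ.ext_of_euler k fun N hN => ?_
    have h1 : hdim k F N = hdim k (projAt (e y)) N +
        hdim k (ModuleCat.of Cᵐᵒᵖ (Fin m → ModuleCat.of Cᵐᵒᵖ (∀ v, P₀ v))) N :=
      hdim_exact_left (A := projAt (e y)) (B := F)
        (D := ModuleCat.of Cᵐᵒᵖ (Fin m → ModuleCat.of Cᵐᵒᵖ (∀ v, P₀ v)))
        ExtZero.of_projective (i := LinearMap.inr Cᵐᵒᵖ _ _) (p := LinearMap.fst Cᵐᵒᵖ _ _)
        LinearMap.inr_injective
        (fun x => ⟨fun h => ⟨x.2, Prod.ext h.symm rfl⟩, by rintro ⟨x, rfl⟩; rfl⟩)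
        LinearMap.fst_surjective
    have h2 := hUres.finite₀
    have h3 := hUres.finite₁
    rw [hgE.euler hQ hE, h1, hdim_pi_left (M := fun _ : Fin m => ModuleCat.of Cᵐᵒᵖ (∀ v, P₀ v))
      (M' := ModuleCat.of Cᵐᵒᵖ (Fin m → ModuleCat.of Cᵐᵒᵖ (∀ v, P₀ v)))
      (LinearEquiv.refl _ _), hdim_pi_left (M := fun _ : Fin m => ModuleCat.of Cᵐᵒᵖ (∀ v, P₁ v))
      (M' := ModuleCat.of Cᵐᵒᵖ (Fin m → ModuleCat.of Cᵐᵒᵖ (∀ v, P₁ v)))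
      (LinearEquiv.refl _ _)]
    have h4 := hgU.euler (k := k) (N := N) hQ hUres
    simp only [Pi.add_apply, Pi.smul_apply, add_mul, Finset.sum_add_distrib, smul_eq_mul,
      mul_assoc, ← Finset.mul_sum, h4]
    simp only [Finset.sum_const, Finset.card_univ, Fintype.card_fin, smul_eq_mul, Pi.single_apply,
      ite_mul, zero_mul, one_mul, Finset.sum_ite_eq', Finset.mem_univ, if_true]
    push_cast
    ring
  have h1 : ∑ x, w x * gE x = 0 := by
    simp only [hgE', Finset.sum_apply, Finset.mul_sum]
    rw [Finset.sum_comm]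
    exact Finset.sum_eq_zero fun l _ => hgS (hWS l) (hgW l)
  have h2 : ∑ x, w x * gU x = 0 := by
    simp only [hgU', Finset.sum_apply, Finset.mul_sum]
    rw [Finset.sum_comm]
    exact Finset.sum_eq_zero fun v _ => hw v
  simp only [hgE'', Pi.add_apply, Pi.smul_apply, mul_add, Finset.sum_add_distrib, smul_eq_mul,
    mul_left_comm _ (m : ℚ), ← Finset.mul_sum, h2] at h1
  simpa [Pi.single_apply] using h1

end Slices

/-! ### Translation from the derived `Ext` and projective dimension. -/

section Ext

variable {R : Type u} [Ring R]

theorem ExtZero.of_subsingleton_ext {M N : ModuleCat.{u} R}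
    (h : Subsingleton (Abelian.Ext M N 1)) : ExtZero M N := by
  intro X π hπ t
  have hS := LinearMap.shortExact_shortComplexKer (f := π) hπ
  obtain ⟨s, hs⟩ := Abelian.Ext.contravariant_sequence_exact₁ hS N
    (Abelian.Ext.mk₀ (ModuleCat.ofHom t)) (n₁ := 1) rfl (Subsingleton.elim (α := Abelian.Ext M N 1) _ _)
  obtain ⟨s, rfl⟩ := Abelian.Ext.homEquiv₀.symm.surjective s
  rw [Abelian.Ext.homEquiv₀_symm_apply, Abelian.Ext.mk₀_comp_mk₀] at hs
  have h1 := (Abelian.Ext.mk₀_bijective _ _).1 hs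
  exact ⟨s.hom, congrArg ModuleCat.Hom.hom h1⟩

/-- Modules of projective dimension at most one have resolutions of length one. -/
theorem exists_isRes_of_projDim [IsNoetherianRing R] {M : ModuleCat.{u} R} [Module.Finite R M]
    (h : HasProjectiveDimensionLE M 1) :
    ∃ (P₁ P₀ : ModuleCat.{u} R) (i : P₁ →ₗ[R] P₀) (p : P₀ →ₗ[R] M), IsRes i p := by
  obtain ⟨m, s, hs⟩ := Module.Finite.exists_fin' R M
  let P₀ := ModuleCat.of R (Fin m → R)
  let s' : P₀ →ₗ[R] M := s
  have hS := LinearMap.shortExact_shortComplexKer (f := s') hs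
  have hP : Projective P₀ := (projective_iff P₀).2 inferInstance
  have h1 : HasProjectiveDimensionLT (ModuleCat.of R (LinearMap.ker s')) 1 :=
    (hS.hasProjectiveDimensionLT_X₃_iff 0 hP).1 h
  have h2 : Projective (ModuleCat.of R (LinearMap.ker s')) := inferInstance
  exact ⟨ModuleCat.of R (LinearMap.ker s'), P₀, (LinearMap.ker s').subtype, s',
    inferInstanceAs (Module.Finite R (LinearMap.ker s')), inferInstanceAs (Module.Finite R (Fin m → R)),
    (projective_iff _).1 h2, inferInstanceAs (Module.Projective R (Fin m → R)),
    Subtype.val_injective, LinearMap.exact_subtype_ker_map s', hs⟩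

theorem hasProjectiveDimensionLE_of_retract {M N : ModuleCat.{u} R} {n : ℕ}
    (h : HasProjectiveDimensionLE M n) (i : N →ₗ[R] M) (r : M →ₗ[R] N)
    (hri : r ∘ₗ i = LinearMap.id) : HasProjectiveDimensionLE N n :=
  Retract.hasProjectiveDimensionLT (X := N) (Y := M) ⟨ModuleCat.ofHom i, ModuleCat.ofHom r, by
    rw [← ModuleCat.ofHom_comp, hri]; rfl⟩ (n + 1)

end Ext

/-! ### Sink maps as a recursion for dimensions of Hom. -/

section Sinks

variable {k : Type u} [Field k] {R : Type u} [Ring R] [Algebra k R] [FiniteDimensional k R]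

theorem isIrreducible_lift_split {E L M : ModuleCat.{u} R} {p : E →ₗ[R] M} (hp : IsSink p)
    (hL : IsInd L) {f : L ⟶ M} (hf : IsIrreducible f) :
    ∃ (f' : L →ₗ[R] E) (r : E →ₗ[R] L), p ∘ₗ f' = f.hom ∧ r ∘ₗ f' = LinearMap.id := by
  obtain ⟨-, h2, h3⟩ := hf
  have hns : ¬ ∃ s : M →ₗ[R] L, f.hom ∘ₗ s = LinearMap.id := fun h =>
    h2 ((isSplitEpi_iff f.hom).2 h)
  obtain ⟨f', hf'⟩ := hp.lift L f.hom hL.finite hns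
  rcases h3 E (ModuleCat.ofHom f') (ModuleCat.ofHom p) hp.finite
    (by rw [← ModuleCat.ofHom_comp, hf']; rfl) with h | h
  · obtain ⟨r, hr⟩ := (isSplitMono_iff f').1 h
    exact ⟨f', r, hf', hr⟩
  · exact absurd ((isSplitEpi_iff p).1 h) hp.not_split

variable {κ : Type*} [Fintype κ] [DecidableEq κ] {L : κ → ModuleCat.{u} R}

/-- The multiplicities in a sink map count dimensions of Hom-spaces. -/
theorem IsSink.hdim_eq (hL : ∀ x, IsInd (L x)) (heq : ∀ x y, Nonempty (L x ≃ₗ[R] L y) → x = y)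
    (hbrick : ∀ x, hdim k (L x) (L x) = 1) {y : κ} {E : ModuleCat.{u} R} {p : E →ₗ[R] L y}
    (hp : IsSink p) (hinj : ∀ x, ∀ g : L x →ₗ[R] E, p ∘ₗ g = 0 → g = 0)
    {α : Type} [Fintype α] {Y : α → ModuleCat.{u} R} (hY : ∀ j, IsInd (Y j))
    (e : E ≃ₗ[R] ∀ j, Y j)
    (hYL : ∀ j, (∃ z, Nonempty (Y j ≃ₗ[R] L z)) ∨ ∀ x, ∀ f : L x →ₗ[R] Y j, f = 0) :
    ∃ a : κ → ℕ, (∀ z, a z = Nat.card {j // Nonempty (Y j ≃ₗ[R] L z)}) ∧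
      (∀ z, Arrow (L z) (L y) → a z ≠ 0) ∧
      ∀ x, hdim k (L x) (L y) = (if x = y then 1 else 0) + ∑ z, hdim k (L x) (L z) * a z := by
  classical
  have := isArtinianRing_of_finiteDimensional k R
  have := hp.finite
  have hLf := fun x => (hL x).finite
  have := fun j => (hY j).finite
  refine ⟨fun z => Nat.card {j // Nonempty (Y j ≃ₗ[R] L z)}, fun _ => rfl, ?_, ?_⟩
  · rintro z ⟨-, -, f, hf⟩
    obtain ⟨f', r, -, hr⟩ := isIrreducible_lift_split hp (hL z) hf
    obtain ⟨j, ⟨ej⟩⟩ := (hL z).exists_linearEquiv_of_retract hY (e.toLinearMap ∘ₗ f')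
      (r ∘ₗ e.symm.toLinearMap) (by
        ext x
        simpa using LinearMap.congr_fun hr x)
    have : Nonempty {j // Nonempty (Y j ≃ₗ[R] L z)} := ⟨⟨j, ⟨ej.symm⟩⟩⟩
    exact Nat.card_pos.ne'
  · intro x
    have hE : hdim k (L x) E = ∑ z, hdim k (L x) (L z) * Nat.card {j // Nonempty (Y j ≃ₗ[R] L z)} := by
      rw [hdim_pi_right e]
      have h1 (j : α) : hdim k (L x) (Y j) =
          ∑ z, if Nonempty (Y j ≃ₗ[R] L z) then hdim k (L x) (L z) else 0 := by
        by_cases h : ∃ z, Nonempty (Y j ≃ₗ[R] L z)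
        · obtain ⟨z, ⟨ez⟩⟩ := h
          rw [Finset.sum_eq_single z (fun w _ hw => if_neg fun ⟨ew⟩ =>
            hw (heq _ _ ⟨ew.symm.trans ez⟩)) (by simp), if_pos ⟨ez⟩]
          exact hdim_congr (LinearEquiv.refl _ _) ez
        · rw [hdim_eq_zero ((hYL j).resolve_left h x), Finset.sum_eq_zero]
          exact fun z _ => if_neg fun hz => h ⟨z, hz⟩
      rw [Finset.sum_congr rfl fun j _ => h1 j, Finset.sum_comm]
      refine Finset.sum_congr rfl fun z _ => ?_
      rw [Finset.sum_ite, Finset.sum_const_zero, add_zero, Finset.sum_const, smul_eq_mul, mul_comm,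
        Nat.card_eq_fintype_card, Fintype.card_subtype]
    rw [← hE]
    -- For `x ≠ y`, composition with `p` identifies `Hom(L x, E)` with `Hom(L x, L y)`. For `x = y`,
    -- a nonzero map to `E` would split `p`, as all endomorphisms are scalars; the identity is then
    -- the extra 1.
    by_cases hxy : x = y
    · subst hxy
      rw [if_pos rfl, hbrick, hdim_eq_zero fun g => ?_]
      by_contra hg
      have h1 : p ∘ₗ g ≠ 0 := fun h => hg (hinj x g h)
      have h2 := hbrick x
      rw [hdim, finrank_eq_one_iff_of_nonzero' _ h1] at h2
      obtain ⟨c, hc⟩ := h2 LinearMap.id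
      refine hp.not_split ⟨c • g, ?_⟩
      rw [← hc]
      exact (postcomp (k := k) p (L x)).map_smul c g
    · rw [if_neg hxy, zero_add]
      have h1 : Function.Injective (postcomp (k := k) p (L x)) := fun f g h =>
        sub_eq_zero.1 (hinj x _ (by rw [LinearMap.comp_sub]; exact sub_eq_zero.2 h))
      have h2 : Function.Surjective (postcomp (k := k) p (L x)) := fun f => by
        refine hp.lift (L x) f (hLf x) fun ⟨s, hs⟩ => hxy (heq _ _ ⟨?_⟩)
        exact LinearEquiv.ofBijective f ((hL y).bijective_of_comp (hL x) (f := s) (g := f)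
          (by rw [hs]; exact Function.bijective_id)).2
      exact (LinearEquiv.ofBijective _ ⟨h1, h2⟩).finrank_eq.symm

end Sinks

/-! ### The trace of the Coxeter transformation. -/

section Matrices

variable {m n : Type*} [Fintype m] [DecidableEq m] [Fintype n] [DecidableEq n]

open Matrix in
/-- Congruent bilinear forms have Coxeter transformations of the same trace. -/
theorem trace_eq_of_congruent {c a : Matrix n n ℚ} {d b : Matrix m m ℚ} {P : Matrix m n ℚ}
    (hcard : Fintype.card m = Fintype.card n) (hc : c * (1 - a) = 1) (hd : d * (1 - b) = 1)
    (h : c = Pᵀ * d * P) : ((1 - a)ᵀ * c).trace = ((1 - b)ᵀ * d).trace := by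
  have h1 : ((1 - a) * Pᵀ * d) * P = 1 := by
    rw [Matrix.mul_assoc, Matrix.mul_assoc, ← Matrix.mul_assoc Pᵀ, ← h]
    exact mul_eq_one_comm.1 hc
  -- The one-sided inverse of `P` is two-sided because the sizes agree.
  have h2 : P * ((1 - a) * Pᵀ * d) = 1 :=
    (Matrix.mul_eq_one_comm_of_card_eq n m ℚ hcard.symm).1 h1
  have h3 : 1 - b = P * (1 - a) * Pᵀ := by
    have h4 : (P * (1 - a) * Pᵀ) * d = 1 := by rw [← h2]; simp only [Matrix.mul_assoc]
    exact (left_inv_eq_right_inv h4 hd).symm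
  rw [h3, Matrix.transpose_mul, Matrix.transpose_mul, Matrix.transpose_transpose, h,
    Matrix.mul_assoc P, Matrix.trace_mul_comm P]
  simp only [Matrix.mul_assoc]

end Matrices

section Slices

variable {k : Type u} [Field k] [IsAlgClosed k] {C : Type u} [Ring C] [Algebra k C]
  [FiniteDimensional k C] {S : Set (ModuleCat.{u} Cᵐᵒᵖ)} {n : ℕ}
  {X : Fin n → ModuleCat.{u} Cᵐᵒᵖ} {ι : Type*} [Fintype ι] {e : ι → C}

theorem IsCompleteSlice.hdim_self (hS : IsCompleteSlice k S) {M : ModuleCat.{u} Cᵐᵒᵖ}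
    (hM : M ∈ S) : hdim k M M = 1 := by
  have := (hS.points.ind _ hM).finite
  have := (hS.points.ind _ hM).nontrivial
  exact finrank_end_eq_one fun f hf => hS.bijective_of_ne_zero hM hf

/-- Summands of sink maps outside the slice are translates of slice modules and receive no maps from
the slice, so only slice modules count in the recursion. It amounts to `c * (1 - a) = 1`. -/
theorem IsIrredundant.exists_sinkMatrix (hS : IsCompleteSlice k S) (hX : IsIrredundant S X)
    (hall : ∀ M ∈ S, ∃ v, Nonempty (M ≃ₗ[Cᵐᵒᵖ] X v)) (he : IsPointSystem e) :
    ∃ a : Fin n → Fin n → ℕ, (∀ z y, Arrow (X z) (X y) → a z y ≠ 0) ∧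
      ∀ x y, hdim k (X x) (X y) =
        (if x = y then 1 else 0) + ∑ z, hdim k (X x) (X z) * a z y := by
  have := isArtinianRing_of_finiteDimensional k Cᵐᵒᵖ
  have key (y : Fin n) : ∃ a : Fin n → ℕ, (∀ z, Arrow (X z) (X y) → a z ≠ 0) ∧
      ∀ x, hdim k (X x) (X y) = (if x = y then 1 else 0) + ∑ z, hdim k (X x) (X z) * a z := by
    obtain ⟨E, p, hp, hinj⟩ := hS.exists_isSink he (hX.mem y)
    have := hp.finite
    have hyI := hS.points.ind _ (hX.mem y)
    obtain ⟨α, _, Y, hY, ⟨eY⟩⟩ := exists_linearEquiv_pi E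
    obtain ⟨a, -, h1, h2⟩ := hp.hdim_eq (k := k) (L := X)
      (fun x => hS.points.ind _ (hX.mem x)) hX.eq_of_equiv (fun x => hS.hdim_self (hX.mem x))
      (fun x g hg => hinj _ (hX.mem x) g hg) hY eY fun j => by
        by_cases hj : Y j ∈ S
        · exact Or.inl (hall _ hj)
        · obtain ⟨L, hL, hLp, hτ⟩ := hS.exists_tau_of_arrow (hX.mem y) (hp.arrow hyI eY j (hY j)) hj
          exact Or.inr fun x f => hS.hom_eq_zero_of_isTau (hX.mem x) hL hLp hτ f
    exact ⟨a, h1, h2⟩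
  choose a h1 h2 using key
  exact ⟨fun z y => a y z, fun z y => h1 y z, fun x y => h2 y x⟩

end Slices

/-! ### Elements of the Jacobson radical. -/

section Jacobson

variable {A : Type u} [Ring A]

theorem mem_jacobson_of_isNilpotent {x : A} (h : ∀ a, IsNilpotent (x * a)) :
    x ∈ Ring.jacobson A := by
  rw [← Ideal.jacobson_bot, Ideal.mem_jacobson_iff]
  intro y
  obtain ⟨n, hn⟩ := h y
  have h1 : IsNilpotent (y * x) := by
    refine ⟨n + 1, ?_⟩
    have h2 : ∀ n, (y * x) ^ (n + 1) = y * (x * y) ^ n * x := by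
      intro n
      induction n with
      | zero => simp
      | succ n ih => rw [pow_succ, ih, pow_succ]; simp only [mul_assoc]
    rw [h2, hn, mul_zero, zero_mul]
  obtain ⟨z, hz⟩ := h1.isUnit_one_add.exists_left_inv
  refine ⟨z, ?_⟩
  rw [Submodule.mem_bot, ← hz]
  noncomm_ring

theorem eq_zero_of_mem_jacobson {f : A} (hf : f * f = f) (h : f ∈ Ring.jacobson A) : f = 0 := by
  rw [← Ideal.jacobson_bot, Ideal.mem_jacobson_iff] at h
  obtain ⟨z, hz⟩ := h (-1)
  rw [Submodule.mem_bot] at hz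
  have h1 : z * (1 - f) = 1 := by
    rw [← sub_eq_zero, ← hz]
    noncomm_ring
  calc f = z * (1 - f) * f := by rw [h1, one_mul]
    _ = 0 := by rw [mul_assoc, sub_mul, one_mul, hf, sub_self, mul_zero]

theorem mul_mem_jacobson {x : A} (hx : x ∈ Ring.jacobson A) (a : A) : x * a ∈ Ring.jacobson A :=
  Ideal.mul_mem_right a _ hx

end Jacobson

/-! ### Projective modules over a hereditary algebra and arrows of its quiver. -/

section Hereditary

variable {k : Type u} [Field k] {A : Type u} [Ring A] [Algebra k A]

theorem IsHereditary.projective_submodule (hA : IsHereditary A) {c : A}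
    (K : Submodule Aᵐᵒᵖ (projAt c)) : Module.Projective Aᵐᵒᵖ K := by
  have := hA (K.map (projRight c).subtype)
  exact Module.Projective.of_equiv
    (Submodule.equivMapOfInjective (projRight c).subtype Subtype.val_injective K).symm

/-- The image is projective, so the kernel is a summand of an indecomposable module. -/
theorem IsHereditary.injective_of_ne_zero (hA : IsHereditary A) {c d : A}
    (hc : IsInd (projAt c)) {g : projAt c →ₗ[Aᵐᵒᵖ] projAt d} (hg : g ≠ 0) :
    Function.Injective g := by
  have := hA.projective_submodule (LinearMap.range g)
  obtain ⟨s, hs⟩ := Module.projective_lifting_property g.rangeRestrict LinearMap.id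
    g.surjective_rangeRestrict
  have hs' (x) : g.rangeRestrict (s x) = x := LinearMap.congr_fun hs x
  rcases ((isInd_iff _).1 hc).2.2 (s ∘ₗ g.rangeRestrict) (by
    ext x
    simp only [LinearMap.comp_apply, hs']) with h | h
  · refine absurd ?_ hg
    ext1 x
    have h1 := LinearMap.congr_fun h x
    have h2 := hs' (g.rangeRestrict x)
    rw [LinearMap.comp_apply, LinearMap.zero_apply] at h1
    rw [h1, map_zero] at h2
    exact (congrArg Subtype.val h2).symm
  · intro x y hxy
    have h1 : g.rangeRestrict x = g.rangeRestrict y := Subtype.ext hxy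
    have h2 := congrArg s h1
    exact (LinearMap.congr_fun h x).symm.trans (h2.trans (LinearMap.congr_fun h y))

variable [FiniteDimensional k A]

theorem IsHereditary.hdim_self [IsAlgClosed k] (hA : IsHereditary A) {c : A}
    (hc : IsInd (projAt c)) : hdim k (projAt c) (projAt c) = 1 := by
  have := isArtinianRing_of_finiteDimensional k Aᵐᵒᵖ
  have := hc.finite
  have := hc.nontrivial
  exact finrank_end_eq_one fun f hf =>
    IsArtinian.bijective_of_injective_endomorphism f (hA.injective_of_ne_zero hc hf)

/-- Left multiplication by a value of `p` is an endomorphism of `c A` factoring through `p`; it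
cannot be bijective, so it is nilpotent. This applies to all right multiples of the value as well.
-/
theorem IsSink.mem_jacobson (k : Type u) [Field k] [Algebra k A] [FiniteDimensional k A]
    {c : A} (hc : IsPrimitiveIdem c) {E : ModuleCat.{u} Aᵐᵒᵖ}
    {p : E →ₗ[Aᵐᵒᵖ] projAt c} (hp : IsSink p) (hinj : Function.Injective p) (w : E) :
    (p w).1 ∈ Ring.jacobson A := by
  have := isArtinianRing_of_finiteDimensional k Aᵐᵒᵖ
  have hcc : c * c = c := hc.1
  have hnil (w : E) : IsNilpotent (p w).1 := by
    let L : projRight c →ₗ[Aᵐᵒᵖ] projRight c :=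
      { toFun x := ⟨(p w).1 * x.1, (mem_projRight hcc).2 (by
          rw [← mul_assoc, (mem_projRight hcc).1 (p w).2])⟩
        map_add' _ _ := Subtype.ext (mul_add _ _ _)
        map_smul' _ _ := Subtype.ext (mul_assoc _ _ _).symm }
    have hL (x) : L x = p (op x.1 • w) := by rw [map_smul]; rfl
    have h1 : IsNilpotent (L : Module.End Aᵐᵒᵖ (projAt c)) := by
      refine ((isInd_projAt hc).bijective_or_isNilpotent L).resolve_left fun h => ?_
      have h2 : Function.Surjective p := fun y => by
        obtain ⟨x, rfl⟩ := h.2 y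
        exact ⟨_, (hL x).symm⟩
      let ε := LinearEquiv.ofBijective p ⟨hinj, h2⟩
      exact hp.not_split ⟨ε.symm.toLinearMap, LinearMap.ext fun x => ε.apply_symm_apply x⟩
    obtain ⟨n, hn⟩ := h1
    refine ⟨n + 1, ?_⟩
    have h3 : ∀ n, (((L : Module.End Aᵐᵒᵖ (projAt c)) ^ n) (p w)).1 = (p w).1 ^ (n + 1) := by
      intro n
      induction n with
      | zero => simp
      | succ n ih =>
        rw [pow_succ', Module.End.mul_apply, pow_succ', ← ih]
        rfl
    rw [← h3, hn]
    rfl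
  refine mem_jacobson_of_isNilpotent fun a => ?_
  have h1 : (p w).1 * a = (p (op a • w)).1 := by rw [map_smul]; rfl
  rw [h1]
  exact hnil _

/-- Left multiplication by `v` from `A` to `c A` lifts through `p` unless it splits, and a splitting
would put the nonzero idempotent `c` in the radical. -/
theorem IsSink.exists_eq_of_mem_jacobson {c : A} (hc : IsPrimitiveIdem c)
    {E : ModuleCat.{u} Aᵐᵒᵖ} {p : E →ₗ[Aᵐᵒᵖ] projAt c} (hp : IsSink p) {v : A} (hcv : c * v = v)
    (hv : v ∈ Ring.jacobson A) : ∃ w, (p w).1 = v := by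
  have hcc : c * c = c := hc.1
  let g : A →ₗ[Aᵐᵒᵖ] projRight c :=
    { toFun a := ⟨v * a, (mem_projRight hcc).2 (by rw [← mul_assoc, hcv])⟩
      map_add' _ _ := Subtype.ext (mul_add _ _ _)
      map_smul' _ _ := Subtype.ext (mul_assoc _ _ _).symm }
  obtain ⟨g', hg'⟩ := hp.lift (ModuleCat.of Aᵐᵒᵖ A) g
    (Module.Finite.equiv (MulOpposite.opLinearEquiv Aᵐᵒᵖ : A ≃ₗ[Aᵐᵒᵖ] Aᵐᵒᵖ).symm) fun ⟨s, hs⟩ => by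
    have h1 := congrArg Subtype.val (LinearMap.congr_fun hs ⟨c, (mem_projRight hcc).2 hcc⟩)
    have h2 : v * s ⟨c, (mem_projRight hcc).2 hcc⟩ = c := h1
    exact hc.2.1 (eq_zero_of_mem_jacobson hcc (h2 ▸ mul_mem_jacobson hv _))
  refine ⟨g' (1 : A), ?_⟩
  have h1 : (p (g' (1 : A))).1 = v * 1 := congrArg Subtype.val (LinearMap.congr_fun hg' (1 : A))
  rw [h1, mul_one]

/-- Each summand `d A` of the radical of `c A` contributes its generator, an element of `c (rad A)
d`. These elements are independent modulo the square of the radical. -/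
theorem IsSink.card_le_numArrows {c d : A} (hc : IsPrimitiveIdem c) (hd : IsPrimitiveIdem d)
    {E : ModuleCat.{u} Aᵐᵒᵖ} {p : E →ₗ[Aᵐᵒᵖ] projAt c} (hp : IsSink p)
    (hinj : Function.Injective p) {α : Type} [Fintype α] {Y : α → ModuleCat.{u} Aᵐᵒᵖ}
    (e : E ≃ₗ[Aᵐᵒᵖ] ∀ j, Y j) :
    Nat.card {j // Nonempty (Y j ≃ₗ[Aᵐᵒᵖ] projAt d)} ≤ numArrows k c d := by
  classical
  have hcc : c * c = c := hc.1
  have hdd : d * d = d := hd.1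
  let J := {j // Nonempty (Y j ≃ₗ[Aᵐᵒᵖ] projAt d)}
  let ε (j : J) : Y j ≃ₗ[Aᵐᵒᵖ] projAt d := j.2.some
  let d' : projAt d := ⟨d, (mem_projRight hdd).2 hdd⟩
  let w (j : J) : E := e.symm (Pi.single j.1 ((ε j).symm d'))
  have hdd' : op d • d' = d' := Subtype.ext hdd
  have hw (j : J) : op d • w j = w j := by
    rw [← map_smul, ← Pi.single_smul, ← map_smul, hdd']
  let U := (rad k A).map (corner k c d)
  let W := (rad k A * rad k A).map (corner k c d)
  have hcorner (a : A) : corner k c d a = c * a * d := rfl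
  have hu (j : J) : (p (w j)).1 ∈ U := by
    refine ⟨(p (w j)).1, hp.mem_jacobson k hc hinj (w j), ?_⟩
    rw [hcorner, (mem_projRight hcc).1 (p (w j)).2]
    have h1 : (p (w j)).1 * d = (p (op d • w j)).1 := by rw [map_smul]; rfl
    rw [h1, hw]
  -- Lifted to `E`, an element of the squared radical has all its coordinates at the chosen summands
  -- in the radical. A combination of the generators has coordinates `d t_j`, and these lie in the
  -- radical only if `t_j = 0`.
  have hsq : ∀ s ∈ rad k A * rad k A, ∃ x : E, (p x).1 = c * s ∧
      ∀ j : J, (ε j (e x j)).1 ∈ Ring.jacobson A := by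
    intro s hs
    induction hs using Submodule.mul_induction_on' with
    | mem_mul_mem a ha b hb =>
      obtain ⟨x, hx⟩ := hp.exists_eq_of_mem_jacobson hc (v := c * a) (by rw [← mul_assoc, hcc])
        (Ideal.mul_mem_left _ c ha)
      refine ⟨op b • x, ?_, fun j => ?_⟩
      · rw [map_smul, ← mul_assoc, ← hx]
        rfl
      · rw [map_smul, Pi.smul_apply, map_smul]
        exact Ideal.mul_mem_left _ (ε j (e x j)).1 hb
    | add a _ b _ ha hb =>
      obtain ⟨x, hx, hx'⟩ := ha
      obtain ⟨y, hy, hy'⟩ := hb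
      refine ⟨x + y, ?_, fun j => ?_⟩
      · rw [map_add, mul_add, ← hx, ← hy]
        rfl
      · rw [map_add, Pi.add_apply, map_add]
        exact Ideal.add_mem _ (hx' j) (hy' j)
  have hlin : LinearIndependent k fun j : J =>
      (W.submoduleOf U).mkQ ⟨(p (w j)).1, hu j⟩ := by
    rw [Fintype.linearIndependent_iff]
    intro t ht j
    simp only [← map_smul, ← map_sum] at ht
    rw [Submodule.mkQ_apply, Submodule.Quotient.mk_eq_zero] at ht
    obtain ⟨s, hs, hs'⟩ := ht
    obtain ⟨x, hx, hx'⟩ := hsq s hs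
    let y : E := ∑ j, op (algebraMap k A (t j)) • w j
    have hy : p y = p (op d • x) := by
      apply Subtype.ext
      have h1 : (p (op d • x)).1 = c * s * d := by
        rw [map_smul, ← hx]; rfl
      rw [h1, ← hcorner, hs']
      have h2 : (p y).1 = ∑ j, (p (w j)).1 * algebraMap k A (t j) := by
        simp only [y, map_sum, map_smul]
        exact map_sum (projRight c).subtype _ _
      rw [h2]
      simp only [Submodule.subtype_apply, AddSubmonoidClass.coe_finsetSum, Submodule.coe_smul]
      exact Finset.sum_congr rfl fun j _ => by rw [Algebra.smul_def, Algebra.commutes]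
    have h1 := hinj hy
    have h2 : (ε j (e y j)).1 = d * algebraMap k A (t j) := by
      have h3 : e y j = op (algebraMap k A (t j)) • (ε j).symm d' := by
        simp only [y, map_sum, map_smul, Finset.sum_apply, Pi.smul_apply, w,
          LinearEquiv.apply_symm_apply]
        rw [Finset.sum_eq_single j (fun i _ hi => by
          rw [Pi.single_eq_of_ne (fun h => hi (Subtype.ext h.symm)), smul_zero]) (by simp),
          Pi.single_eq_same]
      rw [h3, map_smul, LinearEquiv.apply_symm_apply]
      rfl
    by_contra h0
    have h4 : d * algebraMap k A (t j) ∈ Ring.jacobson A := by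
      rw [← h2, h1, map_smul, Pi.smul_apply, map_smul]
      exact mul_mem_jacobson (hx' j) d
    have h5 : d ∈ Ring.jacobson A := by
      have h6 := mul_mem_jacobson h4 (algebraMap k A (t j)⁻¹)
      rwa [mul_assoc, ← map_mul, mul_inv_cancel₀ h0, map_one, mul_one] at h6
    exact hd.2.1 (eq_zero_of_mem_jacobson hdd h5)
  have := hlin.fintype_card_le_finrank
  rwa [← Nat.card_eq_fintype_card] at this

end Hereditary

/-! ### Counting paths in a tree. -/

section Matrices

variable {n : Type*} [Fintype n] [DecidableEq n]

/-- If `c = (1 - a)⁻¹` counts paths, then the paths along a bridge are products. -/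
theorem entry_eq_one_of_bridge {c a : Matrix n n ℚ} (h : c * (1 - a) = 1) {I : Set n} {z y : n}
    (hz : z ∈ I) (hy : y ∉ I) (hzy : a z y = 1)
    (hI : ∀ l j, a l j ≠ 0 → (l ≠ z ∨ j ≠ y) → (l ∈ I ↔ j ∈ I)) (hcz : c z z = 1)
    (hcy : c y y = 1) : c z y = 1 := by
  classical
  have h' : (1 - a) * c = 1 := mul_eq_one_comm.1 h
  have hc (i j : n) : c i j = (1 : Matrix n n ℚ) i j + ∑ l, c i l * a l j := by
    rw [← h, ← Matrix.mul_apply, ← Matrix.add_apply, Matrix.mul_sub, Matrix.mul_one,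
      sub_add_cancel]
  have ha {l j : n} (hl : l ∉ I) (hj : j ∈ I) : a l j = 0 := by
    by_contra h0
    exact hl ((hI l j h0 (Or.inl fun hlz => hl (hlz ▸ hz))).2 hj)
  have hzero {i j : n} (hi : i ∉ I) (hj : j ∈ I) : c i j = 0 := by
    have h1 : (1 - a).BlockTriangular fun i => if i ∈ I then (0 : ℕ) else 1 := by
      intro i j hij
      by_cases hi : i ∈ I
      · simp [hi] at hij
      · by_cases hj : j ∈ I
        · have hne : i ≠ j := fun h0 => hi (h0 ▸ hj)
          simp [Matrix.one_apply_ne hne, ha hi hj]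
        · simp [hi, hj] at hij
    have : Invertible (1 - a) := ⟨c, h, h'⟩
    have h2 := Matrix.blockTriangular_inv_of_blockTriangular h1
    rw [Matrix.inv_eq_left_inv h] at h2
    exact h2 (by simp [hi, hj])
  -- Beyond the bridge, paths from `z` are paths from `y` preceded by the bridge. So rows `z` and
  -- `y` of `c` should agree off `I`; their difference there is annihilated by the invertible matrix
  -- `1 - a`.
  let w : n → ℚ := fun j => if j ∈ I then 0 else c z j - c y j
  have hw : Matrix.vecMul w (1 - a) = 0 := by
    funext j
    rw [Matrix.vecMul_sub, Matrix.vecMul_one, Pi.sub_apply, Pi.zero_apply, sub_eq_zero]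
    simp only [Matrix.vecMul, dotProduct]
    by_cases hj : j ∈ I
    · rw [Finset.sum_eq_zero fun l _ => ?_]
      · simp [w, hj]
      · by_cases hl : l ∈ I
        · simp [w, hl]
        · rw [ha hl hj, mul_zero]
    · have h1 (l : n) : w l * a l j =
          c z l * a l j - c y l * a l j - if l = z then (1 : Matrix n n ℚ) y j else 0 := by
        by_cases hl : l ∈ I
        · simp only [w, hl, if_true, zero_mul, hzero hy hl, sub_zero]
          by_cases hlj : l = z ∧ j = y
          · obtain ⟨rfl, rfl⟩ := hlj
            simp [hcz, hzy]
          · have h0 : a l j = 0 := by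
              by_contra h0
              exact hj ((hI l j h0 (not_and_or.1 hlj)).1 hl)
            rw [h0, mul_zero]
            by_cases hlz : l = z
            · rw [if_pos hlz, Matrix.one_apply_ne fun h1 => hlj ⟨hlz, h1.symm⟩, sub_zero]
            · rw [if_neg hlz, sub_zero]
        · have hlz : l ≠ z := fun h0 => hl (h0 ▸ hz)
          simp only [w, hl, if_false, hlz, sub_mul, sub_zero]
      have h2 : (1 : Matrix n n ℚ) z j = 0 := Matrix.one_apply_ne fun h0 => hj (h0 ▸ hz)
      simp only [h1, Finset.sum_sub_distrib, Finset.sum_ite_eq', Finset.mem_univ, if_true]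
      simp only [w, hj, if_false]
      rw [hc z j, hc y j, h2]
      ring
  have hw0 : w = 0 := by
    have h1 := congrArg (fun v => Matrix.vecMul v c) hw
    simpa only [Matrix.vecMul_vecMul, h', Matrix.vecMul_one, Matrix.zero_vecMul] using h1
  have h1 := congrFun hw0 y
  simp only [w, hy, if_false, Pi.zero_apply] at h1
  rw [hcy] at h1
  exact sub_eq_zero.1 h1

/-- The arrows of a tree contribute at most the number of edges. -/
theorem sum_le_of_tree {c : Matrix n n ℚ} {a N : n → n → ℕ}
    (h : c * (1 - Matrix.of fun i j => (a i j : ℚ)) = 1) (haN : ∀ i j, a i j ≤ N i j)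
    (hN : ∀ i j, N i j + N j i ≤ 1) (hG : (SimpleGraph.fromRel fun i j => N i j ≠ 0).IsTree)
    (hc : ∀ i, c i i = 1) : ∑ i, ∑ j, a i j * c i j + 1 ≤ Fintype.card n := by
  classical
  set G := SimpleGraph.fromRel fun i j => N i j ≠ 0
  have hadj {i j : n} (hij : a i j ≠ 0) : G.Adj i j ∧ a i j = 1 ∧ a j i = 0 := by
    have h1 := haN i j
    have h2 := haN j i
    have h3 := hN i j
    refine ⟨(SimpleGraph.fromRel_adj _ _ _).2 ⟨?_, Or.inl (by omega)⟩, by omega, by omega⟩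
    rintro rfl
    omega
  have hentry {z y : n} (hzy : a z y ≠ 0) : c z y = 1 := by
    obtain ⟨h1, h2, h3⟩ := hadj hzy
    -- In a tree every edge is a bridge. The set `I` is the side of `z` after removing it, and the
    -- other arrows do not cross between the two sides.
    have hb := (SimpleGraph.isAcyclic_iff_forall_adj_isBridge.1 hG.isAcyclic) h1
    rw [SimpleGraph.isBridge_iff] at hb
    refine entry_eq_one_of_bridge h (I := {l | (G.deleteEdges {s(z, y)}).Reachable z l})
      (SimpleGraph.Reachable.refl z) hb (by simp [h2]) (fun l j hlj hne => ?_) (hc z) (hc y)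
    have hlj' : a l j ≠ 0 := by simpa using hlj
    have h4 : (G.deleteEdges {s(z, y)}).Adj l j := by
      rw [SimpleGraph.deleteEdges_adj]
      refine ⟨(hadj hlj').1, fun h5 => ?_⟩
      rw [Set.mem_singleton_iff, Sym2.eq_iff] at h5
      rcases h5 with ⟨rfl, rfl⟩ | ⟨rfl, rfl⟩
      · simp at hne
      · exact hlj' h3
    exact ⟨fun h5 => h5.trans h4.reachable, fun h5 => h5.trans h4.symm.reachable⟩
  let F : Finset (n × n) := Finset.univ.filter fun p => a p.1 p.2 ≠ 0
  have hF : ∑ i, ∑ j, (a i j : ℚ) * c i j = F.card := by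
    rw [← Fintype.sum_prod_type' fun i j => (a i j : ℚ) * c i j, Finset.card_filter, Nat.cast_sum]
    refine Finset.sum_congr rfl fun p _ => ?_
    by_cases hp : a p.1 p.2 ≠ 0
    · rw [if_pos hp, hentry hp, (hadj hp).2.1]
      simp
    · rw [if_neg hp, not_not.1 hp]
      simp
  have hcard : F.card ≤ G.edgeFinset.card := by
    refine Finset.card_le_card_of_injOn (fun p => s(p.1, p.2)) (fun p hp => ?_) ?_
    · exact SimpleGraph.mem_edgeFinset.2 (hadj (Finset.mem_filter.1 hp).2).1
    · rintro ⟨i, j⟩ hp ⟨i', j'⟩ hp' heq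
      rcases Sym2.eq_iff.1 heq with ⟨h1, h2⟩ | ⟨h1, h2⟩
      · exact Prod.ext h1 h2
      · simp only at h1 h2
        subst h1 h2
        exact absurd (hadj (Finset.mem_filter.1 hp).2).2.2 (Finset.mem_filter.1 hp').2
  rw [hF, ← hG.card_edgeFinset]
  exact_mod_cast Nat.succ_le_succ hcard

end Matrices

/-! ### The sink matrix of a hereditary algebra. -/

section Hereditary

variable {k : Type u} [Field k] [IsAlgClosed k] {A : Type u} [Ring A] [Algebra k A]
  [FiniteDimensional k A] {κ : Type*} [Fintype κ] [DecidableEq κ] {f : κ → A}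

/-- The source of the sink map of an indecomposable projective is again projective, so it decomposes
into the projectives at the points, with multiplicities bounded by numbers of arrows. -/
theorem IsHereditary.exists_sinkMatrix (hA : IsHereditary A) (hf : IsPointSystem f) :
    ∃ a : κ → κ → ℕ, (∀ z y, a z y ≤ numArrows k (f y) (f z)) ∧
      ∀ x y, hdim k (projAt (f x)) (projAt (f y)) =
        (if x = y then 1 else 0) + ∑ z, hdim k (projAt (f x)) (projAt (f z)) * a z y := by
  have := isArtinianRing_of_finiteDimensional k Aᵐᵒᵖ
  have hQ := hf.isProjSystem (k := k)
  have key (y : κ) : ∃ a : κ → ℕ, (∀ z, a z ≤ numArrows k (f y) (f z)) ∧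
      ∀ x, hdim k (projAt (f x)) (projAt (f y)) =
        (if x = y then 1 else 0) + ∑ z, hdim k (projAt (f x)) (projAt (f z)) * a z := by
    have := hQ.projective y
    obtain ⟨E, p, hp, hinj⟩ := exists_isSink_of_projective (hQ.ind y)
    have := hA.projective_submodule (LinearMap.range p)
    have : Module.Projective Aᵐᵒᵖ E :=
      Module.Projective.of_equiv (LinearEquiv.ofInjective p hinj).symm
    obtain ⟨α, _, c, ⟨e⟩⟩ := hQ.decomp E hp.finite this
    obtain ⟨a, ha, -, h⟩ := hp.hdim_eq (k := k) (L := fun x => projAt (f x)) hQ.ind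
      hQ.eq_of_equiv (fun x => hA.hdim_self (hQ.ind x))
      (fun x g hg => LinearMap.ext fun v => hinj (by
        rw [LinearMap.zero_apply, map_zero]
        exact LinearMap.congr_fun hg v))
      (fun j => hQ.ind (c j)) e fun j => Or.inl ⟨c j, ⟨LinearEquiv.refl _ _⟩⟩
    exact ⟨a, fun z => (ha z).trans_le
      (hp.card_le_numArrows (hf.primitive y) (hf.primitive z) hinj e), h⟩
  choose a h1 h2 using key
  exact ⟨fun z y => a y z, fun z y => h1 y z, fun x y => h2 y x⟩

end Hereditary

/-! ### Summands of the tilting module and idempotents of its endomorphism algebra. -/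

section Summands

variable {R : Type u} [Ring R]

/-- The image of an idempotent endomorphism. -/
abbrev imageOf {T : ModuleCat.{u} R} (φ : T →ₗ[R] T) : ModuleCat.{u} R :=
  ModuleCat.of R (LinearMap.range φ)

variable {k : Type u} [Field k] {C : Type u} [Ring C] [Algebra k C] [FiniteDimensional k C]
  [Algebra k R] {T : ModuleCat.{u} R} (φ : C ≃ₐ[k] Module.End R T)

theorem imageOf_apply {c : C} (hc : c * c = c) (t : imageOf (φ c)) : φ c t.1 = t.1 := by
  obtain ⟨_, t, rfl⟩ := t
  rw [← Module.End.mul_apply, ← map_mul, hc]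

/-- The inclusion of the image of an idempotent. -/
abbrev imageIncl (c : C) : imageOf (φ c) →ₗ[R] T := (LinearMap.range (φ c)).subtype

/-- The projection to the image of an idempotent. -/
abbrev imageProj (c : C) : T →ₗ[R] imageOf (φ c) := (φ c).rangeRestrict

theorem imageProj_comp_imageIncl {c : C} (hc : c * c = c) :
    imageProj φ c ∘ₗ imageIncl φ c = LinearMap.id :=
  LinearMap.ext fun t => Subtype.ext (imageOf_apply φ hc t)

/-- Endomorphisms of the image extend to `T` through inclusion and projection, hence are elements of
`c C c`. There a primitive idempotent leaves only the trivial idempotents. -/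
theorem isInd_imageOf [Module.Finite R T] {c : C} (hc : IsPrimitiveIdem c) :
    IsInd (imageOf (φ c)) := by
  have hcc : c * c = c := hc.1
  refine (isInd_iff _).2 ⟨inferInstanceAs (Module.Finite R (LinearMap.range (φ c))), ?_, ?_⟩
  · have h1 : φ c ≠ 0 := fun h => hc.2.1 ((map_eq_zero_iff φ φ.injective).1 h)
    obtain ⟨t, ht⟩ : ∃ t, φ c t ≠ 0 := by
      by_contra! h
      exact h1 (LinearMap.ext h)
    exact ⟨⟨φ c t, t, rfl⟩, 0, fun h => ht (congrArg Subtype.val h)⟩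
  · intro ε hε
    obtain ⟨d, hd⟩ := φ.surjective (imageIncl φ c ∘ₗ ε ∘ₗ imageProj φ c)
    have hd' (t : T) : φ d t = (ε (imageProj φ c t)).1 := LinearMap.congr_fun hd t
    have hε' (t) : ε (ε t) = ε t := LinearMap.congr_fun hε t
    have hpi (t : imageOf (φ c)) : imageProj φ c t.1 = t :=
      LinearMap.congr_fun (imageProj_comp_imageIncl φ hcc) t
    have h1 : d * d = d := by
      apply φ.injective
      ext t
      rw [map_mul, Module.End.mul_apply, hd', hd', hpi, hε']
    have h2 : c * d = d := by
      apply φ.injective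
      ext t
      rw [map_mul, Module.End.mul_apply, hd', imageOf_apply φ hcc]
    have h3 : d * c = d := by
      apply φ.injective
      ext t
      rw [map_mul, Module.End.mul_apply, hd', hd']
      exact congrArg (fun t => (ε t).1) (hpi (imageProj φ c t))
    rcases hc.eq_zero_or_eq h1 h2 h3 with h | h
    · left
      ext t
      rw [← hpi t, ← hd', h, map_zero]
      rfl
    · right
      ext t
      conv_lhs => rw [← hpi t, ← hd', h]
      exact imageOf_apply φ hcc t

/-- Both Hom-spaces are `d C c`: on one side by evaluating at the generator of `c C`, on the other
by letting elements of `C` act on `T`. -/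
theorem hdim_eq_of_equiv_range {c d : C} (hc : c * c = c) (hd : d * d = d)
    {P P' : ModuleCat.{u} Cᵐᵒᵖ} {Q Q' : ModuleCat.{u} R} (eP : P ≃ₗ[Cᵐᵒᵖ] projRight c)
    (eP' : P' ≃ₗ[Cᵐᵒᵖ] projRight d) (eQ : Q ≃ₗ[R] LinearMap.range (φ c))
    (eQ' : Q' ≃ₗ[R] LinearMap.range (φ d)) : hdim k P P' = hdim k Q Q' := by
  let c' : projRight c := ⟨c, (mem_projRight hc).2 hc⟩
  let ev (F : P →ₗ[Cᵐᵒᵖ] P') : C := (eP' (F (eP.symm c'))).1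
  have hval (F : P →ₗ[Cᵐᵒᵖ] P') (x : P) : (eP' (F x)).1 = ev F * (eP x).1 := by
    have h1 : x = op (eP x).1 • eP.symm c' := by
      apply eP.injective
      rw [map_smul, LinearEquiv.apply_symm_apply]
      exact Subtype.ext ((mem_projRight hc).1 (eP x).2).symm
    conv_lhs => rw [h1, map_smul, map_smul]
    rfl
  let pr : T →ₗ[R] Q' := eQ'.symm.toLinearMap ∘ₗ (φ d).rangeRestrict
  let inc : Q →ₗ[R] T := (LinearMap.range (φ c)).subtype ∘ₗ eQ.toLinearMap
  have hpr (t : T) : (eQ' (pr t)).1 = φ d t := by simp [pr]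
  have hsurj (t : T) : ∃ q, inc q = φ c t := ⟨eQ.symm ⟨φ c t, t, rfl⟩, by simp [inc]⟩
  let Φ : (P →ₗ[Cᵐᵒᵖ] P') →ₗ[k] (Q →ₗ[R] Q') :=
    { toFun F := pr ∘ₗ φ (ev F) ∘ₗ inc
      map_add' F G := by
        have h1 : ev (F + G) = ev F + ev G := by
          simp only [ev, LinearMap.add_apply, map_add]
          rfl
        rw [h1, map_add, LinearMap.add_comp, LinearMap.comp_add]
      map_smul' a F := by
        have h1 : ev (a • F) = a • ev F := by
          have h2 : ev (a • F) = ev F * algebraMap k C a :=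
            congrArg Subtype.val (map_smul eP' (algebraMap k Cᵐᵒᵖ a) (F (eP.symm c')))
          rw [h2, Algebra.smul_def, Algebra.commutes]
        rw [h1, map_smul, RingHom.id_apply]
        ext1 t
        exact (pr.restrictScalars k).map_smul a _ }
  refine (LinearEquiv.ofBijective Φ ⟨fun F G h => ?_, fun g => ?_⟩).finrank_eq
  · have h1 (F : P →ₗ[Cᵐᵒᵖ] P') (t : T) (q : Q) (hq : inc q = φ c t) :
        φ (ev F) t = (eQ' (Φ F q)).1 := by
      have h2 : ev F = d * ev F * c := by
        have h3 : d * ev F = ev F := (mem_projRight hd).1 (eP' _).2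
        have h4 := hval F (eP.symm c')
        rw [LinearEquiv.apply_symm_apply] at h4
        rw [h3]
        exact h4
      have h3 : (eQ' (Φ F q)).1 = φ d (φ (ev F) (inc q)) := hpr _
      rw [h3, hq]
      conv_lhs => rw [h2, map_mul, map_mul]
      rfl
    have h2 : ev F = ev G := φ.injective (LinearMap.ext fun t => by
      obtain ⟨q, hq⟩ := hsurj t
      rw [h1 F t q hq, h1 G t q hq, h])
    ext x
    exact eP'.injective (Subtype.ext (by rw [hval F, hval G, h2]))
  · obtain ⟨b, hb⟩ := φ.surjective ((LinearMap.range (φ d)).subtype ∘ₗ eQ'.toLinearMap ∘ₗ g ∘ₗ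
      eQ.symm.toLinearMap ∘ₗ (φ c).rangeRestrict)
    have hb' (t : T) : φ b t = (eQ' (g (eQ.symm ((φ c).rangeRestrict t)))).1 :=
      LinearMap.congr_fun hb t
    have hdb : d * b = b := by
      apply φ.injective
      ext t
      rw [map_mul, Module.End.mul_apply, hb']
      exact imageOf_apply φ hd _
    let F : projRight c →ₗ[Cᵐᵒᵖ] projRight d :=
      { toFun x := ⟨b * x.1, (mem_projRight hd).2 (by rw [← mul_assoc, hdb])⟩
        map_add' _ _ := Subtype.ext (mul_add _ _ _)
        map_smul' _ _ := Subtype.ext (mul_assoc _ _ _).symm }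
    refine ⟨eP'.symm.toLinearMap ∘ₗ F ∘ₗ eP.toLinearMap, ?_⟩
    have hev : ev (eP'.symm.toLinearMap ∘ₗ F ∘ₗ eP.toLinearMap) = b * c := by
      simp only [ev, LinearMap.comp_apply, LinearEquiv.coe_coe, LinearEquiv.apply_symm_apply]
      rfl
    ext t
    apply eQ'.injective
    apply Subtype.ext
    have h1 : φ (b * c) (inc t) = (eQ' (g t)).1 := by
      have h2 : (φ c).rangeRestrict (eQ t).1 = eQ t :=
        Subtype.ext (imageOf_apply φ hc (eQ t))
      have h3 : φ c (inc t) = inc t := imageOf_apply φ hc (eQ t)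
      rw [map_mul, Module.End.mul_apply, h3, hb']
      change (eQ' (g (eQ.symm ((φ c).rangeRestrict (eQ t).1)))).1 = _
      rw [h2, LinearEquiv.symm_apply_apply]
    change (eQ' (pr (φ (ev _) (inc t)))).1 = _
    rw [hev, hpr, h1]
    exact imageOf_apply φ hd (eQ' (g t))

theorem hdim_imageOf {c d : C} (hc : c * c = c) (hd : d * d = d) :
    hdim k (projAt c) (projAt d) = hdim k (imageOf (φ c)) (imageOf (φ d)) :=
  hdim_eq_of_equiv_range φ hc hd (LinearEquiv.refl _ _) (LinearEquiv.refl _ _)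
    (LinearEquiv.refl _ _) (LinearEquiv.refl _ _)

/-- A module is the direct sum of the images of a complete family of orthogonal idempotents. -/
theorem exists_linearEquiv_imageOf {ι : Type*} [Fintype ι] {e : ι → C}
    (he : CompleteOrthogonalIdempotents e) :
    Nonempty (T ≃ₗ[R] ∀ x, imageOf (φ (e x))) := by
  classical
  refine ⟨LinearEquiv.ofBijective (LinearMap.pi fun x => imageProj φ (e x)) ⟨?_, ?_⟩⟩
  · rw [injective_iff_map_eq_zero]
    intro t ht
    have h1 (x : ι) : φ (e x) t = 0 := congrArg Subtype.val (congrFun ht x)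
    have h2 : φ (∑ x, e x) t = 0 := by
      rw [map_sum, LinearMap.sum_apply]
      exact Finset.sum_eq_zero fun x _ => h1 x
    rwa [he.complete, map_one] at h2
  · intro v
    refine ⟨∑ x, (v x).1, ?_⟩
    funext y
    apply Subtype.ext
    change φ (e y) (∑ x, (v x).1) = (v y).1
    rw [map_sum, Finset.sum_eq_single y (fun x _ hxy => ?_) (by simp),
      imageOf_apply φ (he.idem y)]
    rw [← imageOf_apply φ (he.idem x), ← Module.End.mul_apply, ← map_mul, he.ortho hxy.symm,
      map_zero, LinearMap.zero_apply]

theorem exists_linearEquiv_of_inAdd [IsArtinianRing R] {κ : Type*} [Fintype κ]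
    {L : κ → ModuleCat.{u} R} (hL : ∀ x, IsInd (L x)) (e : T ≃ₗ[R] ∀ x, L x)
    {N N' : ModuleCat.{u} R} [Module.Finite R N'] (hN : InAdd T N) {i : N' →ₗ[R] N}
    {r : N →ₗ[R] N'} (h : r ∘ₗ i = LinearMap.id) :
    ∃ (ι : Type) (_ : Fintype ι) (c : ι → κ), Nonempty (N' ≃ₗ[R] ∀ j, L (c j)) := by
  obtain ⟨m, i', r', h'⟩ := hN
  let a : (Fin m → T) →ₗ[R] ∀ p : Fin m × κ, L p.2 :=
    LinearMap.pi fun p => LinearMap.proj (φ := fun x => (L x : Type u)) p.2 ∘ₗ e.toLinearMap ∘ₗ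
      LinearMap.proj (φ := fun _ => (T : Type u)) p.1
  let b : (∀ p : Fin m × κ, L p.2) →ₗ[R] (Fin m → T) :=
    LinearMap.pi fun j => e.symm.toLinearMap ∘ₗ LinearMap.pi fun x =>
      LinearMap.proj (φ := fun p : Fin m × κ => (L p.2 : Type u)) (j, x)
  have hba : b ∘ₗ a = LinearMap.id := LinearMap.ext fun v => funext fun j =>
    e.symm_apply_apply (v j)
  obtain ⟨ι, hι, c, ⟨e'⟩⟩ := exists_linearEquiv_pi_of_retract (L := fun p : Fin m × κ => L p.2)
    (fun p => hL p.2) (a ∘ₗ i' ∘ₗ i) (r ∘ₗ r' ∘ₗ b) (by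
      ext x
      have h1 (v) : b (a v) = v := LinearMap.congr_fun hba v
      have h2 (v) : r' (i' v) = v := LinearMap.congr_fun h' v
      have h3 (v) : r (i v) = v := LinearMap.congr_fun h v
      simp only [LinearMap.comp_apply, h1, h2, h3]
      rfl)
  exact ⟨ι, hι, fun j => (c j).2, ⟨e'⟩⟩

theorem ExtZero.of_inAdd {M N : ModuleCat.{u} R} (h : ExtZero T T) (hM : InAdd T M)
    (hN : InAdd T N) : ExtZero M N := by
  obtain ⟨m, i, r, hri⟩ := hM
  obtain ⟨m', i', r', hri'⟩ := hN
  refine ExtZero.retract_left (M := ModuleCat.of R (Fin m → T)) ?_ i r hri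
  refine ExtZero.retract_right (N := ModuleCat.of R (Fin m' → T)) ?_ i' r' hri'
  exact ExtZero.pi_left (L := fun _ => T) (LinearEquiv.refl _ _) fun _ =>
    ExtZero.pi_right (N := fun _ => T) (LinearEquiv.refl _ _) fun _ => h

end Summands

/-! ### Coresolutions of the single projectives by summands of the tilting module. -/

section Coresolutions

variable {A : Type u} [Ring A] {T₀ T₁ : ModuleCat.{u} Aᵐᵒᵖ}

theorem exists_retract_of_isCompl {R : Type u} [Ring R] {M : ModuleCat.{u} R} {v : M →ₗ[R] M}
    (h : IsCompl (LinearMap.ker v) (LinearMap.range v)) :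
    ∃ r : M →ₗ[R] imageOf v, r ∘ₗ (LinearMap.range v).subtype = LinearMap.id :=
  ⟨Submodule.projectionOnto _ _ h.symm, Submodule.projectionOnto_comp_subtype h.symm⟩

/-- A coresolution of `A` splits into coresolutions of the projective modules `c A`. -/
theorem exists_coresolution_projAt {c : A} (hc : c * c = c) [IsArtinianRing Aᵐᵒᵖ]
    [Module.Finite Aᵐᵒᵖ T₀] [Module.Finite Aᵐᵒᵖ T₁] {f : A →ₗ[Aᵐᵒᵖ] T₀} {g : T₀ →ₗ[Aᵐᵒᵖ] T₁}
    (hf : Function.Injective f) (hfg : Function.Exact f g) (hg : Function.Surjective g)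
    (hext : ExtZero T₁ T₀) :
    ∃ (v₀ : T₀ →ₗ[Aᵐᵒᵖ] T₀) (v₁ : T₁ →ₗ[Aᵐᵒᵖ] T₁)
      (f' : projAt c →ₗ[Aᵐᵒᵖ] imageOf v₀) (g' : imageOf v₀ →ₗ[Aᵐᵒᵖ] imageOf v₁),
      IsCompl (LinearMap.ker v₀) (LinearMap.range v₀) ∧
      IsCompl (LinearMap.ker v₁) (LinearMap.range v₁) ∧
      Function.Injective f' ∧ Function.Exact f' g' ∧ Function.Surjective g' := by
  let l : A →ₗ[Aᵐᵒᵖ] A :=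
    { toFun a := c * a
      map_add' := mul_add c
      map_smul' _ _ := (mul_assoc _ _ _).symm }
  -- Left multiplication by `c` extends to `T₀` and induces an endomorphism of `T₁`. These need not
  -- be idempotent; high powers have complementary kernel and range, and still act as `c` on the
  -- image of `A`.
  obtain ⟨u₀, hu₀⟩ := hext.exists_extend (P₁ := ModuleCat.of Aᵐᵒᵖ A) hf hfg hg (f ∘ₗ l)
  have hu₀' (a : A) : u₀ (f a) = f (c * a) := LinearMap.congr_fun hu₀ a
  obtain ⟨u₁, hu₁⟩ := exists_comp_eq_of_ker_le hg (m := g ∘ₗ u₀) (by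
    intro x hx
    obtain ⟨a, rfl⟩ := (hfg x).1 hx
    rw [LinearMap.mem_ker, LinearMap.comp_apply, hu₀', hfg.apply_apply_eq_zero])
  have hu₁' (t : T₀) : u₁ (g t) = g (u₀ t) := LinearMap.congr_fun hu₁ t
  obtain ⟨n, h₀, h₁, hn⟩ := ((LinearMap.eventually_isCompl_ker_pow_range_pow u₀).and
    ((LinearMap.eventually_isCompl_ker_pow_range_pow u₁).and
      (Filter.eventually_ge_atTop 1))).exists
  obtain ⟨n, rfl⟩ := Nat.exists_eq_add_of_le' hn
  have hv₀ (a : A) : ((u₀ : Module.End Aᵐᵒᵖ T₀) ^ (n + 1)) (f a) = f (c * a) := by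
    clear h₀ h₁ hn
    induction n with
    | zero => rw [zero_add, pow_one, hu₀']
    | succ n ih => rw [pow_succ', Module.End.mul_apply, ih, hu₀', ← mul_assoc, hc]
  have hv₁ (m : ℕ) (t : T₀) : ((u₁ : Module.End Aᵐᵒᵖ T₁) ^ m) (g t) =
      g (((u₀ : Module.End Aᵐᵒᵖ T₀) ^ m) t) := by
    induction m with
    | zero => rfl
    | succ m ih => rw [pow_succ', Module.End.mul_apply, ih, hu₁', pow_succ', Module.End.mul_apply]
  generalize hv : (u₀ : Module.End Aᵐᵒᵖ T₀) ^ (n + 1) = v₀ at *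
  generalize hv' : (u₁ : Module.End Aᵐᵒᵖ T₁) ^ (n + 1) = v₁ at *
  have hv₁' (t : T₀) : v₁ (g t) = g (v₀ t) := by rw [← hv, ← hv', hv₁]
  refine ⟨v₀, v₁, (f ∘ₗ (projRight c).subtype).codRestrict _ fun x =>
    ⟨f x.1, (hv₀ x.1).trans (congrArg f ((mem_projRight hc).1 x.2))⟩,
    (g ∘ₗ (LinearMap.range v₀).subtype).codRestrict _ fun x => ?_, h₀, h₁, ?_, ?_, ?_⟩
  · obtain ⟨_, t, rfl⟩ := x
    exact ⟨g t, hv₁' t⟩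
  · intro x y hxy
    exact Subtype.ext (hf (congrArg Subtype.val hxy))
  · intro y
    constructor
    · intro hy
      obtain ⟨a, ha⟩ := (hfg y.1).1 (congrArg Subtype.val hy)
      have h2 : v₀ y.1 = f (c * a) := by rw [← ha, hv₀]
      -- The difference is killed by `v₀`, since `c` is idempotent, and lies in its range; these two
      -- submodules are complementary.
      have h3 : v₀ y.1 = y.1 := by
        have h4 : v₀ y.1 - y.1 ∈ LinearMap.ker v₀ ⊓ LinearMap.range v₀ := by
          refine ⟨?_, Submodule.sub_mem _ ⟨_, rfl⟩ y.2⟩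
          change v₀ (v₀ y.1 - y.1) = 0
          rw [map_sub, h2, hv₀, ← mul_assoc, hc, sub_self]
        rw [h₀.inf_eq_bot] at h4
        exact sub_eq_zero.1 h4
      exact ⟨⟨c * a, (mem_projRight hc).2 (by rw [← mul_assoc, hc])⟩,
        Subtype.ext (h2.symm.trans h3)⟩
    · rintro ⟨x, rfl⟩
      exact Subtype.ext (hfg.apply_apply_eq_zero x.1)
  · rintro ⟨_, t, rfl⟩
    obtain ⟨s, rfl⟩ := hg t
    exact ⟨⟨v₀ s, s, rfl⟩, Subtype.ext (hv₁' s).symm⟩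

end Coresolutions

section Matrices

open Matrix

variable {m n : Type*} [Fintype m] [Fintype n]

theorem card_le_card_of_vecMul {M : Matrix m n ℚ} (h : ∀ w, w ᵥ* M = 0 → w = 0) :
    Fintype.card m ≤ Fintype.card n := by
  have h1 : Function.Injective M.vecMulLinear :=
    (injective_iff_map_eq_zero M.vecMulLinear).2 h
  simpa using LinearMap.finrank_le_finrank_of_injective h1

theorem transpose_mul_mul_apply (B : Matrix m n ℚ) (c : Matrix m m ℚ) (i j : n) :
    (Bᵀ * c * B) i j = ∑ x, ∑ y, B x i * c x y * B y j := by
  simp only [Matrix.mul_apply, Matrix.transpose_apply, Finset.sum_mul]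
  rw [Finset.sum_comm]

theorem trace_one_sub_transpose_mul [DecidableEq n] (a c : Matrix n n ℚ) :
    ((1 - a)ᵀ * c).trace = ∑ i, c i i - ∑ i, ∑ j, a i j * c i j := by
  rw [transpose_sub, transpose_one, Matrix.sub_mul, Matrix.one_mul, trace_sub]
  simp only [trace, diag_apply, Matrix.mul_apply, transpose_apply]
  rw [Finset.sum_comm]

end Matrices

theorem IsIrreducible.hom_ne_zero {R : Type u} [Ring R] {M N : ModuleCat.{u} R} [Nontrivial M]
    [Nontrivial N] {f : M ⟶ N} (h : IsIrreducible f) : f.hom ≠ 0 := by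
  intro h0
  let Z := ModuleCat.of R PUnit.{u + 1}
  rcases h.2.2 Z (ModuleCat.ofHom (0 : M →ₗ[R] Z)) (ModuleCat.ofHom (0 : Z →ₗ[R] N))
    inferInstance (by
      ext x
      have h1 : f.hom x = 0 := LinearMap.congr_fun h0 x
      rw [h1]
      rfl) with h | h
  · obtain ⟨r, hr⟩ := (isSplitMono_iff _).1 h
    obtain ⟨x, hx⟩ := exists_ne (0 : M)
    exact hx ((LinearMap.congr_fun hr x).symm.trans (map_zero r))
  · obtain ⟨s, hs⟩ := (isSplitEpi_iff _).1 h
    obtain ⟨x, hx⟩ := exists_ne (0 : N)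
    exact hx (LinearMap.congr_fun hs x).symm

theorem Arrow.exists_ne_zero {R : Type u} [Ring R] {M N : ModuleCat.{u} R} (h : Arrow M N) :
    ∃ f : M →ₗ[R] N, f ≠ 0 := by
  obtain ⟨hM, hN, f, hf⟩ := h
  have := hM.nontrivial
  have := hN.nontrivial
  exact ⟨f.hom, hf.hom_ne_zero⟩

/-! ### Classes of the tilting summands. -/

section Tilting

variable {k : Type u} [Field k] {C : Type u} [Ring C] [Algebra k C]
  [FiniteDimensional k C] {ι : Type*} [Fintype ι] {e : ι → C} {A : Type u} [Ring A]
  [Algebra k A] [FiniteDimensional k A] {κ : Type*} [Fintype κ] [DecidableEq κ] {f : κ → A}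
  {T : ModuleCat.{u} Aᵐᵒᵖ}

theorem IsTilting.finite_imageOf (hT : IsTilting A T) (φ : C ≃ₐ[k] Module.End Aᵐᵒᵖ T) (c : C) :
    Module.Finite Aᵐᵒᵖ (imageOf (φ c)) :=
  have := hT.finite
  inferInstanceAs (Module.Finite Aᵐᵒᵖ (LinearMap.range (φ c)))

theorem IsTilting.exists_isGVector (hT : IsTilting A T) (hf : IsPointSystem f)
    (φ : C ≃ₐ[k] Module.End Aᵐᵒᵖ T) {c : C} (hc : c * c = c) :
    ∃ g, IsGVector (fun x => projAt (f x)) (imageOf (φ c)) g := by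
  have := isArtinianRing_of_finiteDimensional k Aᵐᵒᵖ
  have := hT.finite_imageOf φ c
  obtain ⟨P₁, P₀, i, p, h⟩ := exists_isRes_of_projDim (M := imageOf (φ c))
    (hasProjectiveDimensionLE_of_retract hT.projDim (imageIncl φ c) (imageProj φ c)
      (imageProj_comp_imageIncl φ hc))
  exact (hf.isProjSystem (k := k)).exists_isGVector h

theorem IsTilting.extZero_imageOf (hT : IsTilting A T) (φ : C ≃ₐ[k] Module.End Aᵐᵒᵖ T) {c d : C}
    (hc : c * c = c) (hd : d * d = d) : ExtZero (imageOf (φ c)) (imageOf (φ d)) :=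
  ((ExtZero.of_subsingleton_ext hT.rigid).retract_left (imageIncl φ c) (imageProj φ c)
    (imageProj_comp_imageIncl φ hc)).retract_right (imageIncl φ d) (imageProj φ d)
    (imageProj_comp_imageIncl φ hd)

/-- The dimension vectors of the summands of a tilting module span those of the projectives. -/
theorem IsTilting.sum_hdim_eq_zero (hT : IsTilting A T) (hf : IsPointSystem f)
    (φ : C ≃ₐ[k] Module.End Aᵐᵒᵖ T) (he : IsPointSystem e) {w : κ → ℚ}
    (hw : ∀ x, ∑ a, w a * hdim k (projAt (f a)) (imageOf (φ (e x))) = 0) (b : κ) :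
    ∑ a, w a * hdim k (projAt (f a)) (projAt (f b)) = 0 := by
  have := isArtinianRing_of_finiteDimensional k Aᵐᵒᵖ
  have hQ := hf.isProjSystem (k := k)
  have := hT.finite
  have hL (x : ι) : IsInd (imageOf (φ (e x))) := isInd_imageOf φ (he.primitive x)
  obtain ⟨eT⟩ := exists_linearEquiv_imageOf φ he.complete
  have key {N : ModuleCat.{u} Aᵐᵒᵖ} (hN : InAdd T N) {v : N →ₗ[Aᵐᵒᵖ] N} [Module.Finite Aᵐᵒᵖ N]
      (hv : IsCompl (LinearMap.ker v) (LinearMap.range v)) :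
      ∑ a, w a * hdim k (projAt (f a)) (imageOf v) = 0 := by
    obtain ⟨r, hr⟩ := exists_retract_of_isCompl hv
    have : Module.Finite Aᵐᵒᵖ (imageOf v) := inferInstanceAs (Module.Finite Aᵐᵒᵖ (LinearMap.range v))
    obtain ⟨α, _, c, ⟨ec⟩⟩ := exists_linearEquiv_of_inAdd hL eT hN (N' := imageOf v) hr
    have := fun x => (hL x).finite
    have := fun x => (hQ.ind x).finite
    have h1 (a : κ) : hdim k (projAt (f a)) (imageOf v) =
        ∑ j, hdim k (projAt (f a)) (imageOf (φ (e (c j)))) :=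
      hdim_pi_right (N := fun j => imageOf (φ (e (c j)))) ec
    simp only [h1, Nat.cast_sum, Finset.mul_sum]
    rw [Finset.sum_comm]
    exact Finset.sum_eq_zero fun j _ => hw (c j)
  have hfin {N : ModuleCat.{u} Aᵐᵒᵖ} (hN : InAdd T N) : Module.Finite Aᵐᵒᵖ N := by
    obtain ⟨m, i, r, hri⟩ := hN
    exact Module.Finite.of_surjective r fun x => ⟨i x, LinearMap.congr_fun hri x⟩
  obtain ⟨T₀, T₁, i, p, h₀, h₁, hi, hip, hp⟩ := hT.coresolution
  have := hfin h₀
  have := hfin h₁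
  obtain ⟨v₀, v₁, i', p', hv₀, hv₁, hi', hip', hp'⟩ := exists_coresolution_projAt
    (hf.primitive b).1 hi hip hp ((ExtZero.of_subsingleton_ext hT.rigid).of_inAdd h₁ h₀)
  have : Module.Finite Aᵐᵒᵖ (imageOf v₀) :=
    inferInstanceAs (Module.Finite Aᵐᵒᵖ (LinearMap.range v₀))
  have h2 (a : κ) : (hdim k (projAt (f a)) (projAt (f b)) : ℚ) =
      hdim k (projAt (f a)) (imageOf v₀) - hdim k (projAt (f a)) (imageOf v₁) := by
    have := hQ.projective a
    have := (hQ.ind a).finite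
    rw [hdim_exact_right hi' hip' hp']
    push_cast
    ring
  simp only [h2, mul_sub, Finset.sum_sub_distrib, key h₀ hv₀, key h₁ hv₁, sub_self]

end Tilting

/-! ### Comparison of the slice with the tree. -/

section Slices

open Matrix

variable {k : Type u} [Field k] [IsAlgClosed k] {C : Type u} [Ring C] [Algebra k C]
  [FiniteDimensional k C] {S : Set (ModuleCat.{u} Cᵐᵒᵖ)} {n : ℕ}
  {X : Fin n → ModuleCat.{u} Cᵐᵒᵖ} {ι : Type*} [Fintype ι] {e : ι → C}

/-- A complete slice over a tilted algebra of tree type has fewer arrows than points. -/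
theorem IsIrredundant.card_arrow_lt (hS : IsCompleteSlice k S) (hX : IsIrredundant S X)
    (hall : ∀ M ∈ S, ∃ v, Nonempty (M ≃ₗ[Cᵐᵒᵖ] X v)) (he : IsPointSystem e)
    (hC : IsTiltedOfTreeType k C) :
    Nat.card {p : Fin n × Fin n // Arrow (X p.1) (X p.2)} < n := by
  classical
  obtain ⟨A, _, _, n', f, T, hAfd, hA, hf, ⟨hN, htree⟩, hT, ⟨φ⟩⟩ := hC
  have := isArtinianRing_of_finiteDimensional k Aᵐᵒᵖ
  have hQA := hf.isProjSystem (k := k)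
  have hQC := he.isProjSystem (k := k)
  have := fun v => (hS.points.ind _ (hX.mem v)).finite
  have := fun x => hT.finite_imageOf φ (e x)
  have hee (x : ι) : e x * e x = e x := (he.primitive x).1
  choose gL hgL using fun x => hT.exists_isGVector hf φ (hee x)
  choose gX hgX using fun v => hS.exists_isGVector he (hX.mem v)
  obtain ⟨α, hα, hαc⟩ := hA.exists_sinkMatrix (k := k) hf
  obtain ⟨a, ha, hac⟩ := hX.exists_sinkMatrix hS hall he
  let cA : Matrix (Fin n') (Fin n') ℚ := .of fun x y => (hdim k (projAt (f x)) (projAt (f y)) : ℚ)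
  let cC : Matrix ι ι ℚ := .of fun x y => (hdim k (projAt (e x)) (projAt (e y)) : ℚ)
  let cX : Matrix (Fin n) (Fin n) ℚ := .of fun v w => (hdim k (X v) (X w) : ℚ)
  let G : Matrix (Fin n') ι ℚ := .of fun a x => gL x a
  let H : Matrix ι (Fin n) ℚ := .of fun x v => gX v x
  let α' : Matrix (Fin n') (Fin n') ℚ := .of fun i j => (α i j : ℚ)
  let a' : Matrix (Fin n) (Fin n) ℚ := .of fun i j => (a i j : ℚ)
  have hcA : cA * (1 - α') = 1 := by
    rw [Matrix.mul_sub, Matrix.mul_one, sub_eq_iff_eq_add]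
    ext x y
    simp only [cA, α', Matrix.of_apply, hαc x y, Matrix.add_apply, Matrix.mul_apply,
      Matrix.one_apply]
    push_cast
    rfl
  have hcX : cX * (1 - a') = 1 := by
    rw [Matrix.mul_sub, Matrix.mul_one, sub_eq_iff_eq_add]
    ext x y
    simp only [cX, a', Matrix.of_apply, Matrix.add_apply, Matrix.mul_apply,
      Matrix.one_apply]
    rw [hac x y]
    push_cast
    rfl
  have hCA : cC = Gᵀ * cA * G := by
    ext x y
    rw [transpose_mul_mul_apply]
    have h1 : cC x y = hdim k (imageOf (φ (e x))) (imageOf (φ (e y))) :=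
      congrArg Nat.cast (hdim_imageOf φ (hee x) (hee y))
    rw [h1, (hgL x).hdim_eq hQA (hgL y) (hT.extZero_imageOf φ (hee x) (hee y))]
    rfl
  have hXC : cX = Hᵀ * cC * H := by
    ext v w
    rw [transpose_mul_mul_apply]
    exact (hgX v).hdim_eq hQC (hgX w) (hS.extZero (hX.mem v) (hX.mem w))
  have hXA : cX = (G * H)ᵀ * cA * (G * H) := by
    rw [hXC, hCA, Matrix.transpose_mul]
    simp only [Matrix.mul_assoc]
  -- Three inequalities close a circle. Spanning by the slice bounds the points of `C` by the slice
  -- modules; the coresolution of `A` bounds the points of `A` by those of `C`; invertibility of the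
  -- slice matrix bounds the slice modules by the points of `A`.
  have h1 : Fintype.card ι ≤ Fintype.card (Fin n) :=
    card_le_card_of_vecMul (M := H) fun w hw =>
      hX.spanning hS hall he hgX fun v => congrFun hw v
  have h2 : Fintype.card (Fin n') ≤ Fintype.card ι := by
    refine card_le_card_of_vecMul (M := cA * G) fun w hw => ?_
    have h3 : w ᵥ* cA = 0 := by
      funext b
      refine hT.sum_hdim_eq_zero hf φ he (fun x => ?_) b
      refine Eq.trans ?_ (congrFun hw x)
      simp only [Matrix.vecMul, dotProduct, Matrix.mul_apply]
      refine Finset.sum_congr rfl fun b _ => ?_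
      have := (hgL x).hdim_proj (k := k) hQA b
      rw [this]
      congr 1
      exact Finset.sum_congr rfl fun y _ => mul_comm _ _
    have h4 := congrArg (fun w => w ᵥ* (1 - α')) h3
    simpa only [Matrix.vecMul_vecMul, hcA, Matrix.vecMul_one, Matrix.zero_vecMul] using h4
  have h3 : Fintype.card (Fin n) ≤ Fintype.card (Fin n') := by
    refine card_le_card_of_vecMul (M := (G * H)ᵀ) fun w hw => ?_
    have h4 : w ᵥ* cX = 0 := by
      rw [hXA, Matrix.mul_assoc, ← Matrix.vecMul_vecMul, hw, Matrix.zero_vecMul]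
    have h5 := congrArg (fun w => w ᵥ* (1 - a')) h4
    simpa only [Matrix.vecMul_vecMul, hcX, Matrix.vecMul_one, Matrix.zero_vecMul] using h5
  have hcard : Fintype.card (Fin n') = Fintype.card (Fin n) := (h2.trans h1).antisymm h3
  have htrace := trace_eq_of_congruent hcard hcX hcA hXA
  have hcA1 (i : Fin n') : cA i i = 1 :=
    (congrArg Nat.cast (hA.hdim_self (k := k) (hQA.ind i))).trans Nat.cast_one
  have hcX1 (i : Fin n) : cX i i = 1 :=
    (congrArg Nat.cast (hS.hdim_self (hX.mem i))).trans Nat.cast_one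
  -- The entry of the sink matrix at `(i, j)` is bounded by `numArrows` with its arguments
  -- exchanged, so the tree is read in the opposite direction.
  have hG : (SimpleGraph.fromRel fun i j => numArrows k (f j) (f i) ≠ 0).IsTree := by
    convert htree using 1
    ext i j
    simp only [SimpleGraph.fromRel_adj]
    tauto
  have hsum := sum_le_of_tree (N := fun i j => numArrows k (f j) (f i)) hcA (fun i j => hα i j)
    (fun i j => hN j i) hG hcA1
  rw [trace_one_sub_transpose_mul, trace_one_sub_transpose_mul] at htrace
  simp only [hcA1, hcX1, Finset.sum_const, Finset.card_univ, nsmul_eq_mul, mul_one, hcard]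
    at htrace
  -- Each arrow of the slice has positive multiplicity in the sink map and carries a nonzero map, so
  -- it adds at least 1. All other terms are nonnegative.
  have hle : (Nat.card {p : Fin n × Fin n // Arrow (X p.1) (X p.2)} : ℚ) ≤
      ∑ i, ∑ j, a' i j * cX i j := by
    rw [← Fintype.sum_prod_type' fun i j => a' i j * cX i j, Nat.card_eq_fintype_card,
      Fintype.card_subtype, Finset.card_filter, Nat.cast_sum]
    refine Finset.sum_le_sum fun p _ => ?_
    by_cases hp : Arrow (X p.1) (X p.2)
    · rw [if_pos hp]
      obtain ⟨g, hg⟩ := hp.exists_ne_zero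
      have h4 : 1 ≤ a p.1 p.2 * hdim k (X p.1) (X p.2) :=
        Nat.one_le_iff_ne_zero.2 (mul_ne_zero (ha _ _ hp) (hdim_ne_zero hg))
      simp only [a', cX, Matrix.of_apply]
      exact_mod_cast h4
    · rw [if_neg hp]
      simp only [a', cX, Matrix.of_apply]
      positivity
  have hfin : (Nat.card {p : Fin n × Fin n // Arrow (X p.1) (X p.2)} : ℚ) + 1 ≤ n := by
    rw [hcard, Fintype.card_fin] at hsum
    rw [Fintype.card_fin] at htrace
    have h5 : ∑ i, ∑ j, α' i j * cA i j = ∑ i, ∑ j, (α i j : ℚ) * cA i j := rfl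
    linarith
  exact_mod_cast hfin

end Slices

/-! ### The counting argument for bad arrows. -/

/-- In a finite directed graph with fewer arrows than vertices, some component of the subgraph of
good arrows is not entered by a bad arrow. -/
theorem exists_connectedComponent_of_card_lt {V : Type*} [Fintype V] (r bad : V → V → Prop)
    (hcard : Nat.card {p : V × V // r p.1 p.2} < Fintype.card V) :
    ∃ K : (SimpleGraph.fromRel fun v w => r v w ∧ ¬ bad v w).ConnectedComponent,
      ∀ v w, r v w → bad v w → SimpleGraph.connectedComponentMk _ w ≠ K := by
  classical
  set H := SimpleGraph.fromRel fun v w => r v w ∧ ¬ bad v w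
  by_contra! hne
  choose s t hr hbad ht using hne
  let d (v : V) : ℕ := H.dist v (t (H.connectedComponentMk v))
  have hstep {v z : V} (hvz : H.Reachable v z) (hne : v ≠ z) :
      ∃ u, H.Adj v u ∧ H.dist u z < H.dist v z := by
    obtain ⟨p, hp⟩ := hvz.exists_walk_length_eq_dist
    cases p with
    | nil => exact absurd rfl hne
    | @cons _ u _ hadj p =>
      have h2 := SimpleGraph.dist_le p
      rw [SimpleGraph.Walk.length_cons] at hp
      exact ⟨u, hadj, by omega⟩
  -- Assign to the root `t` of each component the bad arrow entering there, and to any other vertex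
  -- a good arrow joining it to a neighbour nearer to its root.
  have key (v : V) : ∃ p : V × V, r p.1 p.2 ∧ ((bad p.1 p.2 ∧ p.2 = v) ∨
      (¬ bad p.1 p.2 ∧ ∃ u, (p = (v, u) ∨ p = (u, v)) ∧ d u < d v)) := by
    by_cases hv : v = t (H.connectedComponentMk v)
    · exact ⟨(s (H.connectedComponentMk v), t (H.connectedComponentMk v)), hr _,
        Or.inl ⟨hbad _, hv.symm⟩⟩
    · obtain ⟨u, hadj, hd⟩ := hstep (SimpleGraph.ConnectedComponent.exact (ht _).symm) hv
      have hd' : d u < d v := by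
        have h1 : H.connectedComponentMk u = H.connectedComponentMk v :=
          SimpleGraph.ConnectedComponent.sound hadj.symm.reachable
        simpa only [d, h1] using hd
      rcases (SimpleGraph.fromRel_adj _ _ _).1 hadj with ⟨-, h | h⟩
      · exact ⟨(v, u), h.1, Or.inr ⟨h.2, u, Or.inl rfl, hd'⟩⟩
      · exact ⟨(u, v), h.1, Or.inr ⟨h.2, u, Or.inr rfl, hd'⟩⟩
  choose p hp hpv using key
  have hinj : Function.Injective fun v => (⟨p v, hp v⟩ : {p : V × V // r p.1 p.2}) := by
    intro v w hvw
    have hvw : p v = p w := congrArg Subtype.val hvw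
    rcases hpv v with ⟨h1, h2⟩ | ⟨h1, u, h2, h3⟩ <;> rcases hpv w with ⟨h4, h5⟩ | ⟨h4, u', h5, h6⟩
    · rw [← h2, ← h5, hvw]
    · exact absurd (hvw ▸ h1) h4
    · exact absurd (hvw ▸ h4) h1
    -- Two different vertices sharing a good arrow would be its two ends, each strictly nearer to
    -- its root than the other.
    · rcases h2 with h2 | h2 <;> rcases h5 with h5 | h5 <;>
        · rw [h2, h5, Prod.mk.injEq] at hvw
          obtain ⟨rfl, rfl⟩ := hvw
          first | rfl | omega
  have h1 := Nat.card_le_card_of_injective _ hinj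
  rw [Nat.card_eq_fintype_card] at h1
  omega

/-! ### Invariance of arrows and injectivity under isomorphism. -/

section Arrows

variable {R : Type u} [Ring R] {M M' N N' : ModuleCat.{u} R}

theorem IsIrreducible.congr {f : M ⟶ N} (hf : IsIrreducible f) (e : M' ≅ M) (e' : N ≅ N') :
    IsIrreducible (e.hom ≫ f ≫ e'.hom) := by
  obtain ⟨h1, h2, h3⟩ := hf
  refine ⟨fun h => h1 ?_, fun h => h2 ?_, fun X g h hX hgh => ?_⟩
  · obtain ⟨s⟩ := h.exists_splitMono
    have hs := s.id
    simp only [Category.assoc] at hs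
    have hs' : f ≫ e'.hom ≫ s.retraction = e.inv := by
      rw [← cancel_epi e.hom, hs, e.hom_inv_id]
    exact ⟨⟨⟨e'.hom ≫ s.retraction ≫ e.hom, by
      simpa only [Category.assoc, e.inv_hom_id] using congrArg (· ≫ e.hom) hs'⟩⟩⟩
  · obtain ⟨s⟩ := h.exists_splitEpi
    have hs' : s.section_ ≫ e.hom ≫ f = e'.inv := by
      rw [← cancel_mono e'.hom, e'.inv_hom_id, ← s.id]
      simp only [Category.assoc]
    exact ⟨⟨⟨e'.hom ≫ s.section_ ≫ e.hom, by
      simpa only [Category.assoc, e'.hom_inv_id] using congrArg (e'.hom ≫ ·) hs'⟩⟩⟩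
  · rcases h3 X (e.inv ≫ g) (h ≫ e'.inv) hX (by
      rw [Category.assoc, ← Category.assoc g, hgh]
      simp) with h4 | h4
    · obtain ⟨s⟩ := h4.exists_splitMono
      have hs := s.id
      rw [Category.assoc] at hs
      have hs' : g ≫ s.retraction = e.hom := by
        rw [← cancel_epi e.inv, hs, e.inv_hom_id]
      exact Or.inl ⟨⟨⟨s.retraction ≫ e.inv, by
        simpa only [Category.assoc, e.hom_inv_id] using congrArg (· ≫ e.inv) hs'⟩⟩⟩
    · obtain ⟨s⟩ := h4.exists_splitEpi
      have hs' : s.section_ ≫ h = e'.hom := by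
        rw [← cancel_mono e'.inv, e'.hom_inv_id, Category.assoc, s.id]
      exact Or.inr ⟨⟨⟨e'.inv ≫ s.section_, by
        simpa only [Category.assoc, e'.inv_hom_id] using congrArg (e'.inv ≫ ·) hs'⟩⟩⟩

theorem Arrow.congr (h : Arrow M N) (e : M ≃ₗ[R] M') (e' : N ≃ₗ[R] N') : Arrow M' N' := by
  obtain ⟨hM, hN, f, hf⟩ := h
  exact ⟨hM.of_linearEquiv e, hN.of_linearEquiv e', _,
    hf.congr e.toModuleIso.symm e'.toModuleIso⟩

theorem injective_congr (e : M ≃ₗ[R] N) : Injective M ↔ Injective N :=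
  ⟨fun h => Injective.of_iso e.toModuleIso h, fun h => Injective.of_iso e.symm.toModuleIso h⟩

end Arrows

/-! ### Sources of a slice, and the completion. -/

section Slices

variable {k : Type u} [Field k] {C : Type u} [Ring C] [Algebra k C] [FiniteDimensional k C]
  {S : Set (ModuleCat.{u} Cᵐᵒᵖ)} {ι : Type*} [Fintype ι] {e : ι → C}

/-- A nonzero map between slice modules whose target is a source of the slice is bijective. -/
theorem IsCompleteSlice.bijective_of_source (hS : IsCompleteSlice k S) (he : IsPointSystem e)
    {I Y : ModuleCat.{u} Cᵐᵒᵖ} (hI : I ∈ S) (hsrc : ∀ N ∈ S, ¬ Arrow N I) (hY : Y ∈ S)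
    {g : Y →ₗ[Cᵐᵒᵖ] I} (hg : g ≠ 0) : Function.Bijective g := by
  classical
  have := isArtinianRing_of_finiteDimensional k Cᵐᵒᵖ
  have hII := hS.points.ind I hI
  have hYI := hS.points.ind Y hY
  by_contra hb
  obtain ⟨E, p, hp, -⟩ := hS.exists_isSink he hI
  obtain ⟨g', rfl⟩ := hp.lift Y g hYI.finite fun ⟨s, hs⟩ =>
    hb (hII.bijective_of_comp hYI (by rw [hs]; exact Function.bijective_id)).2
  have := hp.finite
  obtain ⟨α, _, W, hW, ⟨eW⟩⟩ := exists_linearEquiv_pi E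
  obtain ⟨i, hi⟩ := exists_component_ne_zero eW hg
  have harr := hp.arrow hII eW i (hW i)
  obtain ⟨L, hL, hLp, hτ⟩ := hS.exists_tau_of_arrow hI harr fun h => hsrc _ h harr
  exact hi (by rw [hS.hom_eq_zero_of_isTau hY hL hLp hτ
    (LinearMap.proj i ∘ₗ eW.toLinearMap ∘ₗ g'), LinearMap.comp_zero])

/-- An injective predecessor is some `I_y`, which receives a nonzero map from the slice by
sincerity. Convexity puts it, and the whole path, in the slice, where any nonzero map to a source is
bijective. -/
theorem IsCompleteSlice.isStrongSink (hS : IsCompleteSlice k S) (he : IsPointSystem e) {x : ι}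
    (hI : injAt k (e x) ∈ S) (hsrc : ∀ N ∈ S, ¬ Arrow N (injAt k (e x))) :
    IsStrongSink k (e x) := by
  intro M hM hMinj hlead
  obtain ⟨y, ⟨ey⟩⟩ := exists_linearEquiv_injAt (k := k) he hM hMinj
  have hy := he.primitive y
  obtain ⟨N, hN, m, hm⟩ := hS.sincere (e y) hy.1 hy.2.1
  obtain ⟨φ, hφ⟩ := exists_ne_zero_injAt (k := k) hm
  have hNM : Leads N M := .of_ne_zero (hS.points.ind N hN) hM (f := ey.symm.toLinearMap ∘ₗ φ)
    fun h0 => hφ (by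
      ext1 z
      apply ey.symm.injective
      rw [LinearMap.zero_apply, map_zero]
      exact LinearMap.congr_fun h0 z)
  have hMS : M ∈ S := hS.convex N hN _ hI M hNM hlead
  have key : ∀ Y, Leads Y (injAt k (e x)) → Y ∈ S → Nonempty (Y ≃ₗ[Cᵐᵒᵖ] injAt k (e x)) := by
    intro Y hY
    induction hY using Relation.ReflTransGen.head_induction_on with
    | refl => exact fun _ => ⟨LinearEquiv.refl _ _⟩
    | @head Y Z hYZ hZ ih =>
      intro hYS
      have hZS : Z ∈ S := hS.convex Y hYS _ hI Z (.single hYZ) hZ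
      obtain ⟨eZ⟩ := ih hZS
      obtain ⟨-, -, f, hf⟩ := hYZ
      refine ⟨LinearEquiv.ofBijective (eZ.toLinearMap ∘ₗ f.hom)
        (hS.bijective_of_source he hI hsrc hYS fun h0 => hf ?_)⟩
      ext z
      apply eZ.injective
      exact (LinearMap.congr_fun h0 z).trans (map_zero eZ).symm
  obtain ⟨eM⟩ := key M hlead hMS
  exact ⟨eM.toModuleIso⟩

variable {n : ℕ} {X : Fin n → ModuleCat.{u} Cᵐᵒᵖ}

/-- There are no loops: a nonzero endomorphism of a slice module is bijective, hence not
irreducible. -/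
theorem IsIrredundant.homLT_of_arrow (hS : IsCompleteSlice k S) (hX : IsIrredundant S X)
    {v w : Fin n} (h : Arrow (X v) (X w)) : HomLT X v w := by
  obtain ⟨f, hf⟩ := h.exists_ne_zero
  refine ⟨?_, f, hf⟩
  rintro rfl
  obtain ⟨-, -, g, hg⟩ := h
  have := (hS.points.ind _ (hX.mem v)).nontrivial
  let ε := LinearEquiv.ofBijective g.hom (hS.bijective_of_ne_zero (hX.mem v) hg.hom_ne_zero)
  exact hg.1 ((isSplitMono_iff g.hom).2 ⟨ε.symm.toLinearMap, LinearMap.ext ε.symm_apply_apply⟩)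

end Slices

/-- Over a tilted algebra of tree type, every rightmost slice contains a completion of some strong
sink. -/
theorem IsRightmostSlice.exists_completion {k : Type u} [Field k] [IsAlgClosed k]
    {C : Type u} [Ring C] [Algebra k C] [FiniteDimensional k C]
    {ι : Type*} [Fintype ι] (e : ι → C) (he : IsPointSystem e) (hC : IsTiltedOfTreeType k C)
    (S : Set (ModuleCat.{u} Cᵐᵒᵖ)) (hS : IsRightmostSlice k S) :
    ∃ x : ι, IsStrongSink k (e x) ∧
      ∃ G : Set (ModuleCat.{u} Cᵐᵒᵖ), IsCompletion k S (e x) G := by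
  obtain ⟨hS, hsource⟩ := hS
  obtain ⟨n, X, hX, hall⟩ := hS.exists_irredundant he
  have hcard := hX.card_arrow_lt hS hall he hC
  let r (v w : Fin n) : Prop := Arrow (X v) (X w)
  let bad (v w : Fin n) : Prop := ¬ Injective (X v) ∧ Injective (X w)
  let H := SimpleGraph.fromRel fun v w => r v w ∧ ¬ bad v w
  obtain ⟨K, hK⟩ : ∃ K : H.ConnectedComponent, ∀ v w, r v w → bad v w →
      H.connectedComponentMk w ≠ K :=
    exists_connectedComponent_of_card_lt r bad (by rwa [Fintype.card_fin])
  have hgood {v w : Fin n} (h : r v w) (hb : ¬ bad v w) :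
      H.connectedComponentMk v = H.connectedComponentMk w := by
    refine SimpleGraph.ConnectedComponent.sound (SimpleGraph.Adj.reachable ?_)
    exact (SimpleGraph.fromRel_adj _ _ _).2 ⟨(hX.homLT_of_arrow hS h).1, Or.inl ⟨h, hb⟩⟩
  let G : Set (ModuleCat.{u} Cᵐᵒᵖ) :=
    {M | ∃ v, Nonempty (M ≃ₗ[Cᵐᵒᵖ] X v) ∧ H.connectedComponentMk v = K}
  have hGS {M : ModuleCat.{u} Cᵐᵒᵖ} (hM : M ∈ G) : M ∈ S := by
    obtain ⟨v, ⟨ev⟩, -⟩ := hM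
    exact hS.mem_of_linearEquiv (hX.mem v) ev.symm
  have hXG {v : Fin n} (hv : H.connectedComponentMk v = K) : X v ∈ G :=
    ⟨v, ⟨LinearEquiv.refl _ _⟩, hv⟩
  -- Everything about predecessors comes from this: an arrow into `G` is not bad, so its source is
  -- joined to `G` by a good arrow and is injective if its target is.
  have hpred {M N : ModuleCat.{u} Cᵐᵒᵖ} (hM : M ∈ G) (hN : N ∈ S) (h : Arrow N M) :
      N ∈ G ∧ (Injective M → Injective N) := by
    obtain ⟨v, ⟨ev⟩, hv⟩ := hM
    obtain ⟨w, ⟨ew⟩⟩ := hall N hN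
    have hr : r w v := h.congr ew ev
    have hb : ¬ bad w v := fun hb => hK w v hr hb hv
    refine ⟨⟨w, ⟨ew⟩, (hgood hr hb).trans hv⟩, fun hi => ?_⟩
    by_contra hni
    exact hb ⟨fun h1 => hni ((injective_congr ew).2 h1), (injective_congr ev).1 hi⟩
  obtain ⟨v₀, hv₀⟩ := K.nonempty_supp
  -- Since `G` contains all its predecessors in the slice, a vertex minimal in `G` is a source of
  -- the slice. The rightmost hypothesis then makes it injective, which provides the point `x`.
  obtain ⟨v, hv, hmin⟩ := (hX.wellFounded hS).has_min {v | H.connectedComponentMk v = K}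
    ⟨v₀, hv₀⟩
  have hsrc (N : ModuleCat.{u} Cᵐᵒᵖ) (hN : N ∈ S) : ¬ Arrow N (X v) := fun h => by
    obtain ⟨⟨w, ⟨ew⟩, hw⟩, -⟩ := hpred (hXG hv) hN h
    exact hmin w hw (hX.homLT_of_arrow hS (h.congr ew (LinearEquiv.refl _ _)))
  have hinj := hsource (X v) (hX.mem v) hsrc
  obtain ⟨x, ⟨ex⟩⟩ := exists_linearEquiv_injAt (k := k) he (hS.points.ind _ (hX.mem v)) hinj
  refine ⟨x, hS.isStrongSink he (hS.mem_of_linearEquiv (hX.mem v) ex) fun N hN h =>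
    hsrc N hN (h.congr (LinearEquiv.refl _ _) ex.symm), G, ?_⟩
  exact
    { points := ⟨fun M hM => hS.points.ind M (hGS hM), fun M ⟨w, ⟨ew⟩, hw⟩ N ⟨i⟩ =>
        ⟨w, ⟨i.symm.toLinearEquiv.trans ew⟩, hw⟩⟩
      subset := fun M hM => hGS hM
      connected := by
        refine ⟨⟨X v, hXG hv⟩, ?_⟩
        have hwalk {a b : Fin n} (p : H.Walk a b) (ha : H.connectedComponentMk a = K) :
            Relation.ReflTransGen (fun M N => M ∈ G ∧ N ∈ G ∧
              (Nonempty (M ≅ N) ∨ Arrow M N ∨ Arrow N M)) (X a) (X b) := by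
          induction p with
          | nil => exact .refl
          | @cons a c b hadj p ih =>
            have hc : H.connectedComponentMk c = K :=
              (SimpleGraph.ConnectedComponent.sound hadj.symm.reachable).trans ha
            refine .head ⟨hXG ha, hXG hc, Or.inr ?_⟩ (ih hc)
            rcases (SimpleGraph.fromRel_adj _ _ _).1 hadj with ⟨-, h | h⟩
            · exact Or.inl h.1
            · exact Or.inr h.1
        intro M hM N hN
        obtain ⟨a, ⟨ea⟩, ha⟩ := id hM
        obtain ⟨b, ⟨eb⟩, hb⟩ := id hN
        obtain ⟨p⟩ := SimpleGraph.ConnectedComponent.exact (ha.trans hb.symm)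
        exact .head ⟨hM, hXG ha, Or.inl ⟨ea.toModuleIso⟩⟩
          ((hwalk p ha).tail ⟨hXG hb, hN, Or.inl ⟨eb.symm.toModuleIso⟩⟩)
      mem := ⟨v, ⟨ex.symm⟩, hv⟩
      pred := fun M hM N hN h => by
        clear hN
        induction h using Relation.ReflTransGen.head_induction_on with
        | refl => exact hM
        | head h _ ih => exact (hpred ih h.1 h.2.2).1
      succ_inj := fun I ⟨w, ⟨ew⟩, hw⟩ hI M hM h => by
        obtain ⟨z, ⟨ez⟩⟩ := hall M hM
        exact ⟨z, ⟨ez⟩, (hgood (h.congr ew ez) fun hb => hb.1 ((injective_congr ew).1 hI)).symm.trans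
          hw⟩
      pred_inj := fun I hI hinj N hN h => ⟨(hpred hI hN h).2 hinj, (hpred hI hN h).1⟩ }

end TiltedTree

theorem lemma3p2 {k : Type u} [Field k] [IsAlgClosed k]
    {C : Type u} [Ring C] [Algebra k C] [FiniteDimensional k C]
    (hconn : TiltedTree.IsConnectedAlg C)
    {ι : Type*} [Fintype ι] (e : ι → C) (he : TiltedTree.IsPointSystem e)
    (hC : TiltedTree.IsTiltedOfTreeType k C)
    (S : Set (ModuleCat.{u} Cᵐᵒᵖ)) (hS : TiltedTree.IsRightmostSlice k S) :
    ∃ x : ι, TiltedTree.IsStrongSink k (e x) ∧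
      ∃ G : Set (ModuleCat.{u} Cᵐᵒᵖ), TiltedTree.IsCompletion k S (e x) G := by
  exact hS.exists_completion e he hC
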